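/- **Setting.** Let $d\ge 1$ and $\langle x\rangle=(1+|x|^2)^{1/2}$. Let $\omega_1,\omega_2:\mathbb R^d\to\mathbb R$ extend analytically to a strip $\{z\in\mathbb C^d:|\operatorname{Im}z_i|<2R\ \forall i\}$, $R>0$, and suppose that for real numbers $s_1\le s_2$, $s_2>0$ and some $C_0>0$ one has $|\partial^\alpha\omega_j(k)|\le C_0\langle k\rangle^{s_j}$ $(|\alpha|\le1)$ and $|\omega_j(k)|\ge\frac1{C_0}\langle k\rangle^{s_j}-C_0$ on this strip, $j=1,2$. For $\xi\in\mathbb R^d$ put $$\omega_\xi(k)=\omega_1(\xi-k)+\omega_2(k),\qquad v_\xi(k)=e^{-k^2-\xi^2}\nabla\omega_\xi(k),\qquad A=\tfrac{i}{2}(v_\xi\cdot\nabla+\nabla\cdot v_\xi),\qquad g(h)=\langle h\rangle^{2s_2}e^{-h^2},$$ let $M_f$ be multiplication by $f$, and $H_0(\xi)=M_{\omega_\xi}$. Let $\hat V\in L^1_{\mathrm{loc}}(\mathbb R^d)$ be the Fourier transform of the potential $V$, $\check V(k)=\hat V(-k)$, and $T_0f=\check V*f$. Commutators $\operatorname{ad}_A^0(T_0)=T_0$,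 $\operatorname{ad}_A^{k+1}(T_0)=[\operatorname{ad}_A^k(T_0),A]$ are forms on $C_0^\infty(\mathbb R^d)$. A bound $\|Q\|\le N$ for a form $Q$ on $C_0^\infty(\mathbb R^d)$ means that $Q$ is given by a bounded operator on $L^2(\mathbb R^d)$ of norm at most $N$. A ($d$-dimensional) polyindex is a finitely supported function $\beta:\mathbb N_0\to\mathbb N_0^d$; put $|\beta_\sigma|=\sum_i\beta_\sigma(i)$, $|\beta|=\sum_\sigma|\beta_\sigma|$, $\|\beta\|=\sum_{\sigma,i}\beta_\sigma(i)(i+1)$, $\beta\bar!=\prod_{\sigma,i}(i!)^{\beta_\sigma(i)}$. For $d$-dimensional polyindices $\beta,b$ let $\gamma=\gamma_{\beta,b}\in\mathbb N_0^d$, $\gamma_\sigma=|\beta_\sigma|+|b_\sigma|$, and let $T_{\beta,b}$ be the convolution with the Fourier transform of $(-1)^{|b|}(-x)^{\gamma}V(-x)$, that is, with the distribution $(-1)^{|b|}(-i)^{|\gamma|}\partial^\gamma\check V$. For $K,c>0$ consider the bounds, for all $d$-dimensional polyindices $\beta,b$, $$\|M_{g^{|\beta|}}\,T_{\beta,b}\,M_{(\omega_\xi+i)^{-1}g^{|b|}}\|\le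 K\,c^{|\beta+b|}\,\gamma_{\beta,b}!\qquad(1)$$ $$\|T_{\beta,b}\,(H_0(\xi)+i)^{-1}\|\le K\,c^{|\beta+b|}\,\gamma_{\beta,b}!\qquad(2)$$ **Theorem.** There is a constant $c_d>0$, depending only on $d$, such that for every $k\ge 0$ the number of quadruples $(\alpha,\beta,a,b)$ of polyindices ($\alpha,a$ of dimension $1$; $\beta,b$ of dimension $d$) with $\|\alpha\|+\|\beta\|+\|a\|+\|b\|=k$ is at most $c_d^k$, and the following holds for all $\omega_1,\omega_2$ as above. (i) There is a continuous function $\xi\mapsto C''_\xi>0$, independent of $V$, such that, with $D_v=i v_\xi\cdot\nabla$ and $w=\frac i2\operatorname{div}v_\xi$, $$\Bigl|\prod_i (D_v^iw)(h)^{\alpha(i)}\prod_{\sigma,i}(D_v^iv_{\xi,\sigma})(h)^{\beta_\sigma(i)}\Bigr|\le (C''_\xi)^{\|\alpha\|+\|\beta\|}\,g(h)^{|\beta|}\,\alpha\bar!\,\beta\bar!$$ for all $\xi,h\in\mathbb R^d$ and all polyindices $\alpha$ (of dimension $1$) and $\beta$ (of dimension $d$), and such that for every $c>0$ there is $C>1$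 with the following property: whenever (1) holds for some $\hat V$, $\xi$ and $K$ with this $c$, then for all $k\ge0$ $$\|\operatorname{ad}_A^k(T_0)(H_0(\xi)+i)^{-1}\|\le K\,(C\,C''_\xi\,c_d)^k\,k!.$$ (ii) For every $c>0$ there is $c'>0$ such that, for all $\hat V$, $\xi$, $K$, (2) with constants $K,c$ implies (1) with constants $K,c'$. (iii) Let $K,c>0$; derivatives $\hat V^{(\alpha)}$ are weak derivatives. * (Weak $L^s$.) Let $s>1$, $\max\{\frac12,1-\frac{s_2}{d}\}<\frac1s\le\frac2d$, and let $\|f\|_{s,w}=\sup_{t>0}t\,|\{|f|>t\}|^{1/s}$. Let $\xi\in\mathbb R^d$, and in case $s_1=s_2$ suppose that there is $L>0$ with $|\omega_\xi(k)|\ge\frac1L\langle k\rangle^{s_2}-L$ for all $k\in\mathbb R^d$. Then there is $K'>0$, independent of $\hat V$, $K$ and $c$, such that $\|\hat V^{(\alpha)}\|_{s,w}\le K\,\alpha!\,c^{|\alpha|}$ for all $\alpha\in\mathbb N_0^d$ implies (2) with constants $K'K$, $c$. * ($L^1$.) If $\|\hat V^{(\alpha)}\|_1\le K\,\alpha!\,c^{|\alpha|}$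 for all $\alpha\in\mathbb N_0^d$, then (2) holds with constants $K$, $c$, for every $\xi\in\mathbb R^d$. -/

import Mathlib

open MeasureTheory
open scoped ENNReal NNReal

noncomputable section

namespace DispersivePair

/-- Momentum space `ℝ^d` with the Euclidean norm. -/
abbrev RSpace (d : ℕ) : Type := EuclideanSpace ℝ (Fin d)

/-- `ℂ^d` with the Hermitian norm. -/
abbrev CSpace (d : ℕ) : Type := EuclideanSpace ℂ (Fin d)

/-- The Hilbert space `L²(ℝ^d)`. -/
abbrev L2 (d : ℕ) : Type := Lp ℂ 2 (volume : Measure (RSpace d))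

/-! ### Dispersion relations -/

/-- The inclusion of `ℝ^d` into `ℂ^d`. -/
def complexify {d : ℕ} (x : RSpace d) : CSpace d := WithLp.toLp 2 (fun i => (x i : ℂ))

/-- The strip `{z ∈ ℂ^d : |Im z_i| < r for all i}`. -/
def strip (d : ℕ) (r : ℝ) : Set (CSpace d) := {z | ∀ i, |(z i).im| < r}

/-- The Japanese bracket `⟨x⟩ = (1 + |x|²)^(1/2)` (on `ℝ^d` and on `ℂ^d`). -/
def jap {F : Type*} [Norm F] (x : F) : ℝ := Real.sqrt (1 + ‖x‖ ^ 2)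

/-- `ω : ℝ^d → ℝ` has an analytic continuation to the strip of width `2R`, which satisfies there
`|∂^α ω(k)| ≤ C ⟨k⟩^s` for `|α| ≤ 1` and `|ω(k)| ≥ ⟨k⟩^s / C - C`. -/
def IsDispersionRelation {d : ℕ} (R C s : ℝ) (ω : RSpace d → ℝ) : Prop :=
  ∃ Ω : CSpace d → ℂ,
    AnalyticOnNhd ℂ Ω (strip d (2 * R)) ∧
    (∀ x : RSpace d, Ω (complexify x) = (ω x : ℂ)) ∧
    ∀ z ∈ strip d (2 * R),
      ‖Ω z‖ ≤ C * jap z ^ s ∧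
      (∀ σ : Fin d, ‖fderiv ℂ Ω z (EuclideanSpace.single σ 1)‖ ≤ C * jap z ^ s) ∧
      jap z ^ s / C - C ≤ ‖Ω z‖

/-- The standing condition on the two dispersion relations, with growth exponents `s₁ ≤ s₂`,
`s₂ > 0`. -/
structure DispersionCondition {d : ℕ} (ω₁ ω₂ : RSpace d → ℝ) (s₁ s₂ : ℝ) : Prop where
  le : s₁ ≤ s₂
  pos : 0 < s₂
  bounds : ∃ R C : ℝ, 0 < R ∧ 0 < C ∧
    IsDispersionRelation R C s₁ ω₁ ∧ IsDispersionRelation R C s₂ ω₂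

/-- `ω_ξ(k) = ω₁(ξ - k) + ω₂(k)`; the free fiber Hamiltonian `H₀(ξ)` is multiplication by it. -/
def omegaXi {d : ℕ} (ω₁ ω₂ : RSpace d → ℝ) (ξ k : RSpace d) : ℝ := ω₁ (ξ - k) + ω₂ k

/-! ### Derivatives, test functions, forms -/

/-- The partial derivative `∂_σ f`. -/
def pderiv {d : ℕ} {F : Type*} [NormedAddCommGroup F] [NormedSpace ℝ F] (σ : Fin d)
    (f : RSpace d → F) : RSpace d → F :=
  fun x => fderiv ℝ f x (EuclideanSpace.single σ 1)

/-- The iterated partial derivative `∂^γ f = ∂_1^{γ_1} ⋯ ∂_d^{γ_d} f`. -/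
def mderiv {d : ℕ} (γ : Fin d → ℕ) (f : RSpace d → ℂ) : RSpace d → ℂ :=
  (List.finRange d).foldr (fun σ g => (pderiv σ)^[γ σ] g) f

/-- `φ ∈ C₀^∞(ℝ^d)`. -/
structure IsTest {d : ℕ} (φ : RSpace d → ℂ) : Prop where
  smooth : ContDiff ℝ ((⊤ : ℕ∞) : WithTop ℕ∞) φ
  compact : HasCompactSupport φ

theorem IsTest.memLp {d : ℕ} {φ : RSpace d → ℂ} (h : IsTest φ) :
    MemLp φ 2 (volume : Measure (RSpace d)) :=
  h.smooth.continuous.memLp_of_hasCompactSupport h.compact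

/-- `⟨φ, f⟩ = ∫ conj(φ) f`. -/
def pairing {d : ℕ} (φ f : RSpace d → ℂ) : ℂ := ∫ k, (starRingEnd ℂ) (φ k) * f k

/-- The form `q` on `C₀^∞(ℝ^d)` is given by a bounded operator on `L²(ℝ^d)`, of norm at
most `N`. As `C₀^∞(ℝ^d)` is dense, this operator is unique. -/
def FormNormLE {d : ℕ} (q : (RSpace d → ℂ) → (RSpace d → ℂ) → ℂ) (N : ℝ) : Prop :=
  ∃ B : L2 d →L[ℂ] L2 d, ‖B‖ ≤ N ∧
    ∀ (φ ψ : RSpace d → ℂ) (hφ : IsTest φ) (hψ : IsTest ψ),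
      inner ℂ (hφ.memLp.toLp φ) (B (hψ.memLp.toLp ψ)) = q φ ψ

/-! ### Polyindices -/

/-- One-dimensional polyindices: finitely supported functions `ℕ₀ → ℕ₀`. -/
abbrev Polyindex1 : Type := ℕ →₀ ℕ

/-- `d`-dimensional polyindices `β = (β_σ)_σ`, i.e. finitely supported functions `ℕ₀ → ℕ₀^d`. -/
abbrev Polyindex (d : ℕ) : Type := Fin d → Polyindex1

/-- The order `‖α‖ = ∑ α(i) (i+1)` in dimension one. -/
def order1 (α : Polyindex1) : ℕ := α.sum fun i n => n * (i + 1)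

/-- The size `|α| = ∑ α(i)` in dimension one. -/
def size1 (α : Polyindex1) : ℕ := α.sum fun _ n => n

/-- `∏ (i!)^{α(i)}` in dimension one. -/
def barFactorial1 (α : Polyindex1) : ℕ := α.prod fun i n => Nat.factorial i ^ n

/-- The order `‖β‖`. -/
def order {d : ℕ} (β : Polyindex d) : ℕ := ∑ σ, order1 (β σ)

/-- The size `|β|`. -/
def size {d : ℕ} (β : Polyindex d) : ℕ := ∑ σ, size1 (β σ)

/-- `∏_σ ∏_i (i!)^{β_σ(i)}`, the ratio of the order factorial and the reduced order factorial. -/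
def barFactorial {d : ℕ} (β : Polyindex d) : ℕ := ∏ σ, barFactorial1 (β σ)

/-- The multiindex `(γ_{β,b})_σ = |β_σ| + |b_σ|`. -/
def gam {d : ℕ} (β b : Polyindex d) : Fin d → ℕ := fun σ => size1 (β σ) + size1 (b σ)

/-- `γ! = ∏_σ γ_σ!`. -/
def mfactorial {d : ℕ} (γ : Fin d → ℕ) : ℕ := ∏ σ, Nat.factorial (γ σ)

/-- `|γ| = ∑_σ γ_σ`. -/
def msize {d : ℕ} (γ : Fin d → ℕ) : ℕ := ∑ σ, γ σ

/-- The quadruples `(α, β, a, b)` with `‖α‖ + ‖β‖ + ‖a‖ + ‖b‖ = k`, which index the terms of the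
`k`-th iterated commutator. -/
def indexSet (d k : ℕ) : Set (Polyindex1 × Polyindex d × Polyindex1 × Polyindex d) :=
  {x | order1 x.1 + order x.2.1 + order1 x.2.2.1 + order x.2.2.2 = k}

/-! ### The conjugate operator -/

section Conjugate

variable {d : ℕ} (ω₁ ω₂ : RSpace d → ℝ) (ξ : RSpace d)

/-- The components of the vector field `v_ξ(k) = exp(-k² - ξ²) ∇ω_ξ(k)`. -/
def vField (σ : Fin d) (k : RSpace d) : ℝ :=
  Real.exp (-‖k‖ ^ 2 - ‖ξ‖ ^ 2) * pderiv σ (omegaXi ω₁ ω₂ ξ) k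

/-- `A = (i/2) (v_ξ · ∇ + ∇ · v_ξ)`, acting on functions. -/
def opA (ψ : RSpace d → ℂ) : RSpace d → ℂ := fun k =>
  (Complex.I / 2) *
    ((∑ σ, (vField ω₁ ω₂ ξ σ k : ℂ) * pderiv σ ψ k) +
      ∑ σ, pderiv σ (fun x => (vField ω₁ ω₂ ξ σ x : ℂ) * ψ x) k)

/-- The derivation `D_v = i v_ξ · ∇`. -/
def opD (f : RSpace d → ℂ) : RSpace d → ℂ := fun k =>
  Complex.I * ∑ σ, (vField ω₁ ω₂ ξ σ k : ℂ) * pderiv σ f k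

/-- `w = (i/2) div v_ξ`. -/
def wFun (k : RSpace d) : ℂ :=
  (Complex.I / 2) * ∑ σ, pderiv σ (fun x => (vField ω₁ ω₂ ξ σ x : ℂ)) k

/-- The function `∏_i (D_v^i w)^{α(i)} ∏_σ ∏_i (D_v^i v_{ξ,σ})^{β_σ(i)}`, multiplication by which
is the operator `M_{α,β}`. -/
def fAlphaBeta (α : Polyindex1) (β : Polyindex d) (h : RSpace d) : ℂ :=
  (α.prod fun i n => ((opD ω₁ ω₂ ξ)^[i] (wFun ω₁ ω₂ ξ) h) ^ n) *
    ∏ σ, (β σ).prod fun i n =>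
      ((opD ω₁ ω₂ ξ)^[i] (fun x => (vField ω₁ ω₂ ξ σ x : ℂ)) h) ^ n

/-- `(H₀(ξ) + i)⁻¹`, multiplication by `(ω_ξ + i)⁻¹`. -/
def resolvent (ψ : RSpace d → ℂ) : RSpace d → ℂ := fun k =>
  ((omegaXi ω₁ ω₂ ξ k : ℂ) + Complex.I)⁻¹ * ψ k

end Conjugate

/-- The weight `⟨h⟩^{2s} exp(-h²)`. -/
def weight {d : ℕ} (s : ℝ) (h : RSpace d) : ℝ := jap h ^ (2 * s) * Real.exp (-‖h‖ ^ 2)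

/-! ### The interaction -/

/-- `S_{V̌} f = V̌ * f` with `V̌(u) = V̂(-u)`. -/
def convCheck {d : ℕ} (Vhat : RSpace d → ℂ) (f : RSpace d → ℂ) : RSpace d → ℂ := fun k =>
  ∫ u, Vhat (-u) * f (k - u)

/-- `T_{β,b}`, convolution with the Fourier transform of `(-1)^{|b|} (-x)^γ V(-x)`, `γ = γ_{β,b}`.
As `-i x_σ` on the Fourier side is `∂_σ`, this Fourier transform is the distribution
`(-1)^{|b|} (-i)^{|γ|} ∂^γ V̌`, and the derivatives of a convolution may be put on the test
function `f`. In particular `T_{0,0} = S_{V̌}`. -/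
def opT {d : ℕ} (Vhat : RSpace d → ℂ) (β b : Polyindex d) (f : RSpace d → ℂ) : RSpace d → ℂ :=
  fun k => (-1) ^ size b * (-Complex.I) ^ msize (gam β b) *
    convCheck Vhat (mderiv (gam β b) f) k

/-- The form `⟨φ, ad_A^k(T₀) ψ⟩` on `C₀^∞(ℝ^d)`, where `T₀ = S_{V̌}`,
`ad_A^0(T₀) = T₀` and `ad_A^{k+1}(T₀) = [ad_A^k(T₀), A]`. -/
def adForm {d : ℕ} (ω₁ ω₂ : RSpace d → ℝ) (Vhat : RSpace d → ℂ) (ξ : RSpace d) :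
    ℕ → (RSpace d → ℂ) → (RSpace d → ℂ) → ℂ
  | 0, φ, ψ => pairing φ (convCheck Vhat ψ)
  | k + 1, φ, ψ =>
      adForm ω₁ ω₂ Vhat ξ k φ (opA ω₁ ω₂ ξ ψ) - adForm ω₁ ω₂ Vhat ξ k (opA ω₁ ω₂ ξ φ) ψ

/-- `‖ad_A^k(T₀) (H₀(ξ) + i)⁻¹‖ ≤ N`. -/
def AdNormLE {d : ℕ} (ω₁ ω₂ : RSpace d → ℝ) (Vhat : RSpace d → ℂ) (ξ : RSpace d) (k : ℕ)
    (N : ℝ) : Prop :=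
  FormNormLE (fun φ ψ => adForm ω₁ ω₂ Vhat ξ k φ (resolvent ω₁ ω₂ ξ ψ)) N

/-- `‖M_{g^{|β|}} T_{β,b} M_{(ω_ξ + i)⁻¹ g^{|b|}}‖ ≤ K c^{|β+b|} γ_{β,b}!` for all polyindices
`β`, `b`, where `g(h) = ⟨h⟩^{2s₂} exp(-h²)`. -/
def WeightedBounds {d : ℕ} (ω₁ ω₂ : RSpace d → ℝ) (s₂ : ℝ) (Vhat : RSpace d → ℂ)
    (ξ : RSpace d) (K c : ℝ) : Prop :=
  ∀ β b : Polyindex d,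
    FormNormLE
      (fun φ ψ => pairing φ (fun h => (weight s₂ h : ℂ) ^ size β *
        opT Vhat β b (resolvent ω₁ ω₂ ξ (fun h' => (weight s₂ h' : ℂ) ^ size b * ψ h')) h))
      (K * c ^ size (β + b) * mfactorial (gam β b))

/-- `‖T_{β,b} (H₀(ξ) + i)⁻¹‖ ≤ K c^{|β+b|} γ_{β,b}!` for all polyindices `β`, `b`. -/
def ResolventBounds {d : ℕ} (ω₁ ω₂ : RSpace d → ℝ) (Vhat : RSpace d → ℂ)
    (ξ : RSpace d) (K c : ℝ) : Prop :=
  ∀ β b : Polyindex d,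
    FormNormLE (fun φ ψ => pairing φ (opT Vhat β b (resolvent ω₁ ω₂ ξ ψ)))
      (K * c ^ size (β + b) * mfactorial (gam β b))

/-! ### Conditions on `V̂` -/

/-- `U` is the weak derivative `∂^α f`. -/
def IsWeakDeriv {d : ℕ} (α : Fin d → ℕ) (f U : RSpace d → ℂ) : Prop :=
  LocallyIntegrable U ∧
    ∀ φ : RSpace d → ℂ, IsTest φ →
      ∫ x, f x * mderiv α φ x = (-1) ^ msize α * ∫ x, U x * φ x

/-- The weak `L^s` norm `sup_{t > 0} t |{|f| > t}|^{1/s}`. -/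
def weakNorm {d : ℕ} (s : ℝ) (f : RSpace d → ℂ) : ℝ≥0∞ :=
  ⨆ t : ℝ≥0, (t : ℝ≥0∞) * volume {x | (t : ℝ) < ‖f x‖} ^ (1 / s)

/-- `‖V̂^{(α)}‖_{s,w} ≤ K α! c^{|α|}` for all multiindices `α`. -/
def WeakLsBounds {d : ℕ} (s : ℝ) (Vhat : RSpace d → ℂ) (K c : ℝ) : Prop :=
  ∀ α : Fin d → ℕ, ∃ U : RSpace d → ℂ, IsWeakDeriv α Vhat U ∧
    weakNorm s U ≤ ENNReal.ofReal (K * mfactorial α * c ^ msize α)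

/-- `‖V̂^{(α)}‖_1 ≤ K α! c^{|α|}` for all multiindices `α`. -/
def L1Bounds {d : ℕ} (Vhat : RSpace d → ℂ) (K c : ℝ) : Prop :=
  ∀ α : Fin d → ℕ, ∃ U : RSpace d → ℂ, IsWeakDeriv α Vhat U ∧
    eLpNorm U 1 volume ≤ ENNReal.ofReal (K * mfactorial α * c ^ msize α)

end DispersivePair

end

open DispersivePair

/-!
Throughout, `D_v = i v_ξ · ∇` and `w = (i/2) div v_ξ`, so that `A = D_v + w`.

**Commutators.** For `f`, `h` smooth, `T_{p,q}` the convolution operator `T_{β,b}` with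
`p_σ = |β_σ|`, `q_σ = |b_σ|`, and `e_σ` a unit multiindex, the product rule gives
`[M_f T_{p,q} M_h, A] = ∑_σ (M_f T_{p,q+e_σ} M_{v_σ h} + M_{v_σ f} T_{p+e_σ,q} M_h)`
`- M_{D_v f} T_{p,q} M_h - M_f T_{p,q} M_{D_v h} - M_{w f} T_{p,q} M_h - M_f T_{p,q} M_{w h}`
(`blockForm_commutator`), an operator of the same kind. Instead of expanding `ad_A^k(T₀)` into
products indexed by quadruples of polyindices, the proof keeps track of `f` and `h` only through
the bounds `|D_v^j f| ≤ W C^j n(n+1)⋯(n+j-1) g^m` for all `j` (`IterBound`). By Leibniz' rule these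
are stable under products (with `n` and `m` additive), and `D_v` turns `(n, W)` into
`(n + 1, n C W)`. So one commutator costs a factor linear in the order, and induction on `k`
yields `k!` times a `k`-th power (`WeightedBounds.norm_adIter_le`). The weights `g^m` in the bounds
of `f` and `h` are what the weighted bounds on `T_{β,b}` absorb.

**Iterated derivatives.** The bounds `C^{i+1} i!` for `D_v^i w` and `D_v^i v_σ` come from Cauchy's
estimate on strips that shrink by `r / (i + 1)` in each step
(`norm_iterate_opDC_complexify_le`). The factor `exp(-k² - ξ²)` makes the constant uniform in `ξ`,
so that a constant function can serve as `C''`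
(`DispersionCondition.exists_iterate_bound`).

**Bounds on the interaction.** A sesquilinear form on test functions that is bounded in the `L²` norm
comes from a bounded operator (`IsSesquilinear.formNormLE`), so all bounds are bounds of forms.
Part (ii) holds because `g` is bounded. For part (iii), the derivatives are moved from the
test function to `V̂`, and the resulting convolution is estimated by a three-factor Hölder inequality
(`lintegral_convolution_le`) which uses the resolvent as a multiplier in `L^{t/(t-1)}`,
`1 ≤ t ≤ 2`. A function in weak `L^s` is cut at its norm into a part in `L^1` and a
part in `L^t` with `t` slightly above `s`; the strict inequality in the assumption on `s` leaves
room for such a `t` (`exists_weakLs_bound`).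

The number of quadruples is bounded through the bound `3^k` for the number of one-dimensional
polyindices of order at most `k` (`finite_order1_le`).
-/

namespace DispersivePair

open scoped ContDiff

/-! ### Partial derivatives of smooth functions -/

/-- `f ∈ C^∞(ℝ^d)`. -/
abbrev IsSmooth {d : ℕ} {F : Type*} [NormedAddCommGroup F] [NormedSpace ℝ F]
    (f : RSpace d → F) : Prop := ContDiff ℝ ∞ f

section Calculus

variable {d : ℕ} {F : Type*} [NormedAddCommGroup F] [NormedSpace ℝ F]

theorem IsSmooth.differentiable {f : RSpace d → F} (hf : IsSmooth f) : Differentiable ℝ f :=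
  ContDiff.differentiable hf (by simp)

theorem IsSmooth.pderiv {f : RSpace d → F} (hf : IsSmooth f) (σ : Fin d) :
    IsSmooth (pderiv σ f) := by
  have h : IsSmooth (fderiv ℝ f) := ContDiff.fderiv_right hf (by simp)
  exact h.clm_apply contDiff_const

theorem pderiv_add {f g : RSpace d → F} (hf : IsSmooth f) (hg : IsSmooth g) (σ : Fin d) :
    pderiv σ (fun x => f x + g x) = fun x => pderiv σ f x + pderiv σ g x := by
  funext x
  simp only [pderiv]
  rw [fderiv_fun_add (hf.differentiable x) (hg.differentiable x)]
  rfl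

theorem pderiv_const_mul {f : RSpace d → ℂ} (hf : IsSmooth f) (a : ℂ) (σ : Fin d) :
    pderiv σ (fun x => a * f x) = fun x => a * pderiv σ f x := by
  funext x
  simp only [pderiv]
  rw [fderiv_const_mul (hf.differentiable x)]
  rfl

theorem pderiv_mul {f g : RSpace d → ℂ} (hf : IsSmooth f) (hg : IsSmooth g) (σ : Fin d) :
    pderiv σ (fun x => f x * g x) = fun x => f x * pderiv σ g x + pderiv σ f x * g x := by
  funext x
  simp only [pderiv]
  rw [fderiv_fun_mul (hf.differentiable x) (hg.differentiable x)]
  simp [mul_comm]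

theorem pderiv_comm {f : RSpace d → F} (hf : IsSmooth f) (σ τ : Fin d) :
    pderiv σ (pderiv τ f) = pderiv τ (pderiv σ f) := by
  have h : Differentiable ℝ (fderiv ℝ f) :=
    (ContDiff.fderiv_right hf (m := ∞) (by simp)).differentiable (by simp)
  have key (σ τ : Fin d) (x : RSpace d) : pderiv σ (pderiv τ f) x =
      fderiv ℝ (fderiv ℝ f) x (EuclideanSpace.single σ 1) (EuclideanSpace.single τ 1) := by
    change fderiv ℝ (fun y => fderiv ℝ f y (EuclideanSpace.single τ 1)) x _ = _
    rw [fderiv_clm_apply (h x) (differentiableAt_const _)]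
    simp
  funext x
  rw [key, key]
  exact ((contDiff_infty.1 hf 2).contDiffAt.isSymmSndFDerivAt (by simp)).eq _ _

theorem pderiv_conj {f : RSpace d → ℂ} (σ : Fin d) :
    pderiv σ (fun x => (starRingEnd ℂ) (f x)) = fun x => (starRingEnd ℂ) (pderiv σ f x) := by
  funext x
  have := Complex.conjCLE.comp_fderiv (f := f) (x := x)
  have h2 := congrArg (fun L => L (EuclideanSpace.single σ (1 : ℝ))) this
  simpa [pderiv, Function.comp_def] using h2

theorem IsSmooth.conj {f : RSpace d → ℂ} (hf : IsSmooth f) :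
    IsSmooth (fun x => (starRingEnd ℂ) (f x)) :=
  Complex.conjCLE.contDiff.comp hf

theorem IsSmooth.ofReal {f : RSpace d → ℝ} (hf : IsSmooth f) :
    IsSmooth (fun x => (f x : ℂ)) :=
  Complex.ofRealCLM.contDiff.comp hf

theorem pderiv_ofReal {f : RSpace d → ℝ} (hf : IsSmooth f) (σ : Fin d) :
    pderiv σ (fun x => (f x : ℂ)) = fun x => ((pderiv σ f x : ℝ) : ℂ) := by
  funext x
  have := fderiv_comp x (Complex.ofRealCLM.differentiableAt) (hf.differentiable x)
  have h2 := congrArg (fun L => L (EuclideanSpace.single σ (1 : ℝ))) this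
  simpa [pderiv, Function.comp_def] using h2

theorem pderiv_comp_add_left (f : RSpace d → F) (σ : Fin d) (k : RSpace d) :
    pderiv σ (fun x => f (k + x)) = fun x => pderiv σ f (k + x) := by
  funext x
  simp only [pderiv]
  rw [fderiv_comp_add_left]

/-! ### Test functions -/

theorem IsTest.isSmooth {φ : RSpace d → ℂ} (h : IsTest φ) : IsSmooth φ := h.smooth

theorem IsTest.pderiv {φ : RSpace d → ℂ} (h : IsTest φ) (σ : Fin d) : IsTest (pderiv σ φ) where
  smooth := h.isSmooth.pderiv σ
  compact := h.compact.fderiv_apply (𝕜 := ℝ) _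

theorem IsTest.mul_left {φ f : RSpace d → ℂ} (h : IsTest φ) (hf : IsSmooth f) :
    IsTest (fun x => f x * φ x) where
  smooth := hf.mul h.isSmooth
  compact := h.compact.mul_left

theorem IsTest.const_mul {φ : RSpace d → ℂ} (h : IsTest φ) (a : ℂ) :
    IsTest (fun x => a * φ x) := h.mul_left contDiff_const

theorem IsTest.add {φ ψ : RSpace d → ℂ} (h : IsTest φ) (h' : IsTest ψ) :
    IsTest (fun x => φ x + ψ x) where
  smooth := h.isSmooth.add h'.isSmooth
  compact := h.compact.add h'.compact

theorem IsTest.zero : IsTest (fun _ : RSpace d => (0 : ℂ)) where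
  smooth := contDiff_const
  compact := HasCompactSupport.zero

theorem IsTest.sum {ι : Type*} (s : Finset ι) {φ : ι → RSpace d → ℂ} (h : ∀ i, IsTest (φ i)) :
    IsTest (fun x => ∑ i ∈ s, φ i x) := by
  classical
  induction s using Finset.induction_on with
  | empty => simpa using IsTest.zero
  | insert a s ha ih => simpa [Finset.sum_insert ha] using (h a).add ih

theorem IsTest.conj {φ : RSpace d → ℂ} (h : IsTest φ) :
    IsTest (fun x => (starRingEnd ℂ) (φ x)) where
  smooth := h.isSmooth.conj
  compact := h.compact.comp_left (g := starRingEnd ℂ) (map_zero _)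

theorem IsTest.comp_add_left {φ : RSpace d → ℂ} (h : IsTest φ) (k : RSpace d) :
    IsTest (fun x => φ (k + x)) where
  smooth := h.isSmooth.comp (contDiff_const.add contDiff_id)
  compact := h.compact.comp_homeomorph (Homeomorph.addLeft k)

theorem IsTest.integrable {φ : RSpace d → ℂ} (h : IsTest φ) : Integrable φ :=
  h.isSmooth.continuous.integrable_of_hasCompactSupport h.compact

/-! ### Mixed partial derivatives -/

/-- An iterated partial derivative over a list of directions; `mderiv` is the case of
`List.finRange d`. -/
noncomputable def mderivList (l : List (Fin d)) (γ : Fin d → ℕ) (f : RSpace d → ℂ) : RSpace d → ℂ :=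
  l.foldr (fun σ g => (pderiv σ)^[γ σ] g) f

theorem mderivList_cons (σ : Fin d) (l : List (Fin d)) (γ : Fin d → ℕ) (f : RSpace d → ℂ) :
    mderivList (σ :: l) γ f = (pderiv σ)^[γ σ] (mderivList l γ f) := rfl

/-- Every property of functions that the partial derivatives preserve is preserved
by `mderivList`. -/
theorem mderivList_induction {P : (RSpace d → ℂ) → Prop} (hP : ∀ f σ, P f → P (pderiv σ f))
    (l : List (Fin d)) (γ : Fin d → ℕ) {f : RSpace d → ℂ} (hf : P f) : P (mderivList l γ f) := by
  induction l with
  | nil => exact hf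
  | cons σ l ih =>
    rw [mderivList_cons]
    generalize γ σ = n
    induction n with
    | zero => exact ih
    | succ n ihn => rw [Function.iterate_succ_apply']; exact hP _ _ ihn

theorem IsSmooth.mderivList {f : RSpace d → ℂ} (hf : IsSmooth f) (l : List (Fin d))
    (γ : Fin d → ℕ) : IsSmooth (mderivList l γ f) :=
  mderivList_induction (P := IsSmooth) (fun _ σ h => h.pderiv σ) l γ hf

theorem IsTest.mderiv {f : RSpace d → ℂ} (hf : IsTest f) (γ : Fin d → ℕ) :
    IsTest (mderiv γ f) :=
  mderivList_induction (P := IsTest) (fun _ σ h => h.pderiv σ) _ γ hf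

/-- An operator that commutes with all partial derivatives on a class of functions stable under
them commutes with `mderiv`. -/
theorem map_mderiv {P : (RSpace d → ℂ) → Prop} (hP : ∀ f σ, P f → P (pderiv σ f))
    {S : (RSpace d → ℂ) → (RSpace d → ℂ)} (hS : ∀ f σ, P f → S (pderiv σ f) = pderiv σ (S f))
    (γ : Fin d → ℕ) {f : RSpace d → ℂ} (hf : P f) : S (mderiv γ f) = mderiv γ (S f) := by
  change S (mderivList _ γ f) = mderivList _ γ (S f)
  induction List.finRange d with
  | nil => rfl
  | cons σ l ih =>
    rw [mderivList_cons, mderivList_cons, ← ih]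
    have hg : P (mderivList l γ f) := mderivList_induction hP l γ hf
    generalize mderivList l γ f = g at hg
    induction γ σ generalizing g with
    | zero => rfl
    | succ n ihn =>
      rw [Function.iterate_succ_apply, Function.iterate_succ_apply, ihn _ (hP _ _ hg), hS _ _ hg]

theorem mderiv_pderiv (γ : Fin d → ℕ) (σ : Fin d) {f : RSpace d → ℂ} (hf : IsSmooth f) :
    mderiv γ (pderiv σ f) = pderiv σ (mderiv γ f) :=
  (map_mderiv (P := IsSmooth) (S := pderiv σ) (fun _ τ h => h.pderiv τ)
    (fun _ τ h => pderiv_comm h σ τ) γ hf).symm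

theorem mderiv_add_single (γ : Fin d → ℕ) (σ : Fin d) {f : RSpace d → ℂ} (hf : IsSmooth f) :
    mderiv (γ + Pi.single σ 1) f = mderiv γ (pderiv σ f) := by
  rw [mderiv_pderiv γ σ hf]
  change mderivList _ _ f = pderiv σ (mderivList _ γ f)
  have hnot (l : List (Fin d)) (h : σ ∉ l) :
      mderivList l (γ + Pi.single σ 1) f = mderivList l γ f := by
    induction l with
    | nil => rfl
    | cons τ l ih =>
      rw [List.mem_cons, not_or] at h
      rw [mderivList_cons, mderivList_cons, ih h.2]
      have : (Pi.single σ 1 : Fin d → ℕ) τ = 0 := Pi.single_eq_of_ne (Ne.symm h.1) _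
      simp [this]
  have hmem (l : List (Fin d)) (hl : l.Nodup) (h : σ ∈ l) :
      mderivList l (γ + Pi.single σ 1) f = pderiv σ (mderivList l γ f) := by
    induction l with
    | nil => simp at h
    | cons τ l ih =>
      rw [List.nodup_cons] at hl
      rw [mderivList_cons, mderivList_cons]
      by_cases hτ : τ = σ
      · subst hτ
        rw [hnot l hl.1]
        simp [Function.iterate_succ_apply']
      · have h0 : (Pi.single σ 1 : Fin d → ℕ) τ = 0 := Pi.single_eq_of_ne hτ _
        have hl' : σ ∈ l := by
          rcases List.mem_cons.1 h with h | h
          · exact absurd h.symm hτ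
          · exact h
        rw [ih hl.2 hl', Pi.add_apply, h0, add_zero]
        have hg := hf.mderivList l γ
        generalize mderivList l γ f = g at hg
        induction γ τ generalizing g with
        | zero => rfl
        | succ n ihn =>
          rw [Function.iterate_succ_apply, Function.iterate_succ_apply, ← ihn _ (hg.pderiv τ),
            pderiv_comm hg]
  exact hmem _ (List.nodup_finRange d) (List.mem_finRange σ)

theorem mderivList_add (l : List (Fin d)) (γ : Fin d → ℕ) {f g : RSpace d → ℂ} (hf : IsSmooth f)
    (hg : IsSmooth g) :
    mderivList l γ (fun x => f x + g x) = fun x => mderivList l γ f x + mderivList l γ g x := by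
  induction l with
  | nil => rfl
  | cons σ l ih =>
    simp only [mderivList_cons]
    rw [ih]
    have hf' := hf.mderivList l γ
    have hg' := hg.mderivList l γ
    generalize mderivList l γ f = f' at hf'
    generalize mderivList l γ g = g' at hg'
    induction γ σ generalizing f' g' with
    | zero => rfl
    | succ n ihn =>
      rw [Function.iterate_succ_apply, pderiv_add hf' hg', ihn _ (hf'.pderiv σ) _ (hg'.pderiv σ)]
      rfl

theorem mderiv_add (γ : Fin d → ℕ) {f g : RSpace d → ℂ} (hf : IsSmooth f) (hg : IsSmooth g) :
    mderiv γ (fun x => f x + g x) = fun x => mderiv γ f x + mderiv γ g x :=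
  mderivList_add _ γ hf hg

theorem mderiv_const_mul (γ : Fin d → ℕ) (a : ℂ) {f : RSpace d → ℂ} (hf : IsSmooth f) :
    mderiv γ (fun x => a * f x) = fun x => a * mderiv γ f x :=
  (map_mderiv (P := IsSmooth) (S := fun f x => a * f x) (fun _ τ h => h.pderiv τ)
    (fun _ τ h => (pderiv_const_mul h a τ).symm) γ hf).symm

theorem mderiv_comp_add_left (γ : Fin d → ℕ) (f : RSpace d → ℂ) (k : RSpace d) :
    mderiv γ (fun x => f (k + x)) = fun x => mderiv γ f (k + x) :=
  (map_mderiv (P := fun _ => True) (S := fun f x => f (k + x)) (fun _ _ _ => trivial)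
    (fun f τ _ => (pderiv_comp_add_left f τ k).symm) γ trivial).symm

/-! ### Convolution with the interaction -/

theorem locallyIntegrable_comp_neg {V : RSpace d → ℂ} (hV : LocallyIntegrable V) :
    LocallyIntegrable (fun u => V (-u)) := by
  rw [locallyIntegrable_iff] at hV ⊢
  intro K hK
  have h := hV (-K) hK.neg
  rw [← (Measure.measurePreserving_neg (volume : Measure (RSpace d))).integrableOn_comp_preimage
    (Homeomorph.neg (RSpace d)).measurableEmbedding] at h
  simpa [Function.comp_def] using h

theorem convCheck_eq_convolution (V f : RSpace d → ℂ) :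
    convCheck V f = convolution (fun u => V (-u)) f (ContinuousLinearMap.mul ℝ ℂ) volume := by
  funext k
  simp [convCheck, convolution_def]

variable {V : RSpace d → ℂ}

theorem isSmooth_convCheck (hV : LocallyIntegrable V) {f : RSpace d → ℂ} (hf : IsTest f) :
    IsSmooth (convCheck V f) := by
  rw [convCheck_eq_convolution]
  exact hf.compact.contDiff_convolution_right _ (locallyIntegrable_comp_neg hV) hf.isSmooth

theorem integrable_convCheck (hV : LocallyIntegrable V) {f : RSpace d → ℂ} (hf : IsTest f)
    (k : RSpace d) : Integrable (fun u => V (-u) * f (k - u)) := by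
  have := hf.compact.convolutionExists_right (ContinuousLinearMap.mul ℝ ℂ)
    (locallyIntegrable_comp_neg hV) hf.isSmooth.continuous k
  simpa [ConvolutionExistsAt] using this

theorem pderiv_convCheck (hV : LocallyIntegrable V) {f : RSpace d → ℂ} (hf : IsTest f)
    (σ : Fin d) : pderiv σ (convCheck V f) = convCheck V (pderiv σ f) := by
  funext k
  have h := hf.compact.hasFDerivAt_convolution_right (ContinuousLinearMap.mul ℝ ℂ)
    (locallyIntegrable_comp_neg hV) (hf.isSmooth.of_le (by simp)) k
  rw [convCheck_eq_convolution]
  simp only [pderiv]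
  rw [h.fderiv, convolution_precompR_apply _ (locallyIntegrable_comp_neg hV)
    (hf.compact.fderiv ℝ) ((ContDiff.fderiv_right hf.isSmooth (m := ∞) (by simp)).continuous)]
  rw [convCheck_eq_convolution]
  rfl

theorem convCheck_add (hV : LocallyIntegrable V) {f g : RSpace d → ℂ} (hf : IsTest f)
    (hg : IsTest g) :
    convCheck V (fun x => f x + g x) = fun x => convCheck V f x + convCheck V g x := by
  funext k
  simp only [convCheck, mul_add]
  exact integral_add (integrable_convCheck hV hf k) (integrable_convCheck hV hg k)

theorem convCheck_const_mul (a : ℂ) (f : RSpace d → ℂ) :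
    convCheck V (fun x => a * f x) = fun x => a * convCheck V f x := by
  funext k
  simp only [convCheck, mul_left_comm _ a]
  exact integral_const_mul a _

/-! ### Convolution with derivatives of the interaction -/

/-- Convolution with `(-1)^{|q|} (-i)^{|p+q|} ∂^{p+q} V̌`: the operator `T_{β,b}` depends on the
polyindices only through `p = (|β_σ|)_σ` and `q = (|b_σ|)_σ`. -/
noncomputable def convT (V : RSpace d → ℂ) (p q : Fin d → ℕ) (f : RSpace d → ℂ) : RSpace d → ℂ :=
  fun k => (-1) ^ msize q * (-Complex.I) ^ msize (p + q) * convCheck V (mderiv (p + q) f) k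

theorem opT_eq_convT (V : RSpace d → ℂ) (β b : Polyindex d) :
    opT V β b = convT V (fun σ => size1 (β σ)) (fun σ => size1 (b σ)) := rfl

theorem mderiv_zero (f : RSpace d → ℂ) : mderiv 0 f = f := by
  change mderivList _ 0 f = f
  induction List.finRange d with
  | nil => rfl
  | cons σ l ih => rw [mderivList_cons, ih]; rfl

theorem convT_zero (V : RSpace d → ℂ) (f : RSpace d → ℂ) : convT V 0 0 f = convCheck V f := by
  funext k
  simp [convT, msize, mderiv_zero]

theorem isSmooth_convT (hV : LocallyIntegrable V) (p q : Fin d → ℕ) {f : RSpace d → ℂ}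
    (hf : IsTest f) : IsSmooth (convT V p q f) :=
  contDiff_const.mul (isSmooth_convCheck hV (hf.mderiv _))

theorem convT_add (hV : LocallyIntegrable V) (p q : Fin d → ℕ) {f g : RSpace d → ℂ}
    (hf : IsTest f) (hg : IsTest g) :
    convT V p q (fun x => f x + g x) = fun x => convT V p q f x + convT V p q g x := by
  funext k
  simp only [convT]
  rw [mderiv_add _ hf.isSmooth hg.isSmooth, convCheck_add hV (hf.mderiv _) (hg.mderiv _), mul_add]

theorem convT_const_mul (p q : Fin d → ℕ) (a : ℂ) {f : RSpace d → ℂ} (hf : IsTest f) :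
    convT V p q (fun x => a * f x) = fun x => a * convT V p q f x := by
  funext k
  simp only [convT]
  rw [mderiv_const_mul _ _ hf.isSmooth, convCheck_const_mul]
  ring

theorem convT_sum (hV : LocallyIntegrable V) (p q : Fin d → ℕ) {ι : Type*} (s : Finset ι)
    {f : ι → RSpace d → ℂ} (hf : ∀ i, IsTest (f i)) :
    convT V p q (fun x => ∑ i ∈ s, f i x) = fun x => ∑ i ∈ s, convT V p q (f i) x := by
  classical
  induction s using Finset.induction_on with
  | empty =>
    have := convT_const_mul (V := V) p q 0 (IsTest.zero (d := d))
    simpa using this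
  | insert a s ha ih =>
    simp only [Finset.sum_insert ha]
    rw [convT_add hV p q (hf a) (IsTest.sum s hf), ih]

theorem pderiv_convT (hV : LocallyIntegrable V) (p q : Fin d → ℕ) (σ : Fin d)
    {f : RSpace d → ℂ} (hf : IsTest f) :
    pderiv σ (convT V p q f) = convT V p q (pderiv σ f) := by
  unfold convT
  rw [pderiv_const_mul (isSmooth_convCheck hV (hf.mderiv _)), pderiv_convCheck hV (hf.mderiv _),
    mderiv_pderiv _ _ hf.isSmooth]

theorem msize_add_single (p : Fin d → ℕ) (σ : Fin d) : msize (p + Pi.single σ 1) = msize p + 1 := by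
  simp [msize, Finset.sum_add_distrib]

theorem convT_add_single_left (p q : Fin d → ℕ) (σ : Fin d) {f : RSpace d → ℂ} (hf : IsSmooth f) :
    convT V (p + Pi.single σ 1) q f = fun k => -Complex.I * convT V p q (pderiv σ f) k := by
  funext k
  simp only [convT]
  rw [add_right_comm p, msize_add_single, mderiv_add_single _ _ hf]
  ring

theorem convT_add_single_right (p q : Fin d → ℕ) (σ : Fin d) {f : RSpace d → ℂ}
    (hf : IsSmooth f) :
    convT V p (q + Pi.single σ 1) f = fun k => Complex.I * convT V p q (pderiv σ f) k := by
  funext k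
  simp only [convT]
  rw [← add_assoc p, msize_add_single, msize_add_single, mderiv_add_single _ _ hf]
  ring

end Calculus

/-! ### Bounded forms on test functions -/

section Forms

variable {d : ℕ}

/-- The `L²` norm of a function. -/
noncomputable def l2norm (φ : RSpace d → ℂ) : ℝ :=
  (eLpNorm φ 2 (volume : Measure (RSpace d))).toReal

theorem l2norm_nonneg (φ : RSpace d → ℂ) : 0 ≤ l2norm φ := ENNReal.toReal_nonneg

theorem IsTest.norm_toLp {φ : RSpace d → ℂ} (h : IsTest φ) : ‖h.memLp.toLp φ‖ = l2norm φ :=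
  Lp.norm_toLp _ _

theorem IsTest.l2norm_le {φ ψ : RSpace d → ℂ} (hφ : IsTest φ) {c : ℝ} (hc : 0 ≤ c)
    (h : ∀ x, ‖ψ x‖ ≤ c * ‖φ x‖) : l2norm ψ ≤ c * l2norm φ := by
  have h1 := eLpNorm_le_mul_eLpNorm_of_ae_le_mul (μ := volume) (Filter.Eventually.of_forall h) 2
  have h2 := ENNReal.toReal_mono
    (ENNReal.mul_ne_top ENNReal.ofReal_ne_top hφ.memLp.eLpNorm_ne_top) h1
  rwa [ENNReal.toReal_mul, ENNReal.toReal_ofReal hc] at h2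

/-- The form `q` is sesquilinear on test functions, conjugate linear in the first argument. -/
structure IsSesquilinear (q : (RSpace d → ℂ) → (RSpace d → ℂ) → ℂ) : Prop where
  add_left : ∀ {φ φ' ψ}, IsTest φ → IsTest φ' → IsTest ψ →
    q (fun x => φ x + φ' x) ψ = q φ ψ + q φ' ψ
  smul_left : ∀ (a : ℂ) {φ ψ}, IsTest φ → IsTest ψ →
    q (fun x => a * φ x) ψ = (starRingEnd ℂ) a * q φ ψ
  add_right : ∀ {φ ψ ψ'}, IsTest φ → IsTest ψ → IsTest ψ' →
    q φ (fun x => ψ x + ψ' x) = q φ ψ + q φ ψ'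
  smul_right : ∀ (a : ℂ) {φ ψ}, IsTest φ → IsTest ψ →
    q φ (fun x => a * ψ x) = a * q φ ψ

/-- `C₀^∞(ℝ^d)` as a space of functions. -/
noncomputable def testSpace (d : ℕ) : Submodule ℂ (RSpace d → ℂ) where
  carrier := {φ | IsTest φ}
  add_mem' := fun h h' => IsTest.add h h'
  zero_mem' := IsTest.zero
  smul_mem' := fun a _ h => IsTest.const_mul h a

theorem isTest_coe (φ : testSpace d) : IsTest (φ : RSpace d → ℂ) := φ.2

/-- The inclusion of `C₀^∞(ℝ^d)` into `L²(ℝ^d)`. -/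
noncomputable def testToL2 (d : ℕ) : testSpace d →ₗ[ℂ] L2 d where
  toFun φ := (IsTest.memLp φ.2).toLp φ
  map_add' _ _ := rfl
  map_smul' _ _ := rfl

theorem testToL2_apply (φ : testSpace d) : testToL2 d φ = (isTest_coe φ).memLp.toLp φ := rfl

theorem denseRange_testToL2 : DenseRange (testToL2 d) := by
  have h := Lp.dense_hasCompactSupport_contDiff (F := ℂ) (μ := (volume : Measure (RSpace d)))
    (p := 2) (by simp)
  refine Dense.mono ?_ h
  rintro f ⟨g, hfg, hg, hg'⟩
  refine ⟨⟨g, hg', hg⟩, ?_⟩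
  exact Lp.ext (((IsTest.memLp (φ := g) ⟨hg', hg⟩).coeFn_toLp).trans hfg.symm)

theorem FormNormLE.nonneg {q : (RSpace d → ℂ) → (RSpace d → ℂ) → ℂ} {N : ℝ}
    (h : FormNormLE q N) : 0 ≤ N :=
  let ⟨_, hB, _⟩ := h
  (norm_nonneg _).trans hB

theorem FormNormLE.norm_le {q : (RSpace d → ℂ) → (RSpace d → ℂ) → ℂ} {N : ℝ}
    (h : FormNormLE q N) {φ ψ : RSpace d → ℂ} (hφ : IsTest φ) (hψ : IsTest ψ) :
    ‖q φ ψ‖ ≤ N * (l2norm φ * l2norm ψ) := by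
  obtain ⟨B, hB, hq⟩ := h
  rw [← hq φ ψ hφ hψ, ← hφ.norm_toLp, ← hψ.norm_toLp]
  calc _ ≤ ‖hφ.memLp.toLp φ‖ * ‖B (hψ.memLp.toLp ψ)‖ := norm_inner_le_norm _ _
    _ ≤ ‖hφ.memLp.toLp φ‖ * (N * ‖hψ.memLp.toLp ψ‖) := by
        gcongr
        exact (B.le_opNorm _).trans (by gcongr)
    _ = _ := by ring

/-- A bounded sesquilinear form on a dense subspace of a Hilbert space is given by a bounded
operator: the Riesz representation theorem in the first argument, then extension by density in the
second. -/
theorem exists_clm_of_sesquilinear {E H : Type*} [AddCommGroup E] [Module ℂ E]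
    [NormedAddCommGroup H] [InnerProductSpace ℂ H] [CompleteSpace H] {ι : E →ₗ[ℂ] H}
    (hι : DenseRange ι) {s : E → E → ℂ} (hal : ∀ φ φ' ψ, s (φ + φ') ψ = s φ ψ + s φ' ψ)
    (hsl : ∀ (a : ℂ) φ ψ, s (a • φ) ψ = (starRingEnd ℂ) a * s φ ψ)
    (har : ∀ φ ψ ψ', s φ (ψ + ψ') = s φ ψ + s φ ψ')
    (hsr : ∀ (a : ℂ) φ ψ, s φ (a • ψ) = a * s φ ψ) {N : ℝ} (hN : 0 ≤ N)
    (h : ∀ φ ψ, ‖s φ ψ‖ ≤ N * ‖ι ψ‖ * ‖ι φ‖) :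
    ∃ B : H →L[ℂ] H, ‖B‖ ≤ N ∧ ∀ φ ψ, inner ℂ (ι φ) (B (ι ψ)) = s φ ψ := by
  let L (ψ : E) : E →ₗ[ℂ] ℂ :=
    { toFun := fun φ => (starRingEnd ℂ) (s φ ψ)
      map_add' := fun φ φ' => by rw [hal, map_add]
      map_smul' := fun a φ => by simp [hsl] }
  have hL (ψ φ : E) : ‖L ψ φ‖ ≤ N * ‖ι ψ‖ * ‖ι φ‖ := by
    change ‖(starRingEnd ℂ) (s φ ψ)‖ ≤ _
    rw [RCLike.norm_conj]
    exact h φ ψ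
  have hex (ψ : E) : ∃ y : H, ‖y‖ ≤ N * ‖ι ψ‖ ∧ ∀ φ, inner ℂ (ι φ) y = s φ ψ := by
    refine ⟨(InnerProductSpace.toDual ℂ H).symm ((L ψ).extendOfNorm ι), ?_, fun φ => ?_⟩
    · rw [LinearIsometryEquiv.norm_map]
      exact LinearMap.opNorm_extendOfNorm_le hι (by positivity) (hL ψ)
    · rw [← inner_conj_symm, InnerProductSpace.toDual_symm_apply,
        LinearMap.extendOfNorm_eq hι ⟨_, hL ψ⟩]
      exact Complex.conj_conj _
  choose y hyn hy using hex
  have huniq (u v : H) (huv : ∀ φ, inner ℂ (ι φ) u = inner ℂ (ι φ) v) : u = v := by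
    have hcont (w : H) : Continuous fun x : H => inner ℂ x w :=
      continuous_id.inner continuous_const
    have := hι.equalizer (hcont u) (hcont v) (funext huv)
    exact ext_inner_left ℂ fun x => congrFun this x
  let Y : E →ₗ[ℂ] H :=
    { toFun := y
      map_add' := fun ψ ψ' => huniq _ _ fun φ => by
        rw [inner_add_right, hy, hy, hy, har]
      map_smul' := fun a ψ => huniq _ _ fun φ => by
        rw [RingHom.id_apply, inner_smul_right, hy, hy, hsr] }
  refine ⟨Y.extendOfNorm ι, LinearMap.opNorm_extendOfNorm_le hι hN hyn, fun φ ψ => ?_⟩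
  rw [LinearMap.extendOfNorm_eq hι ⟨N, hyn⟩]
  exact hy ψ φ

theorem IsSesquilinear.formNormLE {q : (RSpace d → ℂ) → (RSpace d → ℂ) → ℂ}
    (hs : IsSesquilinear q) {N : ℝ} (hN : 0 ≤ N)
    (h : ∀ φ ψ, IsTest φ → IsTest ψ → ‖q φ ψ‖ ≤ N * (l2norm φ * l2norm ψ)) :
    FormNormLE q N := by
  have hιn (φ : testSpace d) : ‖testToL2 d φ‖ = l2norm (φ : RSpace d → ℂ) := by
    rw [testToL2_apply, (isTest_coe φ).norm_toLp]
  have hal (φ φ' ψ : testSpace d) : q (φ + φ' : testSpace d) ψ = q φ ψ + q φ' ψ :=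
    hs.add_left (isTest_coe φ) (isTest_coe φ') (isTest_coe ψ)
  have hsl (a : ℂ) (φ ψ : testSpace d) : q (a • φ : testSpace d) ψ = (starRingEnd ℂ) a * q φ ψ :=
    hs.smul_left a (isTest_coe φ) (isTest_coe ψ)
  have har (φ ψ ψ' : testSpace d) : q φ (ψ + ψ' : testSpace d) = q φ ψ + q φ ψ' :=
    hs.add_right (isTest_coe φ) (isTest_coe ψ) (isTest_coe ψ')
  have hsr (a : ℂ) (φ ψ : testSpace d) : q φ (a • ψ : testSpace d) = a * q φ ψ :=
    hs.smul_right a (isTest_coe φ) (isTest_coe ψ)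
  have hb (φ ψ : testSpace d) : ‖q φ ψ‖ ≤ N * ‖testToL2 d ψ‖ * ‖testToL2 d φ‖ := by
    rw [hιn, hιn, mul_assoc, mul_comm (l2norm _)]
    exact h _ _ (isTest_coe φ) (isTest_coe ψ)
  obtain ⟨B, hB, hBq⟩ := exists_clm_of_sesquilinear (s := fun φ ψ : testSpace d => q φ ψ)
    denseRange_testToL2 hal hsl har hsr hN hb
  exact ⟨B, hB, fun φ ψ hφ hψ => hBq ⟨φ, hφ⟩ ⟨ψ, hψ⟩⟩

/-! ### The pairing -/

theorem IsTest.integrable_pairing {φ f : RSpace d → ℂ} (hφ : IsTest φ) (hf : IsSmooth f) :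
    Integrable (fun k => (starRingEnd ℂ) (φ k) * f k) := by
  have := (hφ.conj.mul_left hf).integrable
  simpa [mul_comm] using this

theorem pairing_add_right {φ f g : RSpace d → ℂ} (hφ : IsTest φ) (hf : IsSmooth f)
    (hg : IsSmooth g) : pairing φ (fun x => f x + g x) = pairing φ f + pairing φ g := by
  simp only [pairing, mul_add]
  exact integral_add (hφ.integrable_pairing hf) (hφ.integrable_pairing hg)

theorem pairing_const_mul_right (a : ℂ) (φ f : RSpace d → ℂ) :
    pairing φ (fun x => a * f x) = a * pairing φ f := by
  simp only [pairing, mul_left_comm _ a]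
  exact integral_const_mul a _

theorem pairing_add_left {φ φ' f : RSpace d → ℂ} (hφ : IsTest φ) (hφ' : IsTest φ')
    (hf : IsSmooth f) : pairing (fun x => φ x + φ' x) f = pairing φ f + pairing φ' f := by
  simp only [pairing, map_add, add_mul]
  exact integral_add (hφ.integrable_pairing hf) (hφ'.integrable_pairing hf)

theorem pairing_const_mul_left (a : ℂ) (φ f : RSpace d → ℂ) :
    pairing (fun x => a * φ x) f = (starRingEnd ℂ) a * pairing φ f := by
  simp only [pairing, map_mul, mul_assoc]
  exact integral_const_mul _ _

theorem pairing_sum_right {ι : Type*} (s : Finset ι) {φ : RSpace d → ℂ} {f : ι → RSpace d → ℂ}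
    (hφ : IsTest φ) (hf : ∀ i, IsSmooth (f i)) :
    pairing φ (fun x => ∑ i ∈ s, f i x) = ∑ i ∈ s, pairing φ (f i) := by
  simp only [pairing, Finset.mul_sum]
  exact integral_finsetSum _ fun i _ => hφ.integrable_pairing (hf i)

/-- A form `⟨φ, S ψ⟩` with a linear map `S` from test functions to smooth functions. -/
theorem isSesquilinear_pairing {S : (RSpace d → ℂ) → (RSpace d → ℂ)}
    (hS : ∀ {ψ}, IsTest ψ → IsSmooth (S ψ))
    (hadd : ∀ {ψ ψ'}, IsTest ψ → IsTest ψ' → S (fun x => ψ x + ψ' x) = fun x => S ψ x + S ψ' x)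
    (hmul : ∀ (a : ℂ) {ψ}, IsTest ψ → S (fun x => a * ψ x) = fun x => a * S ψ x) :
    IsSesquilinear fun φ ψ => pairing φ (S ψ) where
  add_left hφ hφ' hψ := pairing_add_left hφ hφ' (hS hψ)
  smul_left a _ _ _ _ := pairing_const_mul_left a _ _
  add_right hφ hψ hψ' := by
    rw [hadd hψ hψ']
    exact pairing_add_right hφ (hS hψ) (hS hψ')
  smul_right a _ _ hφ hψ := by
    rw [hmul a hψ]
    exact pairing_const_mul_right a _ _

/-- `⟨f̄ φ, F⟩ = ⟨φ, f F⟩`. -/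
theorem pairing_mul_left (f φ F : RSpace d → ℂ) :
    pairing (fun x => f x * φ x) F = pairing φ (fun x => (starRingEnd ℂ) (f x) * F x) := by
  simp only [pairing, map_mul]
  congr 1
  funext k
  ring

/-- Integration by parts. -/
theorem pairing_pderiv_left {φ F : RSpace d → ℂ} (hφ : IsTest φ) (hF : IsSmooth F) (σ : Fin d) :
    pairing (pderiv σ φ) F = -pairing φ (pderiv σ F) := by
  have h := integral_mul_fderiv_eq_neg_fderiv_mul_of_integrable (μ := (volume : Measure (RSpace d)))
    (f := fun x => (starRingEnd ℂ) (φ x)) (g := F) (v := EuclideanSpace.single σ 1)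
    ?_ ?_ ?_ (fun x _ => hφ.conj.isSmooth.differentiable x)
    (fun x _ => hF.differentiable x)
  · change ∫ x, _ * pderiv σ F x = -∫ x, pderiv σ _ x * F x at h
    rw [pderiv_conj] at h
    rw [pairing, pairing, h, neg_neg]
  · exact ((hφ.conj.pderiv σ).mul_left hF).integrable.congr (.of_forall fun x => mul_comm _ _)
  · exact hφ.integrable_pairing (hF.pderiv σ)
  · exact hφ.integrable_pairing hF

end Forms

/-! ### The weight and the resolvent -/

section Weight

variable {d : ℕ}

theorem one_add_norm_sq_pos {F : Type*} [SeminormedAddCommGroup F] (x : F) : 0 < 1 + ‖x‖ ^ 2 := by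
  positivity

theorem one_le_jap {F : Type*} [SeminormedAddCommGroup F] (x : F) : 1 ≤ jap x := by
  rw [jap, Real.one_le_sqrt]
  nlinarith [sq_nonneg ‖x‖]

theorem jap_pos {F : Type*} [SeminormedAddCommGroup F] (x : F) : 0 < jap x :=
  one_pos.trans_le (one_le_jap x)

theorem weight_pos (s : ℝ) (h : RSpace d) : 0 < weight s h :=
  mul_pos (Real.rpow_pos_of_pos (jap_pos h) _) (Real.exp_pos _)

theorem isSmooth_weight (s : ℝ) : IsSmooth (weight (d := d) s) := by
  have h1 : IsSmooth fun x : RSpace d => 1 + ‖x‖ ^ 2 := contDiff_const.add (contDiff_norm_sq ℝ)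
  have h2 : IsSmooth fun x : RSpace d => jap x :=
    h1.sqrt fun x => (one_add_norm_sq_pos x).ne'
  have h3 : IsSmooth fun x : RSpace d => jap x ^ (2 * s) :=
    h2.rpow_const_of_ne fun x => (jap_pos x).ne'
  exact h3.mul ((contDiff_norm_sq ℝ).neg.exp)

theorem exists_weight_le (s : ℝ) : ∃ G : ℝ, 1 ≤ G ∧ ∀ h : RSpace d, weight s h ≤ G := by
  obtain ⟨n, hn⟩ := exists_nat_ge s
  refine ⟨n.factorial * Real.exp 1, ?_, fun h => ?_⟩
  · have h1 : (1 : ℝ) ≤ n.factorial := by exact_mod_cast n.factorial_pos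
    nlinarith [Real.add_one_le_exp (1 : ℝ)]
  · have hpos := one_add_norm_sq_pos h
    have h1 : jap h ^ (2 * s) ≤ (1 + ‖h‖ ^ 2) ^ n := by
      rw [Real.rpow_mul (jap_pos h).le, Real.rpow_two, jap, Real.sq_sqrt hpos.le,
        ← Real.rpow_natCast _ n]
      have h1 : 1 ≤ 1 + ‖h‖ ^ 2 := by linarith [sq_nonneg ‖h‖]
      exact Real.rpow_le_rpow_of_exponent_le h1 hn
    have h2 := Real.pow_div_factorial_le_exp _ hpos.le n
    rw [div_le_iff₀ (by positivity)] at h2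
    calc weight s h ≤ (Real.exp (1 + ‖h‖ ^ 2) * n.factorial) * Real.exp (-‖h‖ ^ 2) :=
          mul_le_mul_of_nonneg_right (h1.trans h2) (Real.exp_pos _).le
      _ = n.factorial * (Real.exp (1 + ‖h‖ ^ 2) * Real.exp (-‖h‖ ^ 2)) := by ring
      _ = _ := by rw [← Real.exp_add]; ring_nf

variable {ω₁ ω₂ : RSpace d → ℝ} {ξ : RSpace d}

theorem ofReal_add_I_ne_zero (t : ℝ) : (t : ℂ) + Complex.I ≠ 0 := by
  intro h
  simpa using congrArg Complex.im h

theorem isSmooth_inv_omegaXi (hω : IsSmooth (omegaXi ω₁ ω₂ ξ)) :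
    IsSmooth fun k => ((omegaXi ω₁ ω₂ ξ k : ℂ) + Complex.I)⁻¹ :=
  (hω.ofReal.add contDiff_const).inv fun _ => ofReal_add_I_ne_zero _

theorem IsTest.resolvent (hω : IsSmooth (omegaXi ω₁ ω₂ ξ)) {ψ : RSpace d → ℂ} (hψ : IsTest ψ) :
    IsTest (resolvent ω₁ ω₂ ξ ψ) := hψ.mul_left (isSmooth_inv_omegaXi hω)

theorem resolvent_add (ψ ψ' : RSpace d → ℂ) : resolvent ω₁ ω₂ ξ (fun x => ψ x + ψ' x) =
    fun x => resolvent ω₁ ω₂ ξ ψ x + resolvent ω₁ ω₂ ξ ψ' x := by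
  funext k; simp only [resolvent]; ring

theorem resolvent_mul (f ψ : RSpace d → ℂ) : resolvent ω₁ ω₂ ξ (fun x => f x * ψ x) =
    fun x => f x * resolvent ω₁ ω₂ ξ ψ x := by
  funext k; simp only [resolvent]; ring

theorem IsSesquilinear.resolvent (hω : IsSmooth (omegaXi ω₁ ω₂ ξ))
    {q : (RSpace d → ℂ) → (RSpace d → ℂ) → ℂ} (hq : IsSesquilinear q) :
    IsSesquilinear fun φ ψ => q φ (resolvent ω₁ ω₂ ξ ψ) where
  add_left h h' h'' := hq.add_left h h' (h''.resolvent hω)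
  smul_left a _ _ h h' := hq.smul_left a h (h'.resolvent hω)
  add_right h h' h'' := by
    rw [resolvent_add]
    exact hq.add_right h (h'.resolvent hω) (h''.resolvent hω)
  smul_right a _ _ h h' := by
    rw [resolvent_mul]
    exact hq.smul_right a h (h'.resolvent hω)

end Weight

/-! ### The operators `A` and `D_v` -/

section Conjugate

variable {d : ℕ} {ω₁ ω₂ : RSpace d → ℝ} {ξ : RSpace d}

local notation "vC" => fun σ x => ((vField ω₁ ω₂ ξ σ x : ℝ) : ℂ)
local notation "D" => opD ω₁ ω₂ ξ
local notation "A" => opA ω₁ ω₂ ξ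
local notation "w" => wFun ω₁ ω₂ ξ

theorem isSmooth_vField (hω : IsSmooth (omegaXi ω₁ ω₂ ξ)) (σ : Fin d) :
    IsSmooth (vField ω₁ ω₂ ξ σ) :=
  (((contDiff_norm_sq ℝ).neg.sub contDiff_const).exp).mul (hω.pderiv σ)

theorem isSmooth_wFun (hω : IsSmooth (omegaXi ω₁ ω₂ ξ)) : IsSmooth w :=
  contDiff_const.mul (ContDiff.sum fun σ _ => (isSmooth_vField hω σ).ofReal.pderiv σ)

theorem isSmooth_opD (hω : IsSmooth (omegaXi ω₁ ω₂ ξ)) {f : RSpace d → ℂ} (hf : IsSmooth f) :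
    IsSmooth (D f) :=
  contDiff_const.mul (ContDiff.sum fun σ _ => (isSmooth_vField hω σ).ofReal.mul (hf.pderiv σ))

theorem opD_add {f g : RSpace d → ℂ} (hf : IsSmooth f) (hg : IsSmooth g) :
    D (fun x => f x + g x) = fun x => D f x + D g x := by
  funext x
  simp only [opD, pderiv_add hf hg, mul_add, Finset.sum_add_distrib]

theorem opD_const_mul (a : ℂ) {f : RSpace d → ℂ} (hf : IsSmooth f) :
    D (fun x => a * f x) = fun x => a * D f x := by
  funext x
  simp only [opD, pderiv_const_mul hf, Finset.mul_sum]
  exact Finset.sum_congr rfl fun σ _ => by ring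

theorem opD_mul {f g : RSpace d → ℂ} (hf : IsSmooth f) (hg : IsSmooth g) :
    D (fun x => f x * g x) = fun x => f x * D g x + D f x * g x := by
  funext x
  simp only [opD, pderiv_mul hf hg, Finset.mul_sum, Finset.sum_mul]
  rw [← Finset.sum_add_distrib]
  exact Finset.sum_congr rfl fun σ _ => by ring

/-- `A = D_v + w`. -/
theorem opA_eq (hω : IsSmooth (omegaXi ω₁ ω₂ ξ)) {f : RSpace d → ℂ} (hf : IsSmooth f) :
    A f = fun x => D f x + w x * f x := by
  funext x
  have h (σ : Fin d) := pderiv_mul (isSmooth_vField hω σ).ofReal hf σ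
  simp only [opA, opD, wFun, h, Finset.sum_add_distrib, Finset.mul_sum, Finset.sum_mul, mul_add]
  rw [← add_assoc]
  congr 1
  · rw [← Finset.sum_add_distrib]
    exact Finset.sum_congr rfl fun σ _ => by ring
  · exact Finset.sum_congr rfl fun σ _ => by ring

theorem IsTest.opD (hω : IsSmooth (omegaXi ω₁ ω₂ ξ)) {f : RSpace d → ℂ} (hf : IsTest f) :
    IsTest (D f) :=
  (IsTest.sum Finset.univ fun σ =>
    (hf.pderiv σ).mul_left (isSmooth_vField hω σ).ofReal).const_mul Complex.I

theorem IsTest.opA (hω : IsSmooth (omegaXi ω₁ ω₂ ξ)) {f : RSpace d → ℂ} (hf : IsTest f) :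
    IsTest (A f) := by
  rw [opA_eq hω hf.isSmooth]
  exact (hf.opD hω).add (hf.mul_left (isSmooth_wFun hω))

theorem isSmooth_opA (hω : IsSmooth (omegaXi ω₁ ω₂ ξ)) {f : RSpace d → ℂ} (hf : IsSmooth f) :
    IsSmooth (A f) := by
  rw [opA_eq hω hf]
  exact (isSmooth_opD hω hf).add ((isSmooth_wFun hω).mul hf)

theorem opA_add (hω : IsSmooth (omegaXi ω₁ ω₂ ξ)) {f g : RSpace d → ℂ} (hf : IsSmooth f)
    (hg : IsSmooth g) : A (fun x => f x + g x) = fun x => A f x + A g x := by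
  rw [opA_eq hω (hf.add hg), opA_eq hω hf, opA_eq hω hg, opD_add hf hg]
  funext x; ring

theorem opA_const_mul (hω : IsSmooth (omegaXi ω₁ ω₂ ξ)) (a : ℂ) {f : RSpace d → ℂ}
    (hf : IsSmooth f) : A (fun x => a * f x) = fun x => a * A f x := by
  rw [opA_eq hω (contDiff_const.mul hf), opA_eq hω hf, opD_const_mul a hf]
  funext x; ring

/-- `A` is symmetric. -/
theorem pairing_opA_left (hω : IsSmooth (omegaXi ω₁ ω₂ ξ)) {φ F : RSpace d → ℂ} (hφ : IsTest φ)
    (hF : IsSmooth F) : pairing (A φ) F = pairing φ (A F) := by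
  have hv (σ : Fin d) : IsSmooth fun x => (vField ω₁ ω₂ ξ σ x : ℂ) := (isSmooth_vField hω σ).ofReal
  have hl (σ : Fin d) : IsTest fun x => (vField ω₁ ω₂ ξ σ x : ℂ) * pderiv σ φ x :=
    (hφ.pderiv σ).mul_left (hv σ)
  have hl' (σ : Fin d) : IsTest (pderiv σ fun x => (vField ω₁ ω₂ ξ σ x : ℂ) * φ x) :=
    (hφ.mul_left (hv σ)).pderiv σ
  have hr (σ : Fin d) : IsSmooth fun x => (vField ω₁ ω₂ ξ σ x : ℂ) * pderiv σ F x :=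
    (hv σ).mul (hF.pderiv σ)
  have hr' (σ : Fin d) : IsSmooth (pderiv σ fun x => (vField ω₁ ω₂ ξ σ x : ℂ) * F x) :=
    IsSmooth.pderiv ((hv σ).mul hF) σ
  have hsum {f : Fin d → RSpace d → ℂ} (hf : ∀ σ, IsTest (f σ)) :
      pairing (fun x => ∑ σ, f σ x) F = ∑ σ, pairing (f σ) F := by
    simp only [pairing, map_sum, Finset.sum_mul]
    exact integral_finsetSum _ fun σ _ => (hf σ).integrable_pairing hF
  have h1 (σ : Fin d) : pairing (fun x => (vField ω₁ ω₂ ξ σ x : ℂ) * pderiv σ φ x) F =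
      -pairing φ (pderiv σ fun x => (vField ω₁ ω₂ ξ σ x : ℂ) * F x) := by
    rw [pairing_mul_left]
    simp only [Complex.conj_ofReal]
    exact pairing_pderiv_left hφ ((hv σ).mul hF) σ
  have h2 (σ : Fin d) : pairing (pderiv σ fun x => (vField ω₁ ω₂ ξ σ x : ℂ) * φ x) F =
      -pairing φ (fun x => (vField ω₁ ω₂ ξ σ x : ℂ) * pderiv σ F x) := by
    rw [pairing_pderiv_left (hφ.mul_left (hv σ)) hF, pairing_mul_left]
    simp only [Complex.conj_ofReal]
  unfold opA
  rw [pairing_const_mul_left, pairing_const_mul_right,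
    pairing_add_left (IsTest.sum _ hl) (IsTest.sum _ hl') hF,
    pairing_add_right hφ (ContDiff.sum fun σ _ => hr σ) (ContDiff.sum fun σ _ => hr' σ),
    hsum hl, hsum hl', pairing_sum_right _ hφ hr, pairing_sum_right _ hφ hr']
  simp only [h1, h2, Finset.sum_neg_distrib, map_div₀, Complex.conj_I, map_ofNat]
  ring

/-! ### Iterated commutators -/

variable (ω₁ ω₂ ξ) in
/-- The form of the `k`-th iterated commutator with `A` of the operator with form `q`. -/
noncomputable def adIter (q : (RSpace d → ℂ) → (RSpace d → ℂ) → ℂ) :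
    ℕ → (RSpace d → ℂ) → (RSpace d → ℂ) → ℂ
  | 0, φ, ψ => q φ ψ
  | k + 1, φ, ψ => adIter q k φ (opA ω₁ ω₂ ξ ψ) - adIter q k (opA ω₁ ω₂ ξ φ) ψ

theorem adForm_eq_adIter (V : RSpace d → ℂ) (k : ℕ) (φ ψ : RSpace d → ℂ) :
    adForm ω₁ ω₂ V ξ k φ ψ = adIter ω₁ ω₂ ξ (fun φ ψ => pairing φ (convCheck V ψ)) k φ ψ := by
  induction k generalizing φ ψ with
  | zero => rfl
  | succ k ih => simp only [adForm, adIter, ih]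

theorem IsSesquilinear.adIter (hω : IsSmooth (omegaXi ω₁ ω₂ ξ))
    {q : (RSpace d → ℂ) → (RSpace d → ℂ) → ℂ} (hq : IsSesquilinear q) (k : ℕ) :
    IsSesquilinear (adIter ω₁ ω₂ ξ q k) := by
  induction k with
  | zero => exact hq
  | succ k ih =>
    constructor
    · intro φ φ' ψ h h' h''
      simp only [DispersivePair.adIter]
      rw [opA_add hω h.isSmooth h'.isSmooth, ih.add_left h h' (h''.opA hω),
        ih.add_left (h.opA hω) (h'.opA hω) h'']
      ring
    · intro a φ ψ h h'
      simp only [DispersivePair.adIter]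
      rw [opA_const_mul hω a h.isSmooth, ih.smul_left a h (h'.opA hω),
        ih.smul_left a (h.opA hω) h']
      ring
    · intro φ ψ ψ' h h' h''
      simp only [DispersivePair.adIter]
      rw [opA_add hω h'.isSmooth h''.isSmooth, ih.add_right h (h'.opA hω) (h''.opA hω),
        ih.add_right (h.opA hω) h' h'']
      ring
    · intro a φ ψ h h'
      simp only [DispersivePair.adIter]
      rw [opA_const_mul hω a h'.isSmooth, ih.smul_right a h (h'.opA hω),
        ih.smul_right a (h.opA hω) h']
      ring

/-- The form of the operator `M_f T_{p,q} M_h`. -/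
noncomputable def blockForm (V : RSpace d → ℂ) (p q : Fin d → ℕ) (f h φ ψ : RSpace d → ℂ) : ℂ :=
  pairing φ fun x => f x * convT V p q (fun y => h y * ψ y) x

theorem isSesquilinear_blockForm {V : RSpace d → ℂ} (hV : LocallyIntegrable V) (p q : Fin d → ℕ)
    {f h : RSpace d → ℂ} (hf : IsSmooth f) (hh : IsSmooth h) :
    IsSesquilinear (blockForm V p q f h) := by
  refine isSesquilinear_pairing (S := fun ψ x => f x * convT V p q (fun y => h y * ψ y) x)
    ?_ ?_ ?_
  · exact fun hψ => hf.mul (isSmooth_convT hV p q (hψ.mul_left hh))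
  · intro ψ ψ' hψ hψ'
    simp only [mul_add]
    rw [convT_add hV p q (hψ.mul_left hh) (hψ'.mul_left hh)]
    funext x; ring
  · intro a ψ hψ
    simp only [mul_left_comm _ a]
    rw [convT_const_mul p q a (hψ.mul_left hh)]
    funext x; ring

/-- The commutator of `T_{p,q}` with `A`, on functions. -/
theorem convT_opA {V : RSpace d → ℂ} (hω : IsSmooth (omegaXi ω₁ ω₂ ξ)) (hV : LocallyIntegrable V)
    (p q : Fin d → ℕ) {χ : RSpace d → ℂ} (hχ : IsTest χ) :
    convT V p q (A χ) = fun x => A (convT V p q χ) x +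
      ((∑ σ, (convT V p (q + Pi.single σ 1) (fun y => (vField ω₁ ω₂ ξ σ y : ℂ) * χ y) x +
        (vField ω₁ ω₂ ξ σ x : ℂ) * convT V (p + Pi.single σ 1) q χ x)) -
        w x * convT V p q χ x - convT V p q (fun y => w y * χ y) x) := by
  have hv (σ : Fin d) : IsSmooth fun x => (vField ω₁ ω₂ ξ σ x : ℂ) := (isSmooth_vField hω σ).ofReal
  have hvχ (σ : Fin d) := hχ.mul_left (hv σ)
  have hwχ := hχ.mul_left (isSmooth_wFun hω)
  -- `A χ = i ∑_σ ∂_σ (v_σ χ) - w χ` puts all derivatives in front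
  have hA : A χ = fun x => (∑ σ, Complex.I *
      pderiv σ (fun y => (vField ω₁ ω₂ ξ σ y : ℂ) * χ y) x) + (-1) * (w x * χ x) := by
    rw [opA_eq hω hχ.isSmooth]
    funext x
    have h (σ : Fin d) := pderiv_mul (hv σ) hχ.isSmooth σ
    simp only [h, opD, wFun, mul_add, Finset.sum_add_distrib, Finset.mul_sum, Finset.sum_mul]
    rw [add_assoc]
    congr 1
    rw [← Finset.sum_add_distrib]
    exact Finset.sum_congr rfl fun σ _ => by ring
  rw [hA, convT_add hV p q (IsTest.sum _ fun σ => ((hvχ σ).pderiv σ).const_mul _)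
    (hwχ.const_mul _), convT_sum hV p q _ (fun σ => ((hvχ σ).pderiv σ).const_mul _),
    opA_eq hω (isSmooth_convT hV p q hχ), convT_const_mul p q _ hwχ]
  funext x
  have h1 (σ : Fin d) := convT_const_mul (V := V) p q Complex.I ((hvχ σ).pderiv σ)
  have h2 (σ : Fin d) := convT_add_single_right (V := V) p q σ (hvχ σ).isSmooth
  have h3 (σ : Fin d) := convT_add_single_left (V := V) p q σ hχ.isSmooth
  simp only [h1, h2, h3, opD, pderiv_convT hV p q _ hχ, Finset.sum_add_distrib, Finset.mul_sum]
  have h4 (σ : Fin d) : (vField ω₁ ω₂ ξ σ x : ℂ) *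
      (-Complex.I * convT V p q (pderiv σ χ) x) =
      -(Complex.I * ((vField ω₁ ω₂ ξ σ x : ℂ) * convT V p q (pderiv σ χ) x)) := by ring
  simp only [h4, Finset.sum_neg_distrib]
  ring

/-- The commutator of `M_f T_{p,q} M_h` with `A` is a combination of operators of the same kind. -/
theorem blockForm_commutator {V : RSpace d → ℂ} (hω : IsSmooth (omegaXi ω₁ ω₂ ξ))
    (hV : LocallyIntegrable V) (p q : Fin d → ℕ) {f h φ ψ : RSpace d → ℂ} (hf : IsSmooth f)
    (hh : IsSmooth h) (hφ : IsTest φ) (hψ : IsTest ψ) :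
    blockForm V p q f h φ (A ψ) - blockForm V p q f h (A φ) ψ =
      (∑ σ, (blockForm V p (q + Pi.single σ 1) f (fun x => vC σ x * h x) φ ψ +
        blockForm V (p + Pi.single σ 1) q (fun x => vC σ x * f x) h φ ψ)) -
      (blockForm V p q (D f) h φ ψ + blockForm V p q f (D h) φ ψ +
        blockForm V p q (fun x => w x * f x) h φ ψ +
        blockForm V p q f (fun x => w x * h x) φ ψ) := by
  have hv (σ : Fin d) : IsSmooth fun x => (vField ω₁ ω₂ ξ σ x : ℂ) := (isSmooth_vField hω σ).ofReal
  have hw := isSmooth_wFun hω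
  have hhψ := hψ.mul_left hh
  have hDhψ := hψ.mul_left (isSmooth_opD hω hh)
  have hS {f' h' : RSpace d → ℂ} (p q) (hf' : IsSmooth f') (hh' : IsSmooth h') :
      IsSmooth fun x => f' x * convT V p q (fun y => h' y * ψ y) x :=
    hf'.mul (isSmooth_convT hV p q (hψ.mul_left hh'))
  have hT := isSmooth_convT hV p q hhψ
  have hhA : (fun x => h x * A ψ x) =
      fun x => A (fun y => h y * ψ y) x + (-1) * (D h x * ψ x) := by
    rw [opA_eq hω hψ.isSmooth, opA_eq hω hhψ.isSmooth, opD_mul hh hψ.isSmooth]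
    funext x; ring
  have key : (fun x => f x * convT V p q (fun y => h y * A ψ y) x) = fun x =>
      A (fun x => f x * convT V p q (fun y => h y * ψ y) x) x +
      ((∑ σ, (f x * convT V p (q + Pi.single σ 1)
          (fun y => (vField ω₁ ω₂ ξ σ y : ℂ) * h y * ψ y) x +
        (vField ω₁ ω₂ ξ σ x : ℂ) * f x *
          convT V (p + Pi.single σ 1) q (fun y => h y * ψ y) x)) +
      (-1) * (D f x * convT V p q (fun y => h y * ψ y) x +
        f x * convT V p q (fun y => D h y * ψ y) x +
        w x * f x * convT V p q (fun y => h y * ψ y) x +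
        f x * convT V p q (fun y => w y * h y * ψ y) x)) := by
    rw [hhA, convT_add hV p q (hhψ.opA hω) (hDhψ.const_mul _), convT_const_mul p q _ hDhψ,
      convT_opA hω hV p q hhψ, opA_eq hω hT, opA_eq hω (hf.mul hT), opD_mul hf hT]
    funext x
    simp only [mul_assoc]
    have (σ : Fin d) : f x * convT V p (q + Pi.single σ 1)
          (fun y => (vField ω₁ ω₂ ξ σ y : ℂ) * (h y * ψ y)) x +
        (vField ω₁ ω₂ ξ σ x : ℂ) * (f x *
          convT V (p + Pi.single σ 1) q (fun y => h y * ψ y) x) =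
        f x * (convT V p (q + Pi.single σ 1)
          (fun y => (vField ω₁ ω₂ ξ σ y : ℂ) * (h y * ψ y)) x +
        (vField ω₁ ω₂ ξ σ x : ℂ) *
          convT V (p + Pi.single σ 1) q (fun y => h y * ψ y) x) := by ring
    simp only [this, ← Finset.mul_sum]
    ring
  have s1 (σ : Fin d) := hS p (q + Pi.single σ 1) hf ((hv σ).mul hh)
  have s2 (σ : Fin d) := hS (p + Pi.single σ 1) q ((hv σ).mul hf) hh
  have s3 := hS p q (isSmooth_opD hω hf) hh
  have s4 := hS p q hf (isSmooth_opD hω hh)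
  have s5 := hS p q (hw.mul hf) hh
  have s6 := hS p q hf (hw.mul hh)
  have s12 (σ : Fin d) := (s1 σ).add (s2 σ)
  have s36 := ((s3.add s4).add s5).add s6
  unfold blockForm
  rw [pairing_opA_left hω hφ (hf.mul hT), key,
    pairing_add_right hφ (isSmooth_opA hω (hf.mul hT))
      ((ContDiff.sum fun σ _ => s12 σ).add (contDiff_const.mul s36)),
    pairing_add_right hφ (ContDiff.sum fun σ _ => s12 σ) (contDiff_const.mul s36),
    pairing_const_mul_right, pairing_add_right hφ ((s3.add s4).add s5) s6,
    pairing_add_right hφ (s3.add s4) s5, pairing_add_right hφ s3 s4,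
    pairing_sum_right _ hφ s12]
  simp only [fun σ => pairing_add_right hφ (s1 σ) (s2 σ)]
  ring

theorem adIter_blockForm_succ {V : RSpace d → ℂ} (hω : IsSmooth (omegaXi ω₁ ω₂ ξ))
    (hV : LocallyIntegrable V) (p q : Fin d → ℕ) {f h : RSpace d → ℂ} (hf : IsSmooth f)
    (hh : IsSmooth h) (k : ℕ) {φ ψ : RSpace d → ℂ} (hφ : IsTest φ) (hψ : IsTest ψ) :
    adIter ω₁ ω₂ ξ (blockForm V p q f h) (k + 1) φ ψ =
      (∑ σ, (adIter ω₁ ω₂ ξ (blockForm V p (q + Pi.single σ 1) f (fun x => vC σ x * h x)) k φ ψ +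
        adIter ω₁ ω₂ ξ (blockForm V (p + Pi.single σ 1) q (fun x => vC σ x * f x) h) k φ ψ)) -
      (adIter ω₁ ω₂ ξ (blockForm V p q (D f) h) k φ ψ +
        adIter ω₁ ω₂ ξ (blockForm V p q f (D h)) k φ ψ +
        adIter ω₁ ω₂ ξ (blockForm V p q (fun x => w x * f x) h) k φ ψ +
        adIter ω₁ ω₂ ξ (blockForm V p q f (fun x => w x * h x)) k φ ψ) := by
  induction k generalizing φ ψ with
  | zero => exact blockForm_commutator hω hV p q hf hh hφ hψ
  | succ k ih =>
    rw [adIter, ih hφ (hψ.opA hω), ih (hφ.opA hω) hψ]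
    simp only [adIter, Finset.sum_add_distrib, Finset.sum_sub_distrib]
    ring

/-! ### Factorial bounds for iterated derivatives -/

variable (ω₁ ω₂ ξ) in
/-- The iterates of `D_v` on `f` satisfy `|D_v^j f| ≤ W C^j n(n+1)⋯(n+j-1) g^m`. A product of
factors `D_v^i w` and `D_v^i v_σ`, of which `m` are of the second kind, has this property
with `n` the sum of the numbers `i + 1`. -/
structure IterBound (g : RSpace d → ℝ) (C : ℝ) (m n : ℕ) (W : ℝ) (f : RSpace d → ℂ) : Prop where
  smooth : IsSmooth f
  bound : ∀ j x, ‖(opD ω₁ ω₂ ξ)^[j] f x‖ ≤ W * C ^ j * n.ascFactorial j * g x ^ m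

theorem ascFactorial_succ_left (n j : ℕ) :
    n.ascFactorial (j + 1) = n * (n + 1).ascFactorial j := by
  rw [Nat.ascFactorial_succ, Nat.succ_ascFactorial]

variable {g : RSpace d → ℝ} {C : ℝ}

theorem IterBound.one : IterBound ω₁ ω₂ ξ g C 0 0 1 fun _ => 1 where
  smooth := contDiff_const
  bound j x := by
    rcases j with _ | j
    · simp
    · have h1 : D (fun _ => 1) = fun _ => 0 := by
        funext x; simp [opD, pderiv]
      have h0 : D (fun _ => 0) = fun _ => 0 := by
        funext x; simp [opD, pderiv]
      rw [Function.iterate_succ_apply, h1, Function.iterate_fixed h0]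
      simp [ascFactorial_succ_left]

theorem IterBound.opD (hω : IsSmooth (omegaXi ω₁ ω₂ ξ)) {m n : ℕ} {W : ℝ} {f : RSpace d → ℂ}
    (hf : IterBound ω₁ ω₂ ξ g C m n W f) : IterBound ω₁ ω₂ ξ g C m (n + 1) (W * C * n) (D f) where
  smooth := isSmooth_opD hω hf.smooth
  bound j x := by
    have h := hf.bound (j + 1) x
    rw [Function.iterate_succ_apply, ascFactorial_succ_left] at h
    push_cast at h
    exact h.trans_eq (by ring)

theorem iterate_opD_add (hω : IsSmooth (omegaXi ω₁ ω₂ ξ)) (j : ℕ) {f g : RSpace d → ℂ}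
    (hf : IsSmooth f) (hg : IsSmooth g) :
    D^[j] (fun x => f x + g x) = fun x => D^[j] f x + D^[j] g x := by
  induction j generalizing f g with
  | zero => rfl
  | succ j ih =>
    rw [Function.iterate_succ_apply, opD_add hf hg, ih (isSmooth_opD hω hf) (isSmooth_opD hω hg)]
    rfl

theorem IterBound.mul (hω : IsSmooth (omegaXi ω₁ ω₂ ξ)) {m n m' n' : ℕ} {W W' : ℝ}
    {f f' : RSpace d → ℂ} (hf : IterBound ω₁ ω₂ ξ g C m n W f)
    (hf' : IterBound ω₁ ω₂ ξ g C m' n' W' f') :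
    IterBound ω₁ ω₂ ξ g C (m + m') (n + n') (W * W') fun x => f x * f' x where
  smooth := hf.smooth.mul hf'.smooth
  bound j x := by
    induction j generalizing f f' n n' W W' with
    | zero =>
      have h := mul_le_mul (hf.bound 0 x) (hf'.bound 0 x) (norm_nonneg _)
        ((norm_nonneg _).trans (hf.bound 0 x))
      rw [← norm_mul] at h
      refine h.trans_eq ?_
      simp [pow_add]
      ring
    | succ j ih =>
      rw [Function.iterate_succ_apply, opD_mul hf.smooth hf'.smooth,
        iterate_opD_add hω j (hf.smooth.mul (isSmooth_opD hω hf'.smooth))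
          ((isSmooth_opD hω hf.smooth).mul hf'.smooth)]
      have h1 := ih hf (hf'.opD hω)
      have h2 := ih (hf.opD hω) hf'
      refine (norm_add_le _ _).trans ((add_le_add h1 h2).trans_eq ?_)
      rw [ascFactorial_succ_left, ← add_assoc n n' 1, add_right_comm n 1 n']
      push_cast
      ring

end Conjugate

/-! ### Analytic continuation to strips -/

section Strip

variable {d : ℕ}

/-- `complexify` as a real linear map. -/
noncomputable def complexifyCLM (d : ℕ) : RSpace d →L[ℝ] CSpace d :=
  LinearMap.toContinuousLinearMap
    { toFun := complexify
      map_add' := fun x y => by ext i; simp [complexify]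
      map_smul' := fun a x => by ext i; simp [complexify] }

theorem complexify_single (σ : Fin d) :
    complexify (EuclideanSpace.single σ (1 : ℝ)) = EuclideanSpace.single σ (1 : ℂ) := by
  ext i
  by_cases h : i = σ <;> simp [complexify, h]

theorem complexify_mem_strip {r : ℝ} (hr : 0 < r) (x : RSpace d) : complexify x ∈ strip d r := by
  intro i
  simpa [complexify] using hr

theorem strip_mono {r r' : ℝ} (h : r ≤ r') : strip d r ⊆ strip d r' :=
  fun _ hz i => (hz i).trans_le h

theorem add_smul_single_mem_strip {r δ : ℝ} {z : CSpace d} (hz : z ∈ strip d (r - δ))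
    (σ : Fin d) {t : ℂ} (ht : ‖t‖ ≤ δ) : z + t • EuclideanSpace.single σ 1 ∈ strip d r := by
  intro i
  have hi := hz i
  have h1 : |(t * (EuclideanSpace.single σ (1 : ℂ) : CSpace d) i).im| ≤ δ := by
    by_cases h : i = σ
    · simpa [h] using (Complex.abs_im_le_norm t).trans ht
    · simpa [h] using (norm_nonneg t).trans ht
  have h2 : (z + t • EuclideanSpace.single σ (1 : ℂ) : CSpace d) i =
      z i + t * (EuclideanSpace.single σ (1 : ℂ) : CSpace d) i := rfl
  rw [h2, Complex.add_im]
  have h3 := abs_add_le (z i).im (t * (EuclideanSpace.single σ (1 : ℂ) : CSpace d) i).im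
  linarith

/-- Cauchy's estimate for partial derivatives on a strip. -/
theorem norm_fderiv_single_le {F : CSpace d → ℂ} {r δ M : ℝ} (hδ : 0 < δ)
    (hF : ∀ z ∈ strip d r, DifferentiableAt ℂ F z) (hM : ∀ z ∈ strip d r, ‖F z‖ ≤ M)
    (σ : Fin d) {z : CSpace d} (hz : z ∈ strip d (r - δ)) :
    ‖fderiv ℂ F z (EuclideanSpace.single σ 1)‖ ≤ M / δ := by
  set e : CSpace d := EuclideanSpace.single σ 1
  have hline (t : ℂ) : HasDerivAt (fun t : ℂ => z + t • e) e t := by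
    simpa using ((hasDerivAt_id t).smul_const e).const_add z
  have hd (t : ℂ) (ht : ‖t‖ ≤ δ) :
      HasDerivAt (fun t : ℂ => F (z + t • e)) (fderiv ℂ F (z + t • e) e) t :=
    (hF _ (add_smul_single_mem_strip hz σ ht)).hasFDerivAt.comp_hasDerivAt t (hline t)
  have h0 := (hd 0 (by simpa using hδ.le)).deriv
  rw [zero_smul, add_zero] at h0
  rw [← h0]
  refine Complex.norm_deriv_le_of_forall_mem_sphere_norm_le hδ ?_ ?_
  · refine DifferentiableOn.diffContOnCl fun t ht => ?_
    have := Metric.closure_ball_subset_closedBall ht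
    exact (hd t (by simpa using this)).differentiableAt.differentiableWithinAt
  · intro t ht
    exact hM _ (add_smul_single_mem_strip hz σ (by simpa using ht.le))

/-- The complex derivation `i V · ∇`. -/
noncomputable def opDC (V : Fin d → CSpace d → ℂ) (F : CSpace d → ℂ) : CSpace d → ℂ := fun z =>
  Complex.I * ∑ σ, V σ z * fderiv ℂ F z (EuclideanSpace.single σ 1)

theorem analyticOnNhd_fderiv_single {F : CSpace d → ℂ} {S : Set (CSpace d)}
    (hF : AnalyticOnNhd ℂ F S) (σ : Fin d) :
    AnalyticOnNhd ℂ (fun z => fderiv ℂ F z (EuclideanSpace.single σ 1)) S :=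
  fun z hz => ((ContinuousLinearMap.apply ℂ ℂ (EuclideanSpace.single σ (1 : ℂ) : CSpace d)).analyticAt
    _).comp (hF.fderiv z hz)

theorem analyticOnNhd_opDC {V : Fin d → CSpace d → ℂ} {F : CSpace d → ℂ} {S : Set (CSpace d)}
    (hV : ∀ σ, AnalyticOnNhd ℂ (V σ) S) (hF : AnalyticOnNhd ℂ F S) :
    AnalyticOnNhd ℂ (opDC V F) S := fun z hz =>
  analyticAt_const.mul (Finset.univ.analyticAt_fun_sum fun σ _ =>
    (hV σ z hz).mul (analyticOnNhd_fderiv_single hF σ z hz))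

theorem analyticOnNhd_iterate_opDC {V : Fin d → CSpace d → ℂ} {F : CSpace d → ℂ}
    {S : Set (CSpace d)} (hV : ∀ σ, AnalyticOnNhd ℂ (V σ) S) (hF : AnalyticOnNhd ℂ F S) (j : ℕ) :
    AnalyticOnNhd ℂ ((opDC V)^[j] F) S := by
  induction j with
  | zero => exact hF
  | succ j ih => rw [Function.iterate_succ_apply']; exact analyticOnNhd_opDC hV ih

/-- Each application of `i V · ∇` costs a piece `δ` of the width of the strip. The pointwise
weight `ρ` of `V` is recovered from the outermost factor `V`, so `ρ` need not be slowly varying. -/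
theorem norm_iterate_opDC_le {V : Fin d → CSpace d → ℂ} {F : CSpace d → ℂ} {ρ : CSpace d → ℝ}
    {r δ a M G : ℝ} (hδ : 0 < δ) (ha : 0 ≤ a) (hM0 : 0 ≤ M)
    (hV : ∀ σ, AnalyticOnNhd ℂ (V σ) (strip d r)) (hF : AnalyticOnNhd ℂ F (strip d r))
    (hρ : ∀ z, 0 ≤ ρ z) (hG : ∀ z, ρ z ≤ G) (hVa : ∀ σ, ∀ z ∈ strip d r, ‖V σ z‖ ≤ a * ρ z)
    (hFM : ∀ z ∈ strip d r, ‖F z‖ ≤ M * ρ z) (j : ℕ) :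
    ∀ z ∈ strip d (r - j * δ), ‖(opDC V)^[j] F z‖ ≤ M * (d * a * G / δ) ^ j * ρ z := by
  have hG0 : 0 ≤ G := (hρ 0).trans (hG 0)
  induction j with
  | zero => simpa using hFM
  | succ j ih =>
    intro z hz
    have hmono : strip d (r - j * δ) ⊆ strip d r := strip_mono (by simp; positivity)
    have hz' : z ∈ strip d ((r - j * δ) - δ) := by
      convert hz using 2; push_cast; ring
    have hzr : z ∈ strip d r := hmono (strip_mono (by linarith) hz')
    set X := M * (d * a * G / δ) ^ j with hX
    have hX0 : 0 ≤ X := by positivity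
    have hder (σ : Fin d) :
        ‖fderiv ℂ ((opDC V)^[j] F) z (EuclideanSpace.single σ 1)‖ ≤ X * G / δ :=
      norm_fderiv_single_le hδ
        (fun y hy => (analyticOnNhd_iterate_opDC hV hF j y (hmono hy)).differentiableAt)
        (fun y hy => (ih y hy).trans (mul_le_mul_of_nonneg_left (hG y) hX0)) σ hz'
    rw [Function.iterate_succ_apply', opDC, norm_mul, Complex.norm_I, one_mul]
    calc _ ≤ ∑ σ : Fin d, ‖V σ z * fderiv ℂ ((opDC V)^[j] F) z (EuclideanSpace.single σ 1)‖ :=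
          norm_sum_le _ _
      _ ≤ ∑ _σ : Fin d, a * ρ z * (X * G / δ) := by
          refine Finset.sum_le_sum fun σ _ => ?_
          rw [norm_mul]
          exact mul_le_mul (hVa σ z hzr) (hder σ) (norm_nonneg _) (mul_nonneg ha (hρ z))
      _ = M * (d * a * G / δ) ^ (j + 1) * ρ z := by
          rw [Finset.sum_const, Finset.card_univ, Fintype.card_fin, nsmul_eq_mul, hX, pow_succ]
          ring

/-- Factorial growth of iterated derivatives at real points, by the choice `δ = r / (j + 1)`. -/
theorem norm_iterate_opDC_complexify_le {V : Fin d → CSpace d → ℂ} {F : CSpace d → ℂ}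
    {ρ : CSpace d → ℝ} {r a M G : ℝ} (hr : 0 < r) (ha : 0 ≤ a) (hM0 : 0 ≤ M)
    (hV : ∀ σ, AnalyticOnNhd ℂ (V σ) (strip d r)) (hF : AnalyticOnNhd ℂ F (strip d r))
    (hρ : ∀ z, 0 ≤ ρ z) (hG : ∀ z, ρ z ≤ G) (hVa : ∀ σ, ∀ z ∈ strip d r, ‖V σ z‖ ≤ a * ρ z)
    (hFM : ∀ z ∈ strip d r, ‖F z‖ ≤ M * ρ z) {C : ℝ} (hC1 : M * Real.exp 1 ≤ C)
    (hC2 : d * a * G * Real.exp 1 / r ≤ C) (j : ℕ) (x : RSpace d) :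
    ‖(opDC V)^[j] F (complexify x)‖ ≤ C ^ (j + 1) * j.factorial * ρ (complexify x) := by
  have hG0 : 0 ≤ G := (hρ 0).trans (hG 0)
  have hj : (0 : ℝ) < j + 1 := by positivity
  have hmem : complexify x ∈ strip d (r - j * (r / (j + 1))) := by
    apply complexify_mem_strip
    have : r - j * (r / (j + 1)) = r / (j + 1) := by field_simp; ring
    rw [this]; positivity
  refine (norm_iterate_opDC_le (div_pos hr hj) ha hM0 hV hF hρ hG hVa hFM j _ hmem).trans ?_
  refine mul_le_mul_of_nonneg_right ?_ (hρ _)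
  have h1 := Real.pow_div_factorial_le_exp _ hj.le j
  rw [div_le_iff₀ (by positivity), show (j : ℝ) + 1 = ((j + 1 : ℕ) : ℝ) * 1 by push_cast; ring,
    Real.exp_nat_mul] at h1
  have h2 : d * a * G / (r / (j + 1)) = d * a * G / r * (((j + 1 : ℕ) : ℝ) * 1) := by
    field_simp; push_cast; ring
  rw [h2, mul_pow]
  have hb : 0 ≤ d * a * G / r := by positivity
  calc M * ((d * a * G / r) ^ j * (((j + 1 : ℕ) : ℝ) * 1) ^ j)
      ≤ M * ((d * a * G / r) ^ j * (Real.exp 1 ^ (j + 1) * j.factorial)) := by gcongr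
    _ = (M * Real.exp 1) * (d * a * G * Real.exp 1 / r) ^ j * j.factorial := by
        rw [show d * a * G * Real.exp 1 / r = d * a * G / r * Real.exp 1 by ring, mul_pow]; ring
    _ ≤ C * C ^ j * j.factorial := by gcongr; exact (by positivity : (0:ℝ) ≤ _).trans hC1
    _ = _ := by ring

/-! ### Restriction to real points -/

theorem hasFDerivAt_comp_complexify {F : CSpace d → ℂ} {x : RSpace d}
    (hF : DifferentiableAt ℂ F (complexify x)) :
    HasFDerivAt (fun x => F (complexify x))
      (((fderiv ℂ F (complexify x)).restrictScalars ℝ).comp (complexifyCLM d)) x :=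
  (hF.hasFDerivAt.restrictScalars ℝ).comp x (complexifyCLM d).hasFDerivAt

theorem pderiv_comp_complexify {F : CSpace d → ℂ} {f : RSpace d → ℂ}
    (hf : ∀ x, f x = F (complexify x)) {x : RSpace d}
    (hF : DifferentiableAt ℂ F (complexify x)) (σ : Fin d) :
    pderiv σ f x = fderiv ℂ F (complexify x) (EuclideanSpace.single σ 1) := by
  rw [funext hf, pderiv, (hasFDerivAt_comp_complexify hF).fderiv, ← complexify_single]
  rfl

theorem isSmooth_comp_complexify {F : CSpace d → ℂ} {r : ℝ} (hr : 0 < r)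
    (hF : AnalyticOnNhd ℂ F (strip d r)) : IsSmooth fun x : RSpace d => F (complexify x) := by
  rw [IsSmooth, contDiff_iff_contDiffAt]
  intro x
  have h : ContDiffAt ℝ ∞ F (complexifyCLM d x) :=
    (hF _ (complexify_mem_strip hr x)).contDiffAt.restrict_scalars ℝ
  exact h.comp x (complexifyCLM d).contDiff.contDiffAt

end Strip

section Dispersion

variable {d : ℕ} {ω₁ ω₂ : RSpace d → ℝ} {s₁ s₂ : ℝ}

theorem IsDispersionRelation.isSmooth {R C s : ℝ} {η : RSpace d → ℝ} (hR : 0 < R)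
    (h : IsDispersionRelation R C s η) : IsSmooth η := by
  obtain ⟨Ω, hΩ, hη, -⟩ := h
  have h1 := isSmooth_comp_complexify (by positivity : 0 < 2 * R) hΩ
  rw [funext hη] at h1
  exact Complex.reCLM.contDiff.comp h1

theorem DispersionCondition.isSmooth_omegaXi (h : DispersionCondition ω₁ ω₂ s₁ s₂)
    (ξ : RSpace d) : IsSmooth (omegaXi ω₁ ω₂ ξ) := by
  obtain ⟨R, C, hR, -, h₁, h₂⟩ := h.bounds
  exact ((h₁.isSmooth hR).comp (contDiff_const.sub contDiff_id)).add (h₂.isSmooth hR)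

/-- The iterates of `D_v` are the restrictions of the iterates of the complex derivation. -/
theorem iterate_opD_eq {ξ : RSpace d} {V : Fin d → CSpace d → ℂ} {r : ℝ} (hr : 0 < r)
    (hV : ∀ σ, AnalyticOnNhd ℂ (V σ) (strip d r))
    (hv : ∀ σ x, (vField ω₁ ω₂ ξ σ x : ℂ) = V σ (complexify x)) {F : CSpace d → ℂ}
    (hF : AnalyticOnNhd ℂ F (strip d r)) {f : RSpace d → ℂ} (hf : ∀ x, f x = F (complexify x))
    (j : ℕ) (x : RSpace d) :
    (opD ω₁ ω₂ ξ)^[j] f x = (opDC V)^[j] F (complexify x) := by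
  induction j generalizing f F with
  | zero => exact hf x
  | succ j ih =>
    rw [Function.iterate_succ_apply, Function.iterate_succ_apply]
    refine ih (analyticOnNhd_opDC hV hF) fun y => ?_
    simp only [opD, opDC, hv, pderiv_comp_complexify hf
      (hF _ (complexify_mem_strip hr y)).differentiableAt]

/-- The real part of a complex vector. -/
noncomputable def reC (z : CSpace d) : RSpace d := WithLp.toLp 2 fun i => (z i).re

theorem reC_complexify (x : RSpace d) : reC (complexify x) = x := by
  ext i; simp [reC, complexify]

theorem norm_complexify (x : RSpace d) : ‖complexify x‖ = ‖x‖ := by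
  simp [EuclideanSpace.norm_eq, complexify]

theorem norm_sq_reC_add (z : CSpace d) : ‖z‖ ^ 2 = ‖reC z‖ ^ 2 + ∑ i, (z i).im ^ 2 := by
  rw [EuclideanSpace.norm_sq_eq, EuclideanSpace.norm_sq_eq, ← Finset.sum_add_distrib]
  refine Finset.sum_congr rfl fun i _ => ?_
  rw [Complex.sq_norm, Complex.normSq_apply]
  simp [reC]
  ring

theorem sum_im_sq_le {r : ℝ} {z : CSpace d} (hz : z ∈ strip d r) :
    ∑ i, (z i).im ^ 2 ≤ d * r ^ 2 := by
  calc ∑ i, (z i).im ^ 2 ≤ ∑ _i : Fin d, r ^ 2 :=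
        Finset.sum_le_sum fun i _ => by rw [← sq_abs]; gcongr; exact (hz i).le
    _ = _ := by simp

/-- On a strip `⟨z⟩` is comparable with `⟨Re z⟩`. -/
theorem jap_le_of_mem_strip {r : ℝ} {z : CSpace d} (hz : z ∈ strip d r) :
    jap z ≤ Real.sqrt (1 + d * r ^ 2) * jap (reC z) := by
  rw [jap, jap, ← Real.sqrt_mul (by positivity)]
  refine Real.sqrt_le_sqrt ?_
  have h := sum_im_sq_le hz
  rw [norm_sq_reC_add]
  nlinarith [sq_nonneg ‖reC z‖, mul_nonneg (by positivity : (0 : ℝ) ≤ d * r ^ 2)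
    (sq_nonneg ‖reC z‖)]

/-- Peetre's inequality. -/
theorem jap_sub_le {F : Type*} [SeminormedAddCommGroup F] (x y : F) :
    jap (x - y) ≤ 2 * (jap x * jap y) := by
  have h := norm_sub_le x y
  have h2 : ‖x - y‖ ^ 2 ≤ (‖x‖ + ‖y‖) ^ 2 := by gcongr
  rw [jap, jap, jap, ← Real.sqrt_mul (by positivity), Real.sqrt_le_left (by positivity), mul_pow,
    Real.sq_sqrt (by positivity)]
  nlinarith [sq_nonneg (‖x‖ - ‖y‖), mul_nonneg (sq_nonneg ‖x‖) (sq_nonneg ‖y‖)]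

/-- The Gaussian factor continued to a strip: the imaginary parts only contribute a constant. -/
theorem norm_cexp_le {r : ℝ} {z : CSpace d} (hz : z ∈ strip d r) (ξ : RSpace d) :
    ‖Complex.exp (-(∑ i, z i ^ 2) - (‖ξ‖ ^ 2 : ℝ))‖ ≤
      Real.exp (d * r ^ 2) * (Real.exp (-‖reC z‖ ^ 2) * Real.exp (-‖ξ‖ ^ 2)) := by
  rw [Complex.norm_exp, ← Real.exp_add, ← Real.exp_add]
  apply Real.exp_le_exp.2
  have h : (∑ i, z i ^ 2).re = ‖reC z‖ ^ 2 - ∑ i, (z i).im ^ 2 := by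
    rw [EuclideanSpace.norm_sq_eq, ← Finset.sum_sub_distrib, Complex.re_sum]
    refine Finset.sum_congr rfl fun i _ => ?_
    simp [reC, sq]
  have h2 := sum_im_sq_le hz
  rw [Complex.sub_re, Complex.neg_re, Complex.ofReal_re, h]
  linarith

/-- The components `D_v^j w` and `D_v^j v_σ` are bounded by `C^{j+1} j!`, the second ones with the
weight `g`. The constant does not depend on `ξ`, as `exp(-ξ²)` absorbs the growth of `∇ω₁(ξ - ·)`
in `ξ`. -/
theorem DispersionCondition.exists_iterate_bound (h : DispersionCondition ω₁ ω₂ s₁ s₂) :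
    ∃ C : ℝ, 0 < C ∧ ∀ ξ : RSpace d,
      (∀ j x, ‖(opD ω₁ ω₂ ξ)^[j] (wFun ω₁ ω₂ ξ) x‖ ≤ C ^ (j + 1) * j.factorial) ∧
      ∀ σ j x, ‖(opD ω₁ ω₂ ξ)^[j] (fun x => (vField ω₁ ω₂ ξ σ x : ℂ)) x‖ ≤
        C ^ (j + 1) * j.factorial * weight s₂ x := by
  obtain ⟨R, C, hR, hC, h₁, h₂⟩ := h.bounds
  have hsm := h.isSmooth_omegaXi
  obtain ⟨Ω₁, hΩ₁, hω₁, hb₁⟩ := h₁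
  obtain ⟨Ω₂, hΩ₂, hω₂, hb₂⟩ := h₂
  obtain ⟨G, hG1, hG⟩ := exists_weight_le (d := d) s₂
  have h2R : 0 < 2 * R := by positivity
  set Q : ℝ := Real.sqrt (1 + d * (2 * R) ^ 2) ^ s₂ with hQ
  have hQ0 : 0 ≤ Q := Real.rpow_nonneg (Real.sqrt_nonneg _) _
  -- `a` bounds the continuation of `v_σ` relative to the weight; `⟨ξ - z⟩^{s₁}` is estimated by
  -- `2^{s₂} ⟨ξ⟩^{s₂} ⟨z⟩^{s₂}`, and `⟨ξ⟩^{s₂} exp(-ξ²)` by `G`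
  set a : ℝ := Real.exp (d * (2 * R) ^ 2) * (C * (2 ^ s₂ * G * Q) + C * Q) with ha
  have ha0 : 0 ≤ a := by positivity
  set Cc : ℝ := 1 + a * Real.exp 1 + d * a * G * Real.exp 1 / R +
    d * (a * G / R) * Real.exp 1 with hCc
  have hr1 : 0 ≤ a * Real.exp 1 := by positivity
  have hr2 : 0 ≤ d * a * G * Real.exp 1 / R := by positivity
  have hr3 : 0 ≤ d * (a * G / R) * Real.exp 1 := by positivity
  refine ⟨Cc, by linarith, fun ξ => ?_⟩
  have hsub {z : CSpace d} (hz : z ∈ strip d (2 * R)) :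
      complexify ξ - z ∈ strip d (2 * R) := fun i => by simpa [complexify] using hz i
  set Ω : CSpace d → ℂ := fun z => Ω₁ (complexify ξ - z) + Ω₂ z with hΩdef
  have hΩ : AnalyticOnNhd ℂ Ω (strip d (2 * R)) := fun z hz =>
    ((hΩ₁ _ (hsub hz)).comp (analyticAt_const.sub analyticAt_id)).add (hΩ₂ z hz)
  have hfd {z : CSpace d} (hz : z ∈ strip d (2 * R)) (σ : Fin d) :
      fderiv ℂ Ω z (EuclideanSpace.single σ 1) =
        -fderiv ℂ Ω₁ (complexify ξ - z) (EuclideanSpace.single σ 1) +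
          fderiv ℂ Ω₂ z (EuclideanSpace.single σ 1) := by
    have h1 := (hΩ₁ _ (hsub hz)).differentiableAt.hasFDerivAt.comp z
      ((hasFDerivAt_id z).const_sub (complexify ξ))
    have h2 := h1.add (hΩ₂ z hz).differentiableAt.hasFDerivAt
    have h3 : fderiv ℂ Ω z = _ := h2.fderiv
    rw [h3]
    simp
  set V : Fin d → CSpace d → ℂ := fun σ z =>
    Complex.exp (-(∑ i, z i ^ 2) - (‖ξ‖ ^ 2 : ℝ)) *
      fderiv ℂ Ω z (EuclideanSpace.single σ 1) with hVdef
  have hV (σ : Fin d) : AnalyticOnNhd ℂ (V σ) (strip d (2 * R)) := fun z hz => by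
    refine AnalyticAt.mul (AnalyticAt.cexp (AnalyticAt.sub (AnalyticAt.neg
      (Finset.univ.analyticAt_fun_sum fun i _ => ?_)) analyticAt_const))
      (analyticOnNhd_fderiv_single hΩ σ z hz)
    exact ((EuclideanSpace.proj (𝕜 := ℂ) i).analyticAt z).pow 2
  have hv (σ : Fin d) (x : RSpace d) : (vField ω₁ ω₂ ξ σ x : ℂ) = V σ (complexify x) := by
    have h1 : ∀ x, (omegaXi ω₁ ω₂ ξ x : ℂ) = Ω (complexify x) := fun x => by
      have : complexify ξ - complexify x = complexify (ξ - x) := by ext i; simp [complexify]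
      simp [hΩdef, omegaXi, hω₂, this, hω₁]
    have h2 := pderiv_comp_complexify h1
      (hΩ _ (complexify_mem_strip h2R x)).differentiableAt σ
    rw [pderiv_ofReal (hsm ξ)] at h2
    simp only [vField, hVdef, Complex.ofReal_mul, h2, Complex.ofReal_exp]
    congr 2
    rw [EuclideanSpace.norm_sq_eq x]
    simp [complexify]
  have hρ0 (z : CSpace d) : 0 ≤ weight s₂ (reC z) := (weight_pos _ _).le
  have hVa (σ : Fin d) : ∀ z ∈ strip d (2 * R), ‖V σ z‖ ≤ a * weight s₂ (reC z) := by
    intro z hz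
    set J := jap (reC z) ^ (2 * s₂) with hJ
    have hjz : jap z ^ s₂ ≤ Q * J := by
      calc jap z ^ s₂ ≤ (Real.sqrt (1 + d * (2 * R) ^ 2) * jap (reC z)) ^ s₂ :=
            Real.rpow_le_rpow (jap_pos z).le (jap_le_of_mem_strip hz) h.pos.le
        _ = Q * jap (reC z) ^ s₂ := Real.mul_rpow (Real.sqrt_nonneg _) (jap_pos _).le
        _ ≤ _ := mul_le_mul_of_nonneg_left
            (Real.rpow_le_rpow_of_exponent_le (one_le_jap _) (by linarith [h.pos])) hQ0
    have hj1 : jap (complexify ξ - z) ^ s₁ ≤ 2 ^ s₂ * (jap ξ ^ s₂ * (Q * J)) := by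
      calc jap (complexify ξ - z) ^ s₁ ≤ jap (complexify ξ - z) ^ s₂ :=
            Real.rpow_le_rpow_of_exponent_le (one_le_jap _) h.le
        _ ≤ (2 * (jap (complexify ξ) * jap z)) ^ s₂ :=
            Real.rpow_le_rpow (jap_pos _).le (jap_sub_le _ _) h.pos.le
        _ = 2 ^ s₂ * (jap ξ ^ s₂ * jap z ^ s₂) := by
            rw [Real.mul_rpow (by norm_num) (mul_nonneg (jap_pos _).le (jap_pos _).le),
              Real.mul_rpow (jap_pos _).le (jap_pos _).le]
            simp only [jap, norm_complexify]
        _ ≤ _ := by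
            have := Real.rpow_nonneg (jap_pos ξ).le s₂
            gcongr
    have hξ : jap ξ ^ s₂ * Real.exp (-‖ξ‖ ^ 2) ≤ G := by
      refine le_trans ?_ (hG ξ)
      exact mul_le_mul_of_nonneg_right
        (Real.rpow_le_rpow_of_exponent_le (one_le_jap _) (by linarith [h.pos]))
        (Real.exp_pos _).le
    have hξ1 : Real.exp (-‖ξ‖ ^ 2) ≤ 1 := by simp
    have hJ0 : 0 ≤ J := Real.rpow_nonneg (jap_pos _).le _
    have hn := norm_cexp_le hz ξ
    have hf : ‖fderiv ℂ Ω z (EuclideanSpace.single σ 1)‖ ≤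
        C * (2 ^ s₂ * (jap ξ ^ s₂ * (Q * J))) + C * (Q * J) := by
      rw [hfd hz]
      refine (norm_add_le _ _).trans ?_
      rw [norm_neg]
      refine add_le_add (((hb₁ _ (hsub hz)).2.1 σ).trans ?_) (((hb₂ z hz).2.1 σ).trans ?_) <;>
        gcongr
    rw [hVdef]
    simp only [norm_mul]
    refine (mul_le_mul hn hf (norm_nonneg _) (by positivity)).trans ?_
    rw [ha, weight, ← hJ]
    calc _ = Real.exp (d * (2 * R) ^ 2) * Real.exp (-‖reC z‖ ^ 2) * (C * Q * J) *
          (2 ^ s₂ * (jap ξ ^ s₂ * Real.exp (-‖ξ‖ ^ 2)) + Real.exp (-‖ξ‖ ^ 2)) := by ring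
      _ ≤ Real.exp (d * (2 * R) ^ 2) * Real.exp (-‖reC z‖ ^ 2) * (C * Q * J) *
          (2 ^ s₂ * G + 1) := by gcongr
      _ = _ := by ring
  -- `w` contains a derivative of `v_σ`, which costs half of the width
  have hRR : strip d R ⊆ strip d (2 * R) := strip_mono (by linarith)
  have hVR (σ : Fin d) : AnalyticOnNhd ℂ (V σ) (strip d R) := (hV σ).mono hRR
  refine ⟨fun j x => ?_, fun σ j x => ?_⟩
  · set W : CSpace d → ℂ := fun z =>
      (Complex.I / 2) * ∑ σ, fderiv ℂ (V σ) z (EuclideanSpace.single σ 1) with hWdef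
    have hW : AnalyticOnNhd ℂ W (strip d R) := fun z hz =>
      analyticAt_const.mul (Finset.univ.analyticAt_fun_sum fun σ _ =>
        analyticOnNhd_fderiv_single (hVR σ) σ z hz)
    have hw (x : RSpace d) : wFun ω₁ ω₂ ξ x = W (complexify x) := by
      simp only [wFun, hWdef]
      congr 1
      exact Finset.sum_congr rfl fun σ _ => pderiv_comp_complexify (hv σ)
        (hVR σ _ (complexify_mem_strip hR x)).differentiableAt σ
    have hWM : ∀ z ∈ strip d R, ‖W z‖ ≤ d * (a * G / R) * 1 := by
      intro z hz
      rw [hWdef]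
      simp only [norm_mul, norm_div, Complex.norm_I, Complex.norm_ofNat]
      have h1 : ‖∑ σ, fderiv ℂ (V σ) z (EuclideanSpace.single σ 1)‖ ≤ d * (a * G / R) := by
        calc _ ≤ ∑ σ, ‖fderiv ℂ (V σ) z (EuclideanSpace.single σ 1)‖ := norm_sum_le _ _
          _ ≤ ∑ _σ : Fin d, a * G / R := by
              refine Finset.sum_le_sum fun σ _ => norm_fderiv_single_le hR
                (fun y hy => (hV σ y hy).differentiableAt)
                (fun y hy => (hVa σ y hy).trans (mul_le_mul_of_nonneg_left (hG _) ha0)) σ ?_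
              convert hz using 2; ring
          _ = _ := by simp
      have := norm_nonneg (∑ σ, fderiv ℂ (V σ) z (EuclideanSpace.single σ 1))
      linarith
    rw [iterate_opD_eq hR hVR hv hW hw]
    refine (norm_iterate_opDC_complexify_le (ρ := fun _ => 1) (G := 1) (a := a * G)
      (M := d * (a * G / R)) (C := Cc) hR (by positivity) (by positivity) hVR hW
      (fun _ => zero_le_one) (fun _ => le_rfl) (fun σ z hz => ?_) hWM (by linarith) ?_ j x).trans_eq
      (mul_one _)
    · rw [mul_one]
      exact (hVa σ z (hRR hz)).trans (mul_le_mul_of_nonneg_left (hG _) ha0)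
    · rw [mul_one, ← mul_assoc]; linarith
  · rw [iterate_opD_eq hR hVR hv (hVR σ) (hv σ)]
    have := norm_iterate_opDC_complexify_le (ρ := fun z => weight s₂ (reC z)) (G := G) (a := a)
      (M := a) (C := Cc) hR ha0 ha0 hVR (hVR σ) hρ0 (fun _ => hG _)
      (fun σ z hz => hVa σ z (hRR hz)) (fun z hz => hVa σ z (hRR hz)) (by linarith)
      (by linarith) j x
    rwa [reC_complexify] at this

end Dispersion

/-! ### Counting polyindices -/

/-- The shift `α ↦ (0, α(0), α(1), …)` of a one-dimensional polyindex. -/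
noncomputable def shift1 (α : Polyindex1) : Polyindex1 :=
  Finsupp.embDomain ⟨Nat.succ, Nat.succ_injective⟩ α

theorem order1_add (α β : Polyindex1) : order1 (α + β) = order1 α + order1 β :=
  Finsupp.sum_add_index' (by simp) (by intros; ring)

theorem order1_single (i n : ℕ) : order1 (Finsupp.single i n) = n * (i + 1) := by
  simp [order1]

theorem order1_shift1 (α : Polyindex1) : order1 (shift1 α) = order1 α + size1 α := by
  simp only [order1, shift1, size1, Finsupp.sum_embDomain]
  rw [← Finsupp.sum_add]
  rfl

theorem exists_shift1 {α : Polyindex1} (h : α 0 = 0) : ∃ β, α = shift1 β := by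
  refine ⟨α.comapDomain Nat.succ Nat.succ_injective.injOn, ?_⟩
  have := Finsupp.embDomain_comapDomain (f := ⟨Nat.succ, Nat.succ_injective⟩) (g := α) ?_
  · exact this.symm
  · intro x hx
    rcases x with _ | x
    · simp [h] at hx
    · exact ⟨x, rfl⟩

theorem size1_pos {α : Polyindex1} (h : α ≠ 0) : 0 < size1 α := by
  obtain ⟨i, hi⟩ := Finsupp.ne_iff.1 h
  have : α i ≤ size1 α := Finset.single_le_sum (f := fun i => α i) (fun _ _ => Nat.zero_le _)
    (Finsupp.mem_support_iff.2 hi)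
  have := Nat.pos_of_ne_zero hi
  omega

/-- There are at most `3^k` one-dimensional polyindices of order at most `k`: a nonzero one either
contains the part `1`, which can be removed, or arises by a shift, and both the removal and the
inverse shift lower the order. -/
theorem finite_order1_le (k : ℕ) :
    {α : Polyindex1 | order1 α ≤ k}.Finite ∧ {α : Polyindex1 | order1 α ≤ k}.ncard ≤ 3 ^ k := by
  have hsub (k : ℕ) (S : Set Polyindex1) (hS : ∀ α, order1 α + 1 ≤ k → α ∈ S) :
      {α : Polyindex1 | order1 α ≤ k} ⊆
        {0} ∪ ((fun α => Finsupp.single 0 1 + α) '' S ∪ shift1 '' S) := by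
    intro α hα
    rw [Set.mem_ofPred_eq] at hα
    by_cases h0 : α = 0
    · exact Or.inl h0
    right
    by_cases h : α 0 = 0
    · right
      obtain ⟨β, rfl⟩ := exists_shift1 h
      refine ⟨β, hS _ ?_, rfl⟩
      rw [order1_shift1] at hα
      have : 0 < size1 β := size1_pos fun hβ => h0 (by simp [hβ, shift1])
      omega
    · left
      have hle : Finsupp.single 0 1 ≤ α := by
        rw [Finsupp.single_le_iff]; omega
      refine ⟨α - Finsupp.single 0 1, hS _ ?_, add_tsub_cancel_of_le hle⟩
      have := order1_add (Finsupp.single 0 1) (α - Finsupp.single 0 1)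
      rw [add_tsub_cancel_of_le hle, order1_single] at this
      omega
  induction k with
  | zero =>
    have h := hsub 0 ∅ (by intro α h; omega)
    simp only [Set.image_empty, Set.union_empty] at h
    exact ⟨(Set.finite_singleton _).subset h,
      (Set.ncard_le_ncard h (Set.finite_singleton _)).trans (by simp)⟩
  | succ k ih =>
    have h := hsub (k + 1) {α | order1 α ≤ k} fun α h => Nat.le_of_succ_le_succ h
    have hfin := (Set.finite_singleton (0 : Polyindex1)).union
      ((ih.1.image (fun α => Finsupp.single 0 1 + α)).union (ih.1.image shift1))
    refine ⟨hfin.subset h, (Set.ncard_le_ncard h hfin).trans ?_⟩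
    refine (Set.ncard_union_le _ _).trans ?_
    have h1 := Set.ncard_union_le ((fun α => Finsupp.single 0 1 + α) '' {α | order1 α ≤ k})
      (shift1 '' {α | order1 α ≤ k})
    have h2 := Set.ncard_image_le (f := fun α => Finsupp.single 0 1 + α) ih.1
    have h3 := Set.ncard_image_le (f := shift1) ih.1
    have h4 : 0 < 3 ^ k := by positivity
    rw [Set.ncard_singleton, pow_succ]
    have := ih.2
    omega

theorem indexSet_card (d k : ℕ) :
    (indexSet d k).Finite ∧ (indexSet d k).ncard ≤ (3 ^ (2 + 2 * d)) ^ k := by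
  obtain ⟨hfin, hcard⟩ := finite_order1_le k
  classical
  set S : Finset Polyindex1 := hfin.toFinset with hS
  have hmem (α : Polyindex1) : α ∈ S ↔ order1 α ≤ k := by simp [hS]
  have hScard : S.card ≤ 3 ^ k := by rwa [hS, ← Set.ncard_eq_toFinset_card _ hfin]
  have hle (β : Polyindex d) (σ : Fin d) : order1 (β σ) ≤ order β :=
    Finset.single_le_sum (f := fun σ => order1 (β σ)) (fun _ _ => Nat.zero_le _)
      (Finset.mem_univ σ)
  set B : Finset (Polyindex d) := Fintype.piFinset fun _ => S
  have hsub : indexSet d k ⊆ (S ×ˢ (B ×ˢ (S ×ˢ B)) :) := by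
    rintro ⟨α, β, a, b⟩ h
    have h : order1 α + order β + order1 a + order b = k := h
    simp only [Finset.coe_product, Set.mem_prod, Finset.mem_coe, hmem, B, Fintype.mem_piFinset]
    refine ⟨by omega, fun σ => ?_, by omega, fun σ => ?_⟩
    · have := hle β σ; omega
    · have := hle b σ; omega
  refine ⟨(Finset.finite_toSet _).subset hsub,
    (Set.ncard_le_ncard hsub (Finset.finite_toSet _)).trans ?_⟩
  rw [Set.ncard_coe_finset]
  simp only [Finset.card_product, B, Fintype.card_piFinset, Finset.prod_const, Finset.card_univ,
    Fintype.card_fin]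
  calc S.card * (S.card ^ d * (S.card * S.card ^ d)) = S.card ^ (2 + 2 * d) := by ring
    _ ≤ (3 ^ k) ^ (2 + 2 * d) := Nat.pow_le_pow_left hScard _
    _ = _ := by rw [← pow_mul, ← pow_mul, mul_comm]

/-! ### Products of iterated derivatives -/

section Products

variable {d : ℕ}

/-- The factors `C^{i+1} i! G` multiply up to `C^{‖α‖} (∏ (i!)^{α(i)}) G^{|α|}`. -/
theorem norm_finsupp_prod_le {u : ℕ → ℂ} {C G : ℝ}
    (h : ∀ i, ‖u i‖ ≤ C ^ (i + 1) * i.factorial * G) (α : Polyindex1) :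
    ‖α.prod fun i n => u i ^ n‖ ≤ C ^ order1 α * barFactorial1 α * G ^ size1 α := by
  simp only [Finsupp.prod, order1, barFactorial1, size1, Finsupp.sum, norm_prod, norm_pow]
  rw [← Finset.prod_pow_eq_pow_sum, ← Finset.prod_pow_eq_pow_sum, Nat.cast_prod,
    ← Finset.prod_mul_distrib, ← Finset.prod_mul_distrib]
  refine Finset.prod_le_prod (fun _ _ => by positivity) fun i _ => ?_
  refine (pow_le_pow_left₀ (norm_nonneg _) (h i) _).trans_eq ?_
  rw [mul_pow, mul_pow, ← pow_mul, mul_comm (i + 1)]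
  push_cast
  rfl

theorem norm_fAlphaBeta_le {ω₁ ω₂ : RSpace d → ℝ} {ξ : RSpace d} {C s : ℝ}
    (hw : ∀ j x, ‖(opD ω₁ ω₂ ξ)^[j] (wFun ω₁ ω₂ ξ) x‖ ≤ C ^ (j + 1) * j.factorial)
    (hv : ∀ σ j x, ‖(opD ω₁ ω₂ ξ)^[j] (fun x => (vField ω₁ ω₂ ξ σ x : ℂ)) x‖ ≤
      C ^ (j + 1) * j.factorial * weight s x)
    (α : Polyindex1) (β : Polyindex d) (h : RSpace d) :
    ‖fAlphaBeta ω₁ ω₂ ξ α β h‖ ≤ C ^ (order1 α + order β) * weight s h ^ size β *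
      (barFactorial1 α * barFactorial β) := by
  have h1 := norm_finsupp_prod_le (u := fun i => (opD ω₁ ω₂ ξ)^[i] (wFun ω₁ ω₂ ξ) h) (G := 1)
    (fun i => (hw i h).trans_eq (mul_one _).symm) α
  have h2 : ‖∏ σ, (β σ).prod fun i n =>
      ((opD ω₁ ω₂ ξ)^[i] (fun x => (vField ω₁ ω₂ ξ σ x : ℂ)) h) ^ n‖ ≤
      C ^ order β * barFactorial β * weight s h ^ size β := by
    simp only [norm_prod, order, barFactorial, size]
    rw [← Finset.prod_pow_eq_pow_sum, ← Finset.prod_pow_eq_pow_sum, Nat.cast_prod,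
      ← Finset.prod_mul_distrib, ← Finset.prod_mul_distrib]
    exact Finset.prod_le_prod (fun _ _ => norm_nonneg _) fun σ _ =>
      norm_finsupp_prod_le (fun i => hv σ i h) (β σ)
  rw [fAlphaBeta, norm_mul]
  refine (mul_le_mul h1 h2 (norm_nonneg _) ((norm_nonneg _).trans h1)).trans_eq ?_
  rw [one_pow, pow_add]
  ring

end Products

/-! ### Bounds for the iterated commutators -/

section Commutators

variable {d : ℕ} {ω₁ ω₂ : RSpace d → ℝ} {ξ : RSpace d} {V : RSpace d → ℂ} {s K c : ℝ}

theorem size1_single_zero (n : ℕ) : size1 (Finsupp.single 0 n) = n := by simp [size1]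

theorem size_single_zero (p : Fin d → ℕ) : size (fun σ => Finsupp.single 0 (p σ)) = msize p := by
  simp [size, size1_single_zero, msize]

/-- The weighted bounds for `T_{p,q}`. The two weights need not be exact powers of `g`: bounded
smooth factors can be absorbed in the test functions. -/
theorem WeightedBounds.norm_blockForm_le (hB : WeightedBounds ω₁ ω₂ s V ξ K c) (p q : Fin d → ℕ)
    {f h : RSpace d → ℂ} (hf : IsSmooth f) (hh : IsSmooth h) {W W' : ℝ}
    (hfW : ∀ x, ‖f x‖ ≤ W * weight s x ^ msize p) (hhW : ∀ x, ‖h x‖ ≤ W' * weight s x ^ msize q)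
    {φ ψ : RSpace d → ℂ} (hφ : IsTest φ) (hψ : IsTest ψ) :
    ‖blockForm V p q f h φ (resolvent ω₁ ω₂ ξ ψ)‖ ≤
      K * c ^ msize (p + q) * mfactorial (p + q) * (W * W') * (l2norm φ * l2norm ψ) := by
  have hb := hB (fun σ => Finsupp.single 0 (p σ)) (fun σ => Finsupp.single 0 (q σ))
  have hgam : gam (fun σ => Finsupp.single 0 (p σ)) (fun σ => Finsupp.single 0 (q σ)) = p + q := by
    funext σ
    simp [gam, size1_single_zero]
  have hsize : size ((fun σ => Finsupp.single 0 (p σ) : Polyindex d) +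
      fun σ => Finsupp.single 0 (q σ)) = msize (p + q) := by
    rw [← size_single_zero (p + q)]
    congr 1
    funext σ
    simp
  rw [hgam, hsize] at hb
  have hpos (m : ℕ) (x : RSpace d) : 0 < weight s x ^ m := pow_pos (weight_pos s x) m
  have hg (m : ℕ) : IsSmooth fun x : RSpace d => ((weight s x ^ m : ℝ) : ℂ)⁻¹ :=
    (IsSmooth.ofReal ((isSmooth_weight s).pow m)).inv fun x => by exact_mod_cast (hpos m x).ne'
  -- `u` and `u'` are bounded and smooth, so `u φ` and `u' ψ` are again test functions
  set u : RSpace d → ℂ := fun x => (starRingEnd ℂ) (f x) * ((weight s x ^ msize p : ℝ) : ℂ)⁻¹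
    with hu
  set u' : RSpace d → ℂ := fun x => h x * ((weight s x ^ msize q : ℝ) : ℂ)⁻¹ with hu'
  have hφ' : IsTest fun x => u x * φ x := hφ.mul_left (hf.conj.mul (hg _))
  have hψ' : IsTest fun x => u' x * ψ x := hψ.mul_left (hh.mul (hg _))
  have huW (x : RSpace d) : ‖u x‖ ≤ W := by
    rw [hu]
    simp only [norm_mul, norm_inv, RCLike.norm_conj, Complex.norm_real, Real.norm_eq_abs,
      abs_of_pos (hpos _ _)]
    rw [← div_eq_mul_inv, div_le_iff₀ (hpos _ _)]
    exact hfW x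
  have huW' (x : RSpace d) : ‖u' x‖ ≤ W' := by
    rw [hu']
    simp only [norm_mul, norm_inv, Complex.norm_real, Real.norm_eq_abs, abs_of_pos (hpos _ _)]
    rw [← div_eq_mul_inv, div_le_iff₀ (hpos _ _)]
    exact hhW x
  have hW0 : 0 ≤ W := (norm_nonneg _).trans (huW 0)
  have hW0' : 0 ≤ W' := (norm_nonneg _).trans (huW' 0)
  have key := hb.norm_le hφ' hψ'
  have heq : blockForm V p q f h φ (resolvent ω₁ ω₂ ξ ψ) =
      pairing (fun x => u x * φ x) (fun y => (weight s y : ℂ) ^ msize p *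
        convT V p q (resolvent ω₁ ω₂ ξ
          (fun h' => (weight s h' : ℂ) ^ msize q * (u' h' * ψ h'))) y) := by
    rw [pairing_mul_left, blockForm]
    have hne (x : RSpace d) : (weight s x : ℂ) ≠ 0 := by exact_mod_cast (weight_pos s x).ne'
    have h1 : (fun h' => (weight s h' : ℂ) ^ msize q * (u' h' * ψ h')) = fun x => h x * ψ x := by
      funext x
      have := hne x
      simp only [hu', Complex.ofReal_pow]
      field_simp
    rw [h1, resolvent_mul]
    congr 1
    funext x
    have := hne x
    simp only [hu, Complex.ofReal_pow, map_mul, map_inv₀, map_pow, Complex.conj_ofReal,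
      Complex.conj_conj]
    field_simp
  rw [heq]
  rw [size_single_zero, size_single_zero, opT_eq_convT] at key
  simp only [size1_single_zero] at key
  refine key.trans ?_
  have hN := hb.nonneg
  calc _ ≤ K * c ^ msize (p + q) * mfactorial (p + q) * ((W * l2norm φ) * (W' * l2norm ψ)) := by
        refine mul_le_mul_of_nonneg_left ?_ hN
        refine mul_le_mul (hφ.l2norm_le hW0 fun x => ?_) (hψ.l2norm_le hW0' fun x => ?_)
          (l2norm_nonneg _) (mul_nonneg hW0 (l2norm_nonneg _))
        · rw [norm_mul]; gcongr; exact huW x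
        · rw [norm_mul]; gcongr; exact huW' x
    _ = _ := by ring

theorem mfactorial_add_single (γ : Fin d → ℕ) (σ : Fin d) :
    mfactorial (γ + Pi.single σ 1) = (γ σ + 1) * mfactorial γ := by
  rw [mfactorial, mfactorial, ← Finset.mul_prod_erase _ _ (Finset.mem_univ σ),
    ← Finset.mul_prod_erase _ (fun σ => (γ σ).factorial) (Finset.mem_univ σ), ← mul_assoc]
  congr 1
  · simp [Nat.factorial_succ]
  · refine Finset.prod_congr rfl fun τ hτ => ?_
    simp [Finset.ne_of_mem_erase hτ]

/-- The main estimate. In the commutator of `M_f T_{p,q} M_h` with `A`, derivatives of `f` and `h`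
produce the factor `C (n + m)`, the terms with `w` the factor `2 C`, and the terms with `v_σ` the
factors `2 C c (γ_σ + 1)`, `γ = p + q`; together at most `C (2 + 2 c (1 + d)) (n + m + 1)`. -/
theorem WeightedBounds.norm_adIter_le {C : ℝ} (hω : IsSmooth (omegaXi ω₁ ω₂ ξ))
    (hV : LocallyIntegrable V) (hC : 0 ≤ C) (hc : 0 ≤ c)
    (hw : IterBound ω₁ ω₂ ξ (weight s) C 0 1 C (wFun ω₁ ω₂ ξ))
    (hv : ∀ σ, IterBound ω₁ ω₂ ξ (weight s) C 1 1 C fun x => (vField ω₁ ω₂ ξ σ x : ℂ))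
    (hB : WeightedBounds ω₁ ω₂ s V ξ K c) (hK : 0 ≤ K) (k : ℕ) {p q : Fin d → ℕ} {n m : ℕ}
    {W W' : ℝ} (hW : 0 ≤ W) (hW' : 0 ≤ W') {f h : RSpace d → ℂ}
    (hf : IterBound ω₁ ω₂ ξ (weight s) C (msize p) n W f)
    (hh : IterBound ω₁ ω₂ ξ (weight s) C (msize q) m W' h) (hnm : msize (p + q) ≤ n + m)
    {φ ψ : RSpace d → ℂ} (hφ : IsTest φ) (hψ : IsTest ψ) :
    ‖adIter ω₁ ω₂ ξ (blockForm V p q f h) k φ (resolvent ω₁ ω₂ ξ ψ)‖ ≤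
      K * c ^ msize (p + q) * mfactorial (p + q) * (W * W') *
        ((C * (2 + 2 * c * (1 + d))) ^ k * (n + m + 1).ascFactorial k) *
        (l2norm φ * l2norm ψ) := by
  induction k generalizing p q n m W W' f h with
  | zero =>
    have h1 (x : RSpace d) : ‖f x‖ ≤ W * weight s x ^ msize p := by simpa using hf.bound 0 x
    have h2 (x : RSpace d) : ‖h x‖ ≤ W' * weight s x ^ msize q := by simpa using hh.bound 0 x
    simpa [adIter] using hB.norm_blockForm_le p q hf.smooth hh.smooth h1 h2 hφ hψ
  | succ k ih =>
    rw [adIter_blockForm_succ hω hV p q hf.smooth hh.smooth k hφ (hψ.resolvent hω)]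
    set E : ℝ := 2 + 2 * c * (1 + d) with hE
    set X : ℝ := K * c ^ msize (p + q) * mfactorial (p + q) * (W * W') *
      ((C * E) ^ k * (n + m + 1 + 1).ascFactorial k) * (l2norm φ * l2norm ψ) with hX
    have hX0 : 0 ≤ X := by
      have := l2norm_nonneg φ
      have := l2norm_nonneg ψ
      positivity
    have hvh (σ : Fin d) := (hv σ).mul hω hh
    have hvf (σ : Fin d) := (hv σ).mul hω hf
    have hwf := hw.mul hω hf
    have hwh := hw.mul hω hh
    simp only [add_comm 1 (msize _)] at hvh hvf
    rw [zero_add] at hwf hwh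
    have b1 (σ : Fin d) := ih hW (mul_nonneg hC hW') hf
      (by simpa only [msize_add_single] using hvh σ : IterBound ω₁ ω₂ ξ (weight s) C
        (msize (q + Pi.single σ 1)) _ _ _)
      (by rw [← add_assoc p, msize_add_single]; omega)
    have b2 (σ : Fin d) := ih (mul_nonneg hC hW) hW'
      (by simpa only [msize_add_single] using hvf σ : IterBound ω₁ ω₂ ξ (weight s) C
        (msize (p + Pi.single σ 1)) _ _ _) hh
      (by rw [add_right_comm p, msize_add_single]; omega)
    have b3 := ih (by positivity) hW' (hf.opD hω) hh (by omega)
    have b4 := ih hW (by positivity) hf (hh.opD hω) (by omega)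
    have b5 := ih (mul_nonneg hC hW) hW' hwf hh (by omega)
    have b6 := ih hW (mul_nonneg hC hW') hf hwh (by omega)
    simp only [← add_assoc p, msize_add_single, mfactorial_add_single,
      show n + (1 + m) + 1 = n + m + 1 + 1 by ring] at b1
    simp only [add_right_comm p, msize_add_single, mfactorial_add_single,
      show 1 + n + m + 1 = n + m + 1 + 1 by ring] at b2
    rw [show n + 1 + m + 1 = n + m + 1 + 1 by ring] at b3
    rw [show n + (m + 1) + 1 = n + m + 1 + 1 by ring] at b4
    rw [show 1 + n + m + 1 = n + m + 1 + 1 by ring] at b5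
    rw [show n + (1 + m) + 1 = n + m + 1 + 1 by ring] at b6
    have hsum : ∑ σ, (2 * (C * c) * (((p + q) σ + 1 : ℕ) : ℝ)) ≤
        2 * (C * c) * ((n + m + 1) * (1 + d)) := by
      rw [← Finset.mul_sum]
      refine mul_le_mul_of_nonneg_left ?_ (by positivity)
      have h1 : ∑ σ, ((p + q) σ + 1) = msize (p + q) + d := by
        rw [Finset.sum_add_distrib]; simp [msize]
      have h2 : ((∑ σ, ((p + q) σ + 1) : ℕ) : ℝ) ≤ n + m + d := by
        rw [h1]; push_cast
        have : (msize (p + q) : ℝ) ≤ n + m := by exact_mod_cast hnm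
        linarith
      push_cast at h2 ⊢
      have : (0 : ℝ) ≤ (n + m) * d := by positivity
      linarith
    refine (norm_sub_le _ _).trans ?_
    calc _ ≤ (∑ σ, X * (2 * (C * c) * (((p + q) σ + 1 : ℕ) : ℝ))) +
          (X * (C * n) + X * (C * m) + X * C + X * C) := by
          refine add_le_add ?_ ?_
          · refine (norm_sum_le _ _).trans (Finset.sum_le_sum fun σ _ => ?_)
            refine (norm_add_le _ _).trans ((add_le_add (b1 σ) (b2 σ)).trans_eq ?_)
            rw [hX]; push_cast; ring
          · refine (norm_add₄_le).trans
              (add_le_add (add_le_add (add_le_add ?_ ?_) ?_) ?_)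
            · exact b3.trans_eq (by rw [hX]; ring)
            · exact b4.trans_eq (by rw [hX]; ring)
            · exact b5.trans_eq (by rw [hX]; ring)
            · exact b6.trans_eq (by rw [hX]; ring)
      _ ≤ X * (2 * (C * c) * ((n + m + 1) * (1 + d))) +
          (X * (C * n) + X * (C * m) + X * C + X * C) := by
          rw [← Finset.mul_sum]
          gcongr
      _ ≤ X * (C * E * (n + m + 1)) := by
          have : 0 ≤ X * (C * (n + m)) := by positivity
          rw [hE]
          linarith
      _ = _ := by
          rw [ascFactorial_succ_left, hX]; push_cast; ring

theorem iterBound_wFun {C : ℝ} (hω : IsSmooth (omegaXi ω₁ ω₂ ξ))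
    (hw : ∀ j x, ‖(opD ω₁ ω₂ ξ)^[j] (wFun ω₁ ω₂ ξ) x‖ ≤ C ^ (j + 1) * j.factorial) :
    IterBound ω₁ ω₂ ξ (weight s) C 0 1 C (wFun ω₁ ω₂ ξ) where
  smooth := isSmooth_wFun hω
  bound j x := (hw j x).trans_eq (by rw [Nat.one_ascFactorial]; ring)

theorem iterBound_vField {C : ℝ} (hω : IsSmooth (omegaXi ω₁ ω₂ ξ)) (σ : Fin d)
    (hv : ∀ j x, ‖(opD ω₁ ω₂ ξ)^[j] (fun x => (vField ω₁ ω₂ ξ σ x : ℂ)) x‖ ≤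
      C ^ (j + 1) * j.factorial * weight s x) :
    IterBound ω₁ ω₂ ξ (weight s) C 1 1 C fun x => (vField ω₁ ω₂ ξ σ x : ℂ) where
  smooth := (isSmooth_vField hω σ).ofReal
  bound j x := (hv j x).trans_eq (by rw [Nat.one_ascFactorial]; ring)

theorem WeightedBounds.nonneg (hB : WeightedBounds ω₁ ω₂ s V ξ K c) : 0 ≤ K := by
  have h := (hB 0 0).nonneg
  simpa [size, size1, gam, mfactorial] using h

theorem WeightedBounds.adNormLE {C : ℝ} (hω : IsSmooth (omegaXi ω₁ ω₂ ξ))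
    (hV : LocallyIntegrable V) (hC : 0 ≤ C) (hc : 0 ≤ c)
    (hw : ∀ j x, ‖(opD ω₁ ω₂ ξ)^[j] (wFun ω₁ ω₂ ξ) x‖ ≤ C ^ (j + 1) * j.factorial)
    (hv : ∀ σ j x, ‖(opD ω₁ ω₂ ξ)^[j] (fun x => (vField ω₁ ω₂ ξ σ x : ℂ)) x‖ ≤
      C ^ (j + 1) * j.factorial * weight s x)
    (hB : WeightedBounds ω₁ ω₂ s V ξ K c) (k : ℕ) {N : ℝ}
    (hN : K * (C * (2 + 2 * c * (1 + d))) ^ k * k.factorial ≤ N) :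
    AdNormLE ω₁ ω₂ V ξ k N := by
  have hK := hB.nonneg
  have hq : (fun φ ψ => pairing φ (convCheck V ψ)) = blockForm V 0 0 (fun _ => 1) fun _ => 1 := by
    funext φ ψ
    simp [blockForm, convT_zero]
  have hs := ((isSesquilinear_blockForm hV 0 0 (f := fun _ => 1) (h := fun _ => 1)
    contDiff_const contDiff_const).adIter hω k).resolvent hω
  have hN0 : 0 ≤ N := le_trans (by positivity) hN
  have := hs.formNormLE hN0 fun φ ψ hφ hψ => by
    have h1 : IterBound ω₁ ω₂ ξ (weight s) C (msize (0 : Fin d → ℕ)) 0 1 fun _ => 1 := by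
      simpa [msize] using IterBound.one (ω₁ := ω₁) (ω₂ := ω₂) (ξ := ξ) (g := weight s) (C := C)
    have h2 := hB.norm_adIter_le hω hV hC hc (iterBound_wFun hω hw)
      (fun σ => iterBound_vField hω σ (hv σ)) hK k zero_le_one zero_le_one h1 h1
      (by simp [msize]) hφ hψ
    refine h2.trans ?_
    refine mul_le_mul_of_nonneg_right (le_trans (le_of_eq ?_) hN)
      (mul_nonneg (l2norm_nonneg _) (l2norm_nonneg _))
    simp [msize, mfactorial, Nat.one_ascFactorial]
    ring
  unfold AdNormLE
  simp only [adForm_eq_adIter, hq]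
  exact this

/-! ### From resolvent bounds to weighted bounds -/

theorem isSesquilinear_opT (hω : IsSmooth (omegaXi ω₁ ω₂ ξ)) (hV : LocallyIntegrable V)
    (β b : Polyindex d) :
    IsSesquilinear fun φ ψ => pairing φ (opT V β b (resolvent ω₁ ω₂ ξ ψ)) := by
  rw [opT_eq_convT]
  exact (isSesquilinear_pairing (fun hψ => isSmooth_convT hV _ _ hψ)
    (fun h h' => convT_add hV _ _ h h') (fun a _ h => convT_const_mul _ _ a h)).resolvent hω

theorem size_add (β b : Polyindex d) : size (β + b) = size β + size b := by
  simp only [size, ← Finset.sum_add_distrib]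
  exact Finset.sum_congr rfl fun σ _ => Finsupp.sum_add_index' (by simp) (by intros; ring)

/-- The weight is at most `G`, so `g^{|β|}` and `g^{|b|}` cost the factor `G^{|β+b|}`. -/
theorem ResolventBounds.weightedBounds (hω : IsSmooth (omegaXi ω₁ ω₂ ξ))
    (hV : LocallyIntegrable V) {G : ℝ} (hG : ∀ x : RSpace d, weight s x ≤ G)
    (hR : ResolventBounds ω₁ ω₂ V ξ K c) : WeightedBounds ω₁ ω₂ s V ξ K (c * G) := by
  intro β b
  have hb := hR β b
  have hG0 : 0 ≤ G := (weight_pos s 0).le.trans (hG 0)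
  have hg (m : ℕ) : IsSmooth fun x : RSpace d => (weight s x : ℂ) ^ m :=
    (isSmooth_weight s).ofReal.pow m
  have hgG (m : ℕ) (x : RSpace d) : ‖(weight s x : ℂ) ^ m‖ ≤ G ^ m := by
    rw [norm_pow, Complex.norm_real, Real.norm_eq_abs, abs_of_pos (weight_pos s x)]
    exact pow_le_pow_left₀ (weight_pos s x).le (hG x) m
  have heq (φ ψ : RSpace d → ℂ) : pairing φ (fun h => (weight s h : ℂ) ^ size β *
      opT V β b (resolvent ω₁ ω₂ ξ (fun h' => (weight s h' : ℂ) ^ size b * ψ h')) h) =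
      pairing (fun x => (weight s x : ℂ) ^ size β * φ x)
        (opT V β b (resolvent ω₁ ω₂ ξ (fun h' => (weight s h' : ℂ) ^ size b * ψ h'))) := by
    rw [pairing_mul_left]
    simp
  simp only [heq]
  have hs := isSesquilinear_opT hω hV β b
  have hN : K * (c * G) ^ size (β + b) * mfactorial (gam β b) =
      K * c ^ size (β + b) * mfactorial (gam β b) * (G ^ size β * G ^ size b) := by
    rw [← pow_add, ← size_add, mul_pow]; ring
  have hN0 := hb.nonneg
  refine IsSesquilinear.formNormLE ?_ (by rw [hN]; positivity) fun φ ψ hφ hψ => ?_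
  · constructor
    · intro φ φ' ψ h h' h''
      simp only [mul_add]
      exact hs.add_left (h.mul_left (hg _)) (h'.mul_left (hg _)) (h''.mul_left (hg _))
    · intro a φ ψ h h'
      simp only [mul_left_comm _ a]
      exact hs.smul_left a (h.mul_left (hg _)) (h'.mul_left (hg _))
    · intro φ ψ ψ' h h' h''
      simp only [mul_add]
      exact hs.add_right (h.mul_left (hg _)) (h'.mul_left (hg _)) (h''.mul_left (hg _))
    · intro a φ ψ h h'
      simp only [mul_left_comm _ a]
      exact hs.smul_right a (h.mul_left (hg _)) (h'.mul_left (hg _))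
  · refine (hb.norm_le (hφ.mul_left (hg _)) (hψ.mul_left (hg _))).trans ?_
    calc _ ≤ K * c ^ size (β + b) * mfactorial (gam β b) *
          ((G ^ size β * l2norm φ) * (G ^ size b * l2norm ψ)) := by
          refine mul_le_mul_of_nonneg_left ?_ hN0
          refine mul_le_mul (hφ.l2norm_le (by positivity) fun x => ?_)
            (hψ.l2norm_le (by positivity) fun x => ?_)
            (l2norm_nonneg _) (mul_nonneg (by positivity) (l2norm_nonneg _)) <;>
          · rw [norm_mul]; gcongr; exact hgG _ x
      _ = _ := by rw [hN]; ring

end Commutators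

/-! ### A weighted Young inequality -/

section Young

variable {d : ℕ}

/-- Hölder's inequality on `ℝ^d × ℝ^d` for the three functions `φ² v^t`, `ψ² v^t` and `φ² r`, with
the exponents `1/t - 1/2`, `1/2` and `1 - 1/t`. It combines Young's inequality for the convolution
with `v ∈ L^t` and Hölder's inequality for the multiplication by `r^{1 - 1/t}`. -/
theorem lintegral_convolution_le {φ ψ r v : RSpace d → ℝ≥0∞} (hφ : Measurable φ)
    (hψ : Measurable ψ) (hr : Measurable r) (hv : AEMeasurable v volume) {t : ℝ} (ht1 : 1 ≤ t)
    (ht2 : t ≤ 2) :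
    ∫⁻ k, ∫⁻ y, φ k * (v y * (r (k + y) ^ (1 - 1 / t) * ψ (k + y))) ≤
      (∫⁻ x, φ x ^ (2 : ℝ)) ^ (1 / 2 : ℝ) * (∫⁻ x, ψ x ^ (2 : ℝ)) ^ (1 / 2 : ℝ) *
        ((∫⁻ x, v x ^ t) ^ (1 / t) * (∫⁻ x, r x) ^ (1 - 1 / t)) := by
  have ht0 : 0 < t := by linarith
  have hc : 0 ≤ 1 - 1 / t := by
    rw [sub_nonneg, div_le_one ht0]; exact ht1
  have ha : 0 ≤ 1 / t - 1 / 2 := by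
    rw [sub_nonneg]; exact one_div_le_one_div_of_le ht0 ht2
  have hb : (0 : ℝ) ≤ 1 / 2 := by norm_num
  set a : ℝ := 1 / t - 1 / 2 with hadef
  set c : ℝ := 1 - 1 / t with hcdef
  have hac : 2 * a + 2 * c = 1 := by rw [hadef, hcdef]; ring
  have htab : t * a + t * (1 / 2) = 1 := by rw [hadef]; field_simp; ring
  -- the exponents match
  have hexp (x₁ x₂ x₃ x₄ : ℝ≥0∞) : x₁ * (x₃ * (x₄ ^ c * x₂)) =
      (x₁ ^ (2 : ℝ) * x₃ ^ t) ^ a * (x₂ ^ (2 : ℝ) * x₃ ^ t) ^ (1 / 2 : ℝ) *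
        (x₁ ^ (2 : ℝ) * x₄) ^ c := by
    have h1 : x₁ = x₁ ^ (2 * a) * x₁ ^ (2 * c) := by
      rw [← ENNReal.rpow_add_of_nonneg _ _ (by positivity) (by positivity), hac, ENNReal.rpow_one]
    have h3 : x₃ = x₃ ^ (t * a) * x₃ ^ (t * (1 / 2)) := by
      rw [← ENNReal.rpow_add_of_nonneg _ _ (by positivity) (by positivity), htab,
        ENNReal.rpow_one]
    rw [ENNReal.mul_rpow_of_nonneg _ _ ha, ENNReal.mul_rpow_of_nonneg _ _ hb,
      ENNReal.mul_rpow_of_nonneg _ _ hc, ← ENNReal.rpow_mul, ← ENNReal.rpow_mul,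
      ← ENNReal.rpow_mul, ← ENNReal.rpow_mul, ← ENNReal.rpow_mul,
      show (2 : ℝ) * (1 / 2) = 1 by norm_num, ENNReal.rpow_one]
    conv_lhs => rw [h1, h3]
    ring
  set F : Fin 3 → RSpace d × RSpace d → ℝ≥0∞ :=
    ![fun z => φ z.1 ^ (2 : ℝ) * v z.2 ^ t, fun z => ψ (z.1 + z.2) ^ (2 : ℝ) * v z.2 ^ t,
      fun z => φ z.1 ^ (2 : ℝ) * r (z.1 + z.2)] with hF
  have hm1 : Measurable fun z : RSpace d × RSpace d => φ z.1 ^ (2 : ℝ) :=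
    (hφ.comp measurable_fst).pow_const _
  have hm2 : Measurable fun z : RSpace d × RSpace d => ψ (z.1 + z.2) ^ (2 : ℝ) :=
    (hψ.comp (measurable_fst.add measurable_snd)).pow_const _
  have hm3 : AEMeasurable (fun z : RSpace d × RSpace d => v z.2)
      ((volume : Measure (RSpace d)).prod volume) := hv.comp_snd
  have hm4 : Measurable fun z : RSpace d × RSpace d => r (z.1 + z.2) :=
    hr.comp (measurable_fst.add measurable_snd)
  have hFm : ∀ i ∈ Finset.univ, AEMeasurable (F i)
      ((volume : Measure (RSpace d)).prod volume) := by
    intro i _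
    fin_cases i
    · exact hm1.aemeasurable.mul (hm3.pow_const _)
    · exact hm2.aemeasurable.mul (hm3.pow_const _)
    · exact (hm1.mul hm4).aemeasurable
  have key := ENNReal.lintegral_prod_norm_pow_le
    (μ := (volume : Measure (RSpace d)).prod (volume : Measure (RSpace d))) Finset.univ hFm
    (p := ![a, 1 / 2, c]) (by simp [Fin.sum_univ_three, hadef, hcdef]) (by
      intro i _
      fin_cases i
      · exact ha
      · exact hb
      · exact hc)
  simp only [Fin.prod_univ_three, hF, Matrix.cons_val_zero, Matrix.cons_val_one,
    Matrix.cons_val_two, Matrix.head_cons, Matrix.tail_cons] at key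
  simp only [← hexp] at key
  have hm5 : AEMeasurable (fun z : RSpace d × RSpace d =>
      φ z.1 * (v z.2 * (r (z.1 + z.2) ^ c * ψ (z.1 + z.2))))
      ((volume : Measure (RSpace d)).prod volume) :=
    (hφ.comp measurable_fst).aemeasurable.mul (hm3.mul ((hm4.pow_const _).aemeasurable.mul
      (hψ.comp (measurable_fst.add measurable_snd)).aemeasurable))
  rw [lintegral_prod _ hm5] at key
  refine key.trans (le_of_eq ?_)
  set Φ := ∫⁻ x, φ x ^ (2 : ℝ) with hΦ
  set Ψ := ∫⁻ x, ψ x ^ (2 : ℝ) with hΨ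
  set Vt := ∫⁻ x, v x ^ t with hVt
  have i0 : ∫⁻ z : RSpace d × RSpace d, φ z.1 ^ (2 : ℝ) * v z.2 ^ t
      ∂((volume : Measure (RSpace d)).prod volume) = Φ * Vt :=
    lintegral_prod_mul (hφ.pow_const _).aemeasurable (hv.pow_const _)
  have i1 : ∫⁻ z : RSpace d × RSpace d, ψ (z.1 + z.2) ^ (2 : ℝ) * v z.2 ^ t
      ∂((volume : Measure (RSpace d)).prod volume) = Ψ * Vt := by
    refine (lintegral_prod_symm _ (hm2.aemeasurable.mul (hm3.pow_const _))).trans ?_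
    have (y : RSpace d) : ∫⁻ x, ψ (x + y) ^ (2 : ℝ) * v y ^ t = Ψ * v y ^ t := by
      refine (lintegral_mul_const _
        ((hψ.comp (measurable_id.add_const y)).pow_const _)).trans ?_
      exact congrArg (· * v y ^ t) (lintegral_add_right_eq_self (fun x => ψ x ^ (2 : ℝ)) y)
    exact (lintegral_congr this).trans (lintegral_const_mul'' _ (hv.pow_const _))
  have i2 : ∫⁻ z : RSpace d × RSpace d, φ z.1 ^ (2 : ℝ) * r (z.1 + z.2)
      ∂((volume : Measure (RSpace d)).prod volume) = Φ * ∫⁻ x, r x := by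
    refine (lintegral_prod _ (hm1.mul hm4).aemeasurable).trans ?_
    have (x : RSpace d) : ∫⁻ y, φ x ^ (2 : ℝ) * r (x + y) = φ x ^ (2 : ℝ) * ∫⁻ y, r y := by
      refine (lintegral_const_mul _ (hr.comp (measurable_id.const_add x))).trans ?_
      exact congrArg (φ x ^ (2 : ℝ) * ·) (lintegral_add_left_eq_self r x)
    exact (lintegral_congr this).trans (lintegral_mul_const _ (hφ.pow_const _))
  rw [i0, i1, i2, ENNReal.mul_rpow_of_nonneg _ _ ha, ENNReal.mul_rpow_of_nonneg _ _ hb,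
    ENNReal.mul_rpow_of_nonneg _ _ hc]
  have e1 : Φ ^ (1 / 2 : ℝ) = Φ ^ a * Φ ^ c := by
    rw [← ENNReal.rpow_add_of_nonneg _ _ ha hc]; congr 1; linarith
  have e2 : Vt ^ (1 / t) = Vt ^ a * Vt ^ (1 / 2 : ℝ) := by
    rw [← ENNReal.rpow_add_of_nonneg _ _ ha hb]; congr 1; rw [hadef]; ring
  rw [e1, e2]
  ring

/-! ### Splitting weak `L^s` functions -/

/-- The part above `1` of a function in the unit ball of weak `L^s`, `s > 1`, is integrable, by the
layer cake formula. -/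
theorem lintegral_large_values_lt_top {s : ℝ} (hs : 1 < s) :
    ∃ J : ℝ≥0∞, J < ⊤ ∧ ∀ f : RSpace d → ℝ, AEMeasurable f volume → (∀ x, 0 ≤ f x) →
      (∀ τ : ℝ, 0 < τ → volume {x | τ < f x} ≤ ENNReal.ofReal (τ ^ (-s))) →
      ∫⁻ x, ENNReal.ofReal ({x | 1 < f x}.indicator f x) ≤ J := by
  refine ⟨(∫⁻ _τ in Set.Ioc (0 : ℝ) 1, 1) +
    ∫⁻ τ in Set.Ioi (1 : ℝ), ENNReal.ofReal (τ ^ (-s)), ?_, fun f hfm hf0 hf => ?_⟩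
  · refine ENNReal.add_lt_top.2 ⟨by simp, ?_⟩
    exact (integrableOn_Ioi_rpow_of_lt (by linarith) one_pos).lintegral_lt_top
  · have hnull : NullMeasurableSet {x | 1 < f x} volume :=
      nullMeasurableSet_lt aemeasurable_const hfm
    have h := lintegral_rpow_eq_lintegral_meas_lt_mul (volume : Measure (RSpace d))
      (f := {x | 1 < f x}.indicator f)
      (Filter.Eventually.of_forall fun x => Set.indicator_nonneg (fun x _ => hf0 x) x)
      (hfm.indicator₀ hnull) one_pos
    simp only [Real.rpow_one, ENNReal.ofReal_one, one_mul, sub_self, Real.rpow_zero,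
      mul_one] at h
    rw [h, ← Set.Ioc_union_Ioi_eq_Ioi zero_le_one]
    refine (lintegral_union_le _ _ _).trans (add_le_add ?_ ?_)
    · refine setLIntegral_mono' measurableSet_Ioc fun τ hτ => ?_
      refine (measure_mono fun x hx => ?_).trans ((hf 1 one_pos).trans (by simp))
      by_contra hx1
      rw [Set.mem_ofPred_eq, Set.indicator_of_notMem hx1] at hx
      exact hx.not_ge hτ.1.le
    · refine setLIntegral_mono' measurableSet_Ioi fun τ hτ => ?_
      refine (measure_mono fun x hx => ?_).trans (hf τ (one_pos.trans hτ))
      by_cases hx1 : x ∈ {x | 1 < f x}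
      · simpa [Set.indicator_of_mem hx1] using hx
      · have hτ1 : 1 < τ := hτ
        simp [Set.indicator_of_notMem hx1] at hx
        linarith

/-- The part below `1` of a function in the unit ball of weak `L^s` is in `L^p` for `p > s`. -/
theorem lintegral_small_values_lt_top {s p : ℝ} (hp : 0 < p) (hsp : s < p) :
    ∃ J : ℝ≥0∞, J < ⊤ ∧ ∀ f : RSpace d → ℝ, AEMeasurable f volume → (∀ x, 0 ≤ f x) →
      (∀ τ : ℝ, 0 < τ → volume {x | τ < f x} ≤ ENNReal.ofReal (τ ^ (-s))) →
      ∫⁻ x, ENNReal.ofReal ({x | f x ≤ 1}.indicator f x ^ p) ≤ J := by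
  refine ⟨ENNReal.ofReal p * ∫⁻ τ in Set.Ioc (0 : ℝ) 1, ENNReal.ofReal (τ ^ (p - 1 - s)), ?_,
    fun f hfm hf0 hf => ?_⟩
  · refine ENNReal.mul_lt_top ENNReal.ofReal_lt_top ?_
    have h : IntervalIntegrable (fun τ : ℝ => τ ^ (p - 1 - s)) volume 0 1 :=
      intervalIntegral.intervalIntegrable_rpow' (by linarith)
    rw [intervalIntegrable_iff_integrableOn_Ioc_of_le zero_le_one] at h
    exact h.lintegral_lt_top
  · have hnull : NullMeasurableSet {x | f x ≤ 1} volume :=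
      nullMeasurableSet_le hfm aemeasurable_const
    rw [lintegral_rpow_eq_lintegral_meas_lt_mul (volume : Measure (RSpace d))
      (f := {x | f x ≤ 1}.indicator f)
      (Filter.Eventually.of_forall fun x => Set.indicator_nonneg (fun x _ => hf0 x) x)
      (hfm.indicator₀ hnull) hp, ← Set.Ioc_union_Ioi_eq_Ioi (zero_le_one (α := ℝ))]
    refine mul_le_mul_right ((lintegral_union_le _ _ _).trans ?_) _
    have hsub {τ : ℝ} (hτ : 0 < τ) {x : RSpace d} (hx : τ < {x | f x ≤ 1}.indicator f x) :
        f x ≤ 1 ∧ τ < f x := by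
      by_cases hx1 : x ∈ {x | f x ≤ 1}
      · rw [Set.indicator_of_mem hx1] at hx
        exact ⟨hx1, hx⟩
      · rw [Set.indicator_of_notMem hx1] at hx
        linarith
    have hzero : ∫⁻ τ in Set.Ioi (1 : ℝ), volume {x | τ < {x | f x ≤ 1}.indicator f x} *
        ENNReal.ofReal (τ ^ (p - 1)) = 0 := by
      rw [setLIntegral_congr_fun (g := fun _ => 0) measurableSet_Ioi fun τ hτ => ?_]
      · simp
      · have hτ1 : 1 < τ := hτ
        have : {x | τ < {x | f x ≤ 1}.indicator f x} = ∅ := by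
          refine Set.eq_empty_of_forall_notMem fun x hx => ?_
          have := hsub (one_pos.trans hτ1) hx
          linarith
        simp [this]
    rw [hzero, add_zero]
    refine setLIntegral_mono' measurableSet_Ioc fun τ hτ => ?_
    have hτ0 : 0 < τ := hτ.1
    calc _ ≤ ENNReal.ofReal (τ ^ (-s)) * ENNReal.ofReal (τ ^ (p - 1)) := by
          refine mul_le_mul_left ((measure_mono fun x hx => ?_).trans (hf τ hτ0)) _
          exact (hsub hτ0 hx).2
      _ = _ := by
          rw [← ENNReal.ofReal_mul (by positivity), ← Real.rpow_add hτ0]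
          congr 2; ring

end Young

/-! ### Convolution with an integrable or weakly integrable potential -/

section Interaction

variable {d : ℕ} {ω₁ ω₂ : RSpace d → ℝ} {ξ : RSpace d} {V : RSpace d → ℂ}

/-- With a weak derivative `U = ∂^{p+q} V̂` the derivatives on the test function move to `V̂`. -/
theorem enorm_convT_le {U : RSpace d → ℂ} (p q : Fin d → ℕ) (hU : IsWeakDeriv (p + q) V U)
    {f : RSpace d → ℂ} (hf : IsTest f) (k : RSpace d) :
    ‖convT V p q f k‖ₑ ≤ ∫⁻ y, ‖U y‖ₑ * ‖f (k + y)‖ₑ := by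
  have h1 : convCheck V (mderiv (p + q) f) k =
      (-1) ^ msize (p + q) * ∫ y, U y * f (k + y) := by
    rw [← hU.2 _ (hf.comp_add_left k), mderiv_comp_add_left, convCheck,
      ← integral_neg_eq_self]
    simp only [neg_neg, sub_neg_eq_add]
  have h2 : ‖convT V p q f k‖ = ‖∫ y, U y * f (k + y)‖ := by
    rw [convT, h1]
    simp
  rw [← ofReal_norm, h2, ofReal_norm]
  refine (enorm_integral_le_lintegral_enorm _).trans_eq ?_
  simp only [enorm_mul]

theorem enorm_pairing_convT_le {U : RSpace d → ℂ} (p q : Fin d → ℕ)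
    (hω : IsSmooth (omegaXi ω₁ ω₂ ξ)) (hU : IsWeakDeriv (p + q) V U) (φ : RSpace d → ℂ)
    {ψ : RSpace d → ℂ} (hψ : IsTest ψ) {ρ : RSpace d → ℝ≥0∞}
    (hρ : ∀ x, ‖((omegaXi ω₁ ω₂ ξ x : ℂ) + Complex.I)⁻¹‖ₑ ≤ ρ x) :
    ‖pairing φ (convT V p q (resolvent ω₁ ω₂ ξ ψ))‖ₑ ≤
      ∫⁻ k, ∫⁻ y, ‖φ k‖ₑ * (‖U y‖ₑ * (ρ (k + y) * ‖ψ (k + y)‖ₑ)) := by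
  refine (enorm_integral_le_lintegral_enorm _).trans (lintegral_mono fun k => ?_)
  rw [enorm_mul, lintegral_const_mul' _ _ enorm_ne_top, ← ofReal_norm, RCLike.norm_conj,
    ofReal_norm]
  gcongr
  refine (enorm_convT_le p q hU (hψ.resolvent hω) k).trans (lintegral_mono fun y => ?_)
  rw [resolvent, enorm_mul]
  gcongr
  exact hρ _

theorem eLpNorm_two_eq (φ : RSpace d → ℂ) :
    eLpNorm φ 2 volume = (∫⁻ x, ‖φ x‖ₑ ^ (2 : ℝ)) ^ (1 / 2 : ℝ) := by
  rw [eLpNorm_eq_lintegral_rpow_enorm_toReal (by simp) (by simp)]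
  simp

theorem IsTest.measurable_enorm {φ : RSpace d → ℂ} (h : IsTest φ) :
    Measurable fun x => ‖φ x‖ₑ :=
  h.isSmooth.continuous.measurable.enorm

theorem norm_le_of_enorm_le {z : ℂ} {φ ψ : RSpace d → ℂ} (hφ : IsTest φ) (hψ : IsTest ψ) {N : ℝ}
    (hN : 0 ≤ N)
    (h : ‖z‖ₑ ≤ eLpNorm φ 2 volume * eLpNorm ψ 2 volume * ENNReal.ofReal N) :
    ‖z‖ ≤ N * (l2norm φ * l2norm ψ) := by
  have h1 := ENNReal.toReal_mono (ENNReal.mul_ne_top (ENNReal.mul_ne_top hφ.memLp.eLpNorm_ne_top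
    hψ.memLp.eLpNorm_ne_top) ENNReal.ofReal_ne_top) h
  rw [toReal_enorm, ENNReal.toReal_mul, ENNReal.toReal_mul, ENNReal.toReal_ofReal hN] at h1
  exact h1.trans_eq (mul_comm _ _)

theorem one_le_norm_add_I (t : ℝ) : 1 ≤ ‖(t : ℂ) + Complex.I‖ := by
  have := Complex.abs_im_le_norm ((t : ℂ) + Complex.I)
  simpa using this

theorem abs_le_norm_add_I (t : ℝ) : |t| ≤ ‖(t : ℂ) + Complex.I‖ := by
  have := Complex.abs_re_le_norm ((t : ℂ) + Complex.I)
  simpa using this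

theorem enorm_inv_add_I_le (t : ℝ) : ‖((t : ℂ) + Complex.I)⁻¹‖ₑ ≤ 1 := by
  rw [← ofReal_norm, norm_inv, ENNReal.ofReal_le_one]
  exact inv_le_one_of_one_le₀ (one_le_norm_add_I t)

/-- The case `t = 1` of `lintegral_convolution_le`. -/
theorem lintegral_convolution_one_le {φ ψ v : RSpace d → ℝ≥0∞} (hφ : Measurable φ)
    (hψ : Measurable ψ) (hv : AEMeasurable v volume) :
    ∫⁻ k, ∫⁻ y, φ k * (v y * (1 * ψ (k + y))) ≤
      (∫⁻ x, φ x ^ (2 : ℝ)) ^ (1 / 2 : ℝ) * (∫⁻ x, ψ x ^ (2 : ℝ)) ^ (1 / 2 : ℝ) *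
        ∫⁻ x, v x := by
  have := lintegral_convolution_le hφ hψ (r := fun _ => 1) measurable_const hv le_rfl one_le_two
  simpa using this

theorem L1Bounds.resolventBounds (hω : IsSmooth (omegaXi ω₁ ω₂ ξ)) (hV : LocallyIntegrable V)
    {K c : ℝ} (hK : 0 ≤ K) (hc : 0 ≤ c) (h : L1Bounds V K c) :
    ResolventBounds ω₁ ω₂ V ξ K c := by
  intro β b
  obtain ⟨U, hU, hUb⟩ := h (gam β b)
  have hN : K * mfactorial (gam β b) * c ^ msize (gam β b) =
      K * c ^ size (β + b) * mfactorial (gam β b) := by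
    have : msize (gam β b) = size (β + b) := by
      rw [size_add]; exact Finset.sum_add_distrib
    rw [this]; ring
  rw [hN] at hUb
  refine (isSesquilinear_opT hω hV β b).formNormLE (by positivity) fun φ ψ hφ hψ => ?_
  refine norm_le_of_enorm_le hφ hψ (by positivity) ?_
  refine (enorm_pairing_convT_le _ _ hω hU φ hψ (ρ := fun _ => 1)
    fun x => enorm_inv_add_I_le _).trans ?_
  refine (lintegral_convolution_one_le hφ.measurable_enorm hψ.measurable_enorm
    hU.1.aestronglyMeasurable.enorm).trans ?_
  rw [eLpNorm_two_eq, eLpNorm_two_eq]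
  rw [eLpNorm_one_eq_lintegral_enorm] at hUb
  gcongr

/-- Chebyshev's inequality for the function `|U| / N`, which is normalized in weak `L^s`. -/
theorem volume_le_of_weakNorm_le {s N : ℝ} (hs : 0 < s) (hN : 0 < N) {U : RSpace d → ℂ}
    (h : weakNorm s U ≤ ENNReal.ofReal N) {τ : ℝ} (hτ : 0 < τ) :
    volume {x | τ < ‖U x‖ / N} ≤ ENNReal.ofReal (τ ^ (-s)) := by
  have h1 : ((τ * N).toNNReal : ℝ≥0∞) *
      volume {x | ((τ * N).toNNReal : ℝ) < ‖U x‖} ^ (1 / s) ≤ ENNReal.ofReal N :=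
    (le_iSup (fun t : ℝ≥0 => (t : ℝ≥0∞) * volume {x | (t : ℝ) < ‖U x‖} ^ (1 / s)) _).trans h
  have hset : {x | τ < ‖U x‖ / N} = {x | ((τ * N).toNNReal : ℝ) < ‖U x‖} := by
    ext x
    rw [Real.coe_toNNReal _ (by positivity)]
    exact lt_div_iff₀ hN
  rw [← hset, ← ENNReal.ofReal, ENNReal.ofReal_mul hτ.le] at h1
  set μ := volume {x | τ < ‖U x‖ / N}
  have hN0 : ENNReal.ofReal N ≠ 0 := by simpa using hN
  have hτ0 : ENNReal.ofReal τ ≠ 0 := by simpa using hτ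
  have h2 : μ ^ (1 / s) ≤ (ENNReal.ofReal τ)⁻¹ := by
    rw [ENNReal.le_inv_iff_mul_le, ← ENNReal.mul_le_mul_iff_left hN0 ENNReal.ofReal_ne_top,
      one_mul]
    refine le_trans (le_of_eq ?_) h1
    ring
  have h3 := ENNReal.rpow_le_rpow h2 hs.le
  rw [← ENNReal.rpow_mul, one_div_mul_cancel hs.ne', ENNReal.rpow_one, ENNReal.inv_rpow,
    ← ENNReal.rpow_neg, ENNReal.ofReal_rpow_of_pos hτ] at h3
  exact h3

/-- If the resolvent decays like `⟨k⟩^{-s₂}`, then convolution with a function in weak `L^s`,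
followed by the resolvent, is bounded. The strict inequalities for `1/s` leave room to split the
function `U` at `|U| = N` into a part in `L^1` and a part in `L^p` for some `p > s`; so the weak
Young inequality is not needed. -/
theorem exists_weakLs_bound {s s₂ B : ℝ} (hs1 : 1 < s)
    (hs : max (1 / 2) (1 - s₂ / d) < 1 / s) (hd : 0 < d) (hω : IsSmooth (omegaXi ω₁ ω₂ ξ))
    (hB : ∀ k, ‖((omegaXi ω₁ ω₂ ξ k : ℂ) + Complex.I)⁻¹‖ ≤ B * jap k ^ (-s₂)) :
    ∃ K' : ℝ, 0 < K' ∧ ∀ (V U : RSpace d → ℂ) (p q : Fin d → ℕ) (N : ℝ), 0 < N →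
      IsWeakDeriv (p + q) V U → weakNorm s U ≤ ENNReal.ofReal N → ∀ φ ψ : RSpace d → ℂ,
        IsTest φ → IsTest ψ → ‖pairing φ (convT V p q (resolvent ω₁ ω₂ ξ ψ))‖ ≤
          K' * N * (l2norm φ * l2norm ψ) := by
  have hs0 : 0 < s := by linarith
  have hd' : (0 : ℝ) < d := by exact_mod_cast hd
  -- `θ = 1 / t` lies strictly between the lower bound and `1 / s`, so that `s < t < 2` and the
  -- resolvent is in `L^{1 / (1 - θ)}`
  obtain ⟨θ, hθ1, hθ2⟩ := exists_between hs
  rw [max_lt_iff] at hθ1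
  have hθ0 : 0 < θ := by linarith [hθ1.1]
  have hs' : 1 / s < 1 := by rw [div_lt_one hs0]; exact hs1
  set t : ℝ := 1 / θ with ht
  have hθt : 1 / t = θ := by rw [ht, one_div_one_div]
  have ht0 : 0 < t := by positivity
  have hst : s < t := by
    rw [ht, lt_one_div hs0 hθ0]; exact hθ2
  have ht2 : t ≤ 2 := by
    rw [ht, one_div_le hθ0 two_pos]; exact hθ1.1.le
  have ht1 : 1 ≤ t := by linarith
  have hc0 : 0 < 1 - θ := by linarith
  have hdim : (d : ℝ) < s₂ / (1 - θ) := by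
    have h1 := hθ1.2
    rw [lt_div_iff₀ hc0]
    have h2 : 1 - θ < s₂ / d := by linarith
    rw [lt_div_iff₀ hd'] at h2
    linarith
  have hB0 : 0 ≤ B := by
    have h1 := (norm_nonneg _).trans (hB 0)
    exact nonneg_of_mul_nonneg_left h1 (Real.rpow_pos_of_pos (jap_pos _) _)
  -- the resolvent is bounded by `r^{1 - θ}` with an integrable function `r`
  set r : RSpace d → ℝ := fun x => B ^ (1 / (1 - θ)) * (1 + ‖x‖ ^ 2) ^ (-(s₂ / (1 - θ)) / 2)
    with hr
  have hrint : Integrable r := by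
    refine (integrable_rpow_neg_one_add_norm_sq ?_).const_mul _
    simpa using hdim
  have hr0 (x : RSpace d) : 0 ≤ r x := by
    have := one_add_norm_sq_pos x
    positivity
  have hrB (x : RSpace d) : r x ^ (1 - θ) = B * jap x ^ (-s₂) := by
    have hx := one_add_norm_sq_pos x
    rw [hr]
    simp only
    rw [Real.mul_rpow (by positivity) (by positivity), ← Real.rpow_mul hB0,
      one_div_mul_cancel hc0.ne', Real.rpow_one, ← Real.rpow_mul hx.le, jap,
      Real.sqrt_eq_rpow, ← Real.rpow_mul hx.le]
    congr 2
    field_simp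
  set Rr : ℝ≥0∞ := ∫⁻ x, ENNReal.ofReal (r x) with hRr
  have hRr_top : Rr < ⊤ := hrint.lintegral_lt_top
  obtain ⟨J₁, hJ₁, hJ₁b⟩ := lintegral_large_values_lt_top (d := d) hs1
  obtain ⟨J₂, hJ₂, hJ₂b⟩ := lintegral_small_values_lt_top (d := d) ht0 hst
  set K₀ : ℝ≥0∞ := J₁ + J₂ ^ θ * Rr ^ (1 - θ) with hK₀
  have hK₀_top : K₀ ≠ ⊤ := by
    refine (ENNReal.add_lt_top.2 ⟨hJ₁, ENNReal.mul_lt_top ?_ ?_⟩).ne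
    · exact ENNReal.rpow_lt_top_of_nonneg hθ0.le hJ₂.ne
    · exact ENNReal.rpow_lt_top_of_nonneg hc0.le hRr_top.ne
  refine ⟨K₀.toReal + 1, by positivity, fun V U p q N hN hU hUN φ ψ hφ hψ => ?_⟩
  refine norm_le_of_enorm_le hφ hψ (by positivity) ?_
  -- after division by `N` the function is normalized in weak `L^s` and is split at the value `1`
  set f : RSpace d → ℝ := fun x => ‖U x‖ / N with hf
  have hfm : AEMeasurable f volume := hU.1.aestronglyMeasurable.norm.aemeasurable.div_const N
  have hf0 (x : RSpace d) : 0 ≤ f x := by positivity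
  have hfw (τ : ℝ) (hτ : 0 < τ) := volume_le_of_weakNorm_le hs0 hN hUN hτ
  set v₁ : RSpace d → ℝ≥0∞ := fun x => ENNReal.ofReal ({x | 1 < f x}.indicator f x) with hv₁
  set v₂ : RSpace d → ℝ≥0∞ := fun x => ENNReal.ofReal ({x | f x ≤ 1}.indicator f x) with hv₂
  have hv₁m : AEMeasurable v₁ volume :=
    (hfm.indicator₀ (nullMeasurableSet_lt aemeasurable_const hfm)).ennreal_ofReal
  have hv₂m : AEMeasurable v₂ volume :=
    (hfm.indicator₀ (nullMeasurableSet_le hfm aemeasurable_const)).ennreal_ofReal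
  have hUv (y : RSpace d) : ‖U y‖ₑ = ENNReal.ofReal N * (v₁ y + v₂ y) := by
    have h1 : ‖U y‖ₑ = ENNReal.ofReal N * ENNReal.ofReal (f y) := by
      rw [← ENNReal.ofReal_mul hN.le, hf, mul_div_cancel₀ _ hN.ne', ofReal_norm]
    rw [h1, hv₁, hv₂]
    by_cases hy : f y ≤ 1
    · simp [Set.indicator, hy, hy.not_gt]
    · simp [Set.indicator, hy, not_le.1 hy]
  set ρ : RSpace d → ℝ≥0∞ := fun x => ‖((omegaXi ω₁ ω₂ ξ x : ℂ) + Complex.I)⁻¹‖ₑ with hρ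
  have hρ1 (x : RSpace d) : ρ x ≤ 1 := enorm_inv_add_I_le _
  have hρr (x : RSpace d) : ρ x ≤ ENNReal.ofReal (r x) ^ (1 - 1 / t) := by
    rw [hθt, ENNReal.ofReal_rpow_of_nonneg (hr0 x) hc0.le, hrB, hρ]
    simp only
    rw [← ofReal_norm]
    exact ENNReal.ofReal_le_ofReal (hB x)
  have hrm : Measurable fun x => ENNReal.ofReal (r x) := by
    have : Continuous r := by
      refine continuous_const.mul (Continuous.rpow_const (by fun_prop) fun x => Or.inl ?_)
      exact (one_add_norm_sq_pos x).ne'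
    exact this.measurable.ennreal_ofReal
  have i1 : ∫⁻ k, ∫⁻ y, ‖φ k‖ₑ * (v₁ y * (1 * ‖ψ (k + y)‖ₑ)) ≤
      eLpNorm φ 2 volume * eLpNorm ψ 2 volume * J₁ := by
    refine (lintegral_convolution_one_le hφ.measurable_enorm hψ.measurable_enorm hv₁m).trans ?_
    rw [eLpNorm_two_eq, eLpNorm_two_eq]
    gcongr
    exact hJ₁b f hfm hf0 hfw
  have i2 : ∫⁻ k, ∫⁻ y, ‖φ k‖ₑ *
      (v₂ y * (ENNReal.ofReal (r (k + y)) ^ (1 - 1 / t) * ‖ψ (k + y)‖ₑ)) ≤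
      eLpNorm φ 2 volume * eLpNorm ψ 2 volume * (J₂ ^ θ * Rr ^ (1 - θ)) := by
    refine (lintegral_convolution_le hφ.measurable_enorm hψ.measurable_enorm hrm hv₂m ht1
      ht2).trans ?_
    rw [eLpNorm_two_eq, eLpNorm_two_eq, hθt]
    gcongr
    refine le_trans (le_of_eq (lintegral_congr fun x => ?_)) (hJ₂b f hfm hf0 hfw)
    rw [hv₂]
    exact ENNReal.ofReal_rpow_of_nonneg (Set.indicator_nonneg (fun x _ => hf0 x) x) ht0.le
  have hm1 (k : RSpace d) : AEMeasurable
      (fun y => ‖φ k‖ₑ * (v₁ y * (1 * ‖ψ (k + y)‖ₑ))) volume :=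
    aemeasurable_const.mul (hv₁m.mul (aemeasurable_const.mul
      (hψ.measurable_enorm.comp (measurable_id.const_add k)).aemeasurable))
  have hprod : AEMeasurable (fun z : RSpace d × RSpace d =>
      ‖φ z.1‖ₑ * (v₁ z.2 * (1 * ‖ψ (z.1 + z.2)‖ₑ)))
      ((volume : Measure (RSpace d)).prod volume) :=
    (hφ.measurable_enorm.comp measurable_fst).aemeasurable.mul (hv₁m.comp_snd.mul
      (aemeasurable_const.mul
        (hψ.measurable_enorm.comp (measurable_fst.add measurable_snd)).aemeasurable))
  calc ‖pairing φ (convT V p q (resolvent ω₁ ω₂ ξ ψ))‖ₑ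
      ≤ ∫⁻ k, ∫⁻ y, ‖φ k‖ₑ * (‖U y‖ₑ * (ρ (k + y) * ‖ψ (k + y)‖ₑ)) :=
        enorm_pairing_convT_le p q hω hU φ hψ fun _ => le_rfl
    _ ≤ ∫⁻ k, ∫⁻ y, ENNReal.ofReal N * (‖φ k‖ₑ * (v₁ y * (1 * ‖ψ (k + y)‖ₑ)) +
          ‖φ k‖ₑ * (v₂ y * (ENNReal.ofReal (r (k + y)) ^ (1 - 1 / t) * ‖ψ (k + y)‖ₑ))) := by
        refine lintegral_mono fun k => lintegral_mono fun y => ?_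
        simp only
        rw [hUv]
        calc _ = ENNReal.ofReal N * (‖φ k‖ₑ * (v₁ y * (ρ (k + y) * ‖ψ (k + y)‖ₑ)) +
              ‖φ k‖ₑ * (v₂ y * (ρ (k + y) * ‖ψ (k + y)‖ₑ))) := by ring
          _ ≤ _ := by
              gcongr
              · exact hρ1 _
              · exact hρr _
    _ = ENNReal.ofReal N * ((∫⁻ k, ∫⁻ y, ‖φ k‖ₑ * (v₁ y * (1 * ‖ψ (k + y)‖ₑ))) +
          ∫⁻ k, ∫⁻ y, ‖φ k‖ₑ *
            (v₂ y * (ENNReal.ofReal (r (k + y)) ^ (1 - 1 / t) * ‖ψ (k + y)‖ₑ))) := by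
        rw [← lintegral_add_left' hprod.lintegral_prod_right', ← lintegral_const_mul' _ _
          ENNReal.ofReal_ne_top]
        refine lintegral_congr fun k => ?_
        rw [← lintegral_add_left' (hm1 k), ← lintegral_const_mul' _ _ ENNReal.ofReal_ne_top]
    _ ≤ ENNReal.ofReal N * (eLpNorm φ 2 volume * eLpNorm ψ 2 volume * J₁ +
          eLpNorm φ 2 volume * eLpNorm ψ 2 volume * (J₂ ^ θ * Rr ^ (1 - θ))) := by gcongr
    _ = eLpNorm φ 2 volume * eLpNorm ψ 2 volume * (K₀ * ENNReal.ofReal N) := by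
        rw [hK₀]; ring
    _ ≤ _ := by
        rw [ENNReal.ofReal_mul (by positivity)]
        gcongr
        refine le_trans (le_of_eq (ENNReal.ofReal_toReal hK₀_top).symm) ?_
        exact ENNReal.ofReal_le_ofReal (by linarith)

/-! ### Decay of the resolvent -/

theorem norm_inv_le_of_lower_bound {s₂ L : ℝ} (hL : 0 < L)
    (h : ∀ k, jap k ^ s₂ / L - L ≤ |omegaXi ω₁ ω₂ ξ k|) (k : RSpace d) :
    ‖((omegaXi ω₁ ω₂ ξ k : ℂ) + Complex.I)⁻¹‖ ≤ (L + L ^ 2) * jap k ^ (-s₂) := by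
  have hpos := one_le_norm_add_I (omegaXi ω₁ ω₂ ξ k)
  have h1 := (h k).trans (abs_le_norm_add_I _)
  have hj : 0 < jap k ^ s₂ := Real.rpow_pos_of_pos (jap_pos k) _
  rw [norm_inv, Real.rpow_neg (jap_pos k).le, ← div_eq_mul_inv, inv_le_iff_one_le_mul₀ (by linarith),
    div_mul_eq_mul_div, le_div_iff₀ hj, one_mul]
  set n := ‖(omegaXi ω₁ ω₂ ξ k : ℂ) + Complex.I‖
  rw [sub_le_iff_le_add, div_le_iff₀ hL] at h1
  nlinarith [sq_nonneg L, mul_nonneg (sq_nonneg L) (by linarith : 0 ≤ n - 1)]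

/-- If `s₁ < s₂`, then `ω₂` dominates in `ω_ξ` at infinity. -/
theorem DispersionCondition.exists_lower_bound {s₁ s₂ : ℝ}
    (h : DispersionCondition ω₁ ω₂ s₁ s₂) (hlt : s₁ < s₂) (ξ : RSpace d) :
    ∃ L : ℝ, 0 < L ∧ ∀ k, jap k ^ s₂ / L - L ≤ |omegaXi ω₁ ω₂ ξ k| := by
  obtain ⟨R, C, hR, hC, ⟨Ω₁, -, hω₁, hb₁⟩, ⟨Ω₂, -, hω₂, hb₂⟩⟩ := h.bounds
  have hmem (x : RSpace d) := complexify_mem_strip (by positivity : 0 < 2 * R) x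
  have hjc (x : RSpace d) : jap (complexify x) = jap x := by simp only [jap, norm_complexify]
  have h1 (x : RSpace d) : |ω₁ x| ≤ C * jap x ^ s₁ := by
    have := (hb₁ _ (hmem x)).1
    rwa [hω₁, Complex.norm_real, hjc] at this
  have h2 (x : RSpace d) : jap x ^ s₂ / C - C ≤ |ω₂ x| := by
    have := (hb₂ _ (hmem x)).2.2
    rwa [hω₂, Complex.norm_real, hjc] at this
  set e : ℝ := max s₁ 0 with he
  have he2 : e < s₂ := max_lt hlt h.pos
  have he0 : 0 ≤ e := le_max_right _ _
  set D : ℝ := C * (2 * jap ξ) ^ e with hD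
  have hjξ := jap_pos ξ
  have hD0 : 0 ≤ D := by positivity
  have h3 (k : RSpace d) : |ω₁ (ξ - k)| ≤ D * jap k ^ e := by
    calc |ω₁ (ξ - k)| ≤ C * jap (ξ - k) ^ s₁ := h1 _
      _ ≤ C * (2 * (jap ξ * jap k)) ^ e := by
          refine mul_le_mul_of_nonneg_left ?_ hC.le
          exact (Real.rpow_le_rpow_of_exponent_le (one_le_jap _) (le_max_left _ _)).trans
            (Real.rpow_le_rpow (jap_pos _).le (jap_sub_le _ _) he0)
      _ = D * jap k ^ e := by
          rw [hD, ← mul_assoc 2, Real.mul_rpow (by positivity) (jap_pos k).le, mul_assoc]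
  -- beyond `⟨k⟩ = T` the term `D ⟨k⟩^e` is at most half of `⟨k⟩^{s₂} / C`
  set T : ℝ := (2 * C * D) ^ (1 / (s₂ - e)) with hT
  have hT0 : 0 ≤ T := by positivity
  have h4 (k : RSpace d) : D * jap k ^ e ≤ jap k ^ s₂ / (2 * C) + D * T ^ e := by
    have hk := jap_pos k
    rcases le_total (jap k) T with hkT | hkT
    · have h5 : D * jap k ^ e ≤ D * T ^ e := by gcongr
      have h6 : 0 ≤ jap k ^ s₂ / (2 * C) := by positivity
      linarith
    · have h5 : 2 * C * D ≤ jap k ^ (s₂ - e) := by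
        have h6 := Real.rpow_le_rpow hT0 hkT (sub_pos.2 he2).le
        rwa [hT, ← Real.rpow_mul (by positivity), one_div_mul_cancel (sub_pos.2 he2).ne',
          Real.rpow_one] at h6
      have h6 : D * jap k ^ e ≤ jap k ^ s₂ / (2 * C) := by
        rw [le_div_iff₀ (by positivity)]
        calc D * jap k ^ e * (2 * C) = 2 * C * D * jap k ^ e := by ring
          _ ≤ jap k ^ (s₂ - e) * jap k ^ e := by gcongr
          _ = jap k ^ s₂ := by rw [← Real.rpow_add hk, sub_add_cancel]
      have h7 : 0 ≤ D * T ^ e := by positivity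
      linarith
  set L : ℝ := 2 * C + D * T ^ e with hL
  have hDT : 0 ≤ D * T ^ e := by positivity
  have hL0 : 0 < L := by positivity
  refine ⟨L, hL0, fun k => ?_⟩
  have h5 : |ω₂ k| - |ω₁ (ξ - k)| ≤ |omegaXi ω₁ ω₂ ξ k| := by
    have := abs_sub_abs_le_abs_sub (ω₂ k) (-ω₁ (ξ - k))
    rwa [abs_neg, sub_neg_eq_add, add_comm (ω₂ k)] at this
  have hjp : 0 < jap k ^ s₂ := Real.rpow_pos_of_pos (jap_pos k) _
  have h6 : jap k ^ s₂ / L ≤ jap k ^ s₂ / (2 * C) :=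
    div_le_div_of_nonneg_left hjp.le (by positivity) (by linarith)
  have h7 : jap k ^ s₂ / C = jap k ^ s₂ / (2 * C) + jap k ^ s₂ / (2 * C) := by
    field_simp; norm_num
  have h8 := h2 k
  have h9 := h3 k
  have h10 := h4 k
  linarith

end Interaction

end DispersivePair

open DispersivePair
theorem theorem8p4 (d : ℕ) (hd : 0 < d) :
    ∃ c_d : ℝ, 0 < c_d ∧
      (∀ k : ℕ, (indexSet d k).Finite ∧ ((indexSet d k).ncard : ℝ) ≤ c_d ^ k) ∧
      ∀ (ω₁ ω₂ : RSpace d → ℝ) (s₁ s₂ : ℝ), DispersionCondition ω₁ ω₂ s₁ s₂ →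
        -- part (i)
        (∃ C'' : RSpace d → ℝ, Continuous C'' ∧ (∀ ξ, 0 < C'' ξ) ∧
          (∀ (ξ : RSpace d) (α : Polyindex1) (β : Polyindex d) (h : RSpace d),
            ‖fAlphaBeta ω₁ ω₂ ξ α β h‖ ≤
              C'' ξ ^ (order1 α + order β) * weight s₂ h ^ size β *
                (barFactorial1 α * barFactorial β)) ∧
          ∀ c : ℝ, 0 < c → ∃ C : ℝ, 1 < C ∧
            ∀ Vhat : RSpace d → ℂ, LocallyIntegrable Vhat → ∀ (ξ : RSpace d) (K : ℝ),
              WeightedBounds ω₁ ω₂ s₂ Vhat ξ K c →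
                ∀ k : ℕ, AdNormLE ω₁ ω₂ Vhat ξ k (K * (C * C'' ξ * c_d) ^ k * (Nat.factorial k : ℝ))) ∧
        -- part (ii)
        (∀ c : ℝ, 0 < c → ∃ c' : ℝ, 0 < c' ∧
          ∀ Vhat : RSpace d → ℂ, LocallyIntegrable Vhat → ∀ (ξ : RSpace d) (K : ℝ),
            ResolventBounds ω₁ ω₂ Vhat ξ K c → WeightedBounds ω₁ ω₂ s₂ Vhat ξ K c') ∧
        -- part (iii), weak `L^s` condition
        (∀ s : ℝ, 1 < s → max (1 / 2) (1 - s₂ / d) < 1 / s → 1 / s ≤ 2 / d →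
          ∀ ξ : RSpace d,
            (s₁ < s₂ ∨ ∃ L : ℝ, 0 < L ∧ ∀ k, jap k ^ s₂ / L - L ≤ |omegaXi ω₁ ω₂ ξ k|) →
            ∃ K' : ℝ, 0 < K' ∧
              ∀ Vhat : RSpace d → ℂ, LocallyIntegrable Vhat → ∀ K c : ℝ, 0 < K → 0 < c →
                WeakLsBounds s Vhat K c → ResolventBounds ω₁ ω₂ Vhat ξ (K' * K) c) ∧
        -- part (iii), `L¹` condition
        (∀ ξ : RSpace d, ∀ Vhat : RSpace d → ℂ, LocallyIntegrable Vhat →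
          ∀ K c : ℝ, 0 < K → 0 < c →
            L1Bounds Vhat K c → ResolventBounds ω₁ ω₂ Vhat ξ K c) := by
  refine ⟨3 ^ (2 + 2 * d), by positivity, fun k => ?_, fun ω₁ ω₂ s₁ s₂ h => ⟨?_, ?_, ?_, ?_⟩⟩
  · obtain ⟨hfin, hcard⟩ := indexSet_card d k
    exact ⟨hfin, by exact_mod_cast hcard⟩
  · obtain ⟨C, hC, hCb⟩ := h.exists_iterate_bound
    refine ⟨fun _ => C, continuous_const, fun _ => hC,
      fun ξ α β x => norm_fAlphaBeta_le (hCb ξ).1 (hCb ξ).2 α β x, fun c hc => ?_⟩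
    refine ⟨2 + 2 * c * (1 + d), by nlinarith [hc, d.cast_nonneg (α := ℝ)],
      fun V hV ξ K hW k => ?_⟩
    refine hW.adNormLE (h.isSmooth_omegaXi ξ) hV hC.le hc.le (hCb ξ).1 (hCb ξ).2 k ?_
    have hK := hW.nonneg
    have h3 : (1 : ℝ) ≤ 3 ^ (2 + 2 * d) := one_le_pow₀ (by norm_num)
    have hE : C * (2 + 2 * c * (1 + d)) ≤ (2 + 2 * c * (1 + d)) * C * 3 ^ (2 + 2 * d) := by
      have : 0 ≤ (2 + 2 * c * (1 + d)) * C := by positivity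
      nlinarith
    gcongr
  · obtain ⟨G, hG1, hG⟩ := exists_weight_le (d := d) s₂
    exact fun c hc => ⟨c * G, by positivity, fun V hV ξ K hR =>
      hR.weightedBounds (h.isSmooth_omegaXi ξ) hV hG⟩
  · intro s hs1 hs _ ξ hξ
    obtain ⟨L, hL, hLb⟩ : ∃ L : ℝ, 0 < L ∧ ∀ k, jap k ^ s₂ / L - L ≤ |omegaXi ω₁ ω₂ ξ k| :=
      hξ.elim (fun hlt => h.exists_lower_bound hlt ξ) id
    have hω := h.isSmooth_omegaXi ξ
    obtain ⟨K', hK', hb⟩ := exists_weakLs_bound hs1 hs hd hω (norm_inv_le_of_lower_bound hL hLb)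
    refine ⟨K', hK', fun V hV K c hK hc hw β b => ?_⟩
    obtain ⟨U, hU, hUb⟩ := hw (gam β b)
    have hfac : (0 : ℝ) < mfactorial (gam β b) := by
      exact_mod_cast Finset.prod_pos fun σ _ => Nat.factorial_pos _
    refine (isSesquilinear_opT hω hV β b).formNormLE (by positivity) fun φ ψ hφ hψ => ?_
    refine (hb V U _ _ _ (by positivity) hU hUb φ ψ hφ hψ).trans_eq ?_
    have hsize : msize (gam β b) = size (β + b) := by
      rw [size_add]; exact Finset.sum_add_distrib
    rw [hsize]
    ring
  · exact fun ξ V hV K c hK hc hL =>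
      hL.resolventBounds (h.isSmooth_omegaXi ξ) hV hK.le hc.le
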